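/- **Proposition (modulated entropy bound).** Let $d\ge 2$, let $\Omega\subset\mathbb R^d$ be a bounded open set with $C^\infty$ boundary, with outward unit normal $n(x)$ and surface measure $d\sigma_x$ on $\partial\Omega$. Let $M(v)=(2\pi)^{-d/2}e^{-|v|^2/2}$, let $\Sigma_\pm=\{(x,v)\in\partial\Omega\times\mathbb R^d:\ \pm v\cdot n(x)>0\}$, and let $d\mu_x(v)=\sqrt{2\pi}\,M(v)\,(v\cdot n(x))_+\,dv$, a probability measure. Let $b(z,\omega)\ge 0$ ($z\in\mathbb R^d$, $\omega\in\mathbb S^{d-1}$) be a measurable cross-section such that $b(z,\omega)+b(z,-\omega)$ depends only on $|z|$ and $|z\cdot\omega|$, and such that for some constants $C,c>0$ and integers $k,l\ge 0$ $$b(z,\omega)\le C(1+|z|)^k,\qquad c\,|z\cdot\omega|\le (1+|z|)^l\,\big(b(z,\omega)+b(z,-\omega)\big)$$ (for instance hard spheres, $b(z,\omega)=(z\cdot\omega)_+$). With $v'=v-((v-v_*)\cdot\omega)\,\omega$ and $v'_*=v_*+((v-v_*)\cdot\omega)\,\omega$ set $$\mathcal L h(v)=\int\big(h(v_*)+h(v)-h(v'_*)-h(v')\big)M(v_*)\,b(v-v_*,\omega)\,dv_*d\omega,\qquad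 a(v)=\int M(v_*)\,b(v-v_*,\omega)\,dv_*d\omega .$$ Let $\bar\theta$ be a function on $\partial\Omega$ that has a $C^\infty$ extension, and let $\tilde\theta\in C^\infty(\mathbb R^d)$ be such an extension, $\tilde\theta_{|\partial\Omega}=\bar\theta$. For $\alpha>0$ let $g_\alpha=g_\alpha(t,x,v)$ be a strong $L^2$ solution on $[0,\infty)\times\Omega\times\mathbb R^d$ of $$\alpha\,\partial_t g_\alpha+v\cdot\nabla_x g_\alpha=-\frac1\alpha\,\mathcal L g_\alpha,\qquad g_\alpha=\bar\theta\,\frac{|v|^2-(d+1)}2+\int g_\alpha\,d\mu_x\quad\text{on }\Sigma_- .$$ Here a strong $L^2$ solution means the following: $g_\alpha(t)\in L^2(M\,dv\,dx)$ for all $t\ge0$; for every $T$, $g_\alpha\in L^2([0,T];L^2(aM\,dv\,dx))$, and the trace of $g_\alpha$ on $\partial\Omega\times\mathbb R^d$ is in $L^2([0,T];L^2(|v\cdot n|M\,dv\,d\sigma_x))$; the boundary condition holds almost everywhere; the equation and the trace satisfy Green's formula between any two times $0\le t_1\le t_2$ against all $\varphi\in C^\infty_c(\mathbb R\times\mathbb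 R^d\times\mathbb R^d)$; and on each $[0,T]$ there are $\varphi_k\in C_c^\infty(\mathbb R\times\mathbb R^d\times\mathbb R^d)$ with $\varphi_k\to g_\alpha$ in $L^2(aM\,dv\,dx\,dt)$, $(\alpha\partial_t+v\cdot\nabla_x)\varphi_k\to-\frac1\alpha\mathcal Lg_\alpha$ in $L^2(a^{-1}M\,dv\,dx\,dt)$, $\varphi_k\to g_\alpha$ on $\partial\Omega\times\mathbb R^d$ in $L^2(|v\cdot n|M\,dv\,d\sigma_x\,dt)$, and $\varphi_k(t)\to g_\alpha(t)$ in $L^2(M\,dv\,dx)$ for each $t\in[0,T]$. Put $$\tilde g_\alpha(t,x,v)=g_\alpha(t,x,v)-\tilde\theta(x)\,\frac{|v|^2-(d+2)}2 .$$ Then for every $C_0$ there is a function $C(t)$, depending on $d,\Omega,b,\tilde\theta,C_0$ but neither on $\alpha$ nor on the solution, such that for every $\alpha>0$ and every such $g_\alpha$ with $\int M g_\alpha^2(0,x,v)\,dx\,dv\le C_0$, for all $t\ge 0$ the three integrals below converge absolutely and $$\int M\tilde g_\alpha^2(t,x,v)\,dx\,dv+\frac1{\alpha^2}\int_0^t\!\!\int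 M\,\tilde g_\alpha\,\mathcal L\tilde g_\alpha(s,x,v)\,dx\,dv\,ds+\frac1{\alpha\sqrt{2\pi}}\int_0^t\!\!\int_{\Sigma_+}\Big(\tilde g_\alpha-\int\tilde g_\alpha\,d\mu_x\Big)^2d\mu_x(v)\,d\sigma_x\,ds\le C(t).$$ -/

import Mathlib

open MeasureTheory Filter Topology
open scoped RealInnerProductSpace ENNReal

noncomputable section

namespace LinBoltz

/-- The Euclidean space `ℝ^d`, used both for positions and for velocities. -/
abbrev Vec (d : ℕ) := EuclideanSpace ℝ (Fin d)

/-! ### Domains with smooth boundary -/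

/-- `ρ` is a smooth function with non-vanishing gradient at `x`, and near `x` the set `Ω` is
`{ρ < 0}`. -/
def IsDefiningAt {d : ℕ} (Ω : Set (Vec d)) (x : Vec d) (ρ : Vec d → ℝ) : Prop :=
  ContDiff ℝ (⊤ : ℕ∞) ρ ∧ gradient ρ x ≠ 0 ∧ ∀ᶠ y in 𝓝 x, (y ∈ Ω ↔ ρ y < 0)

/-- Bounded open sets with `C^∞` boundary. -/
structure IsSmoothBoundedDomain {d : ℕ} (Ω : Set (Vec d)) : Prop where
  isOpen : IsOpen Ω
  isBounded : Bornology.IsBounded Ω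
  smooth : ∀ x ∈ frontier Ω, ∃ ρ, IsDefiningAt Ω x ρ

/-- `ν` is the outward unit normal to `Ω` at the boundary point `x`. -/
def IsOutwardUnitNormal {d : ℕ} (Ω : Set (Vec d)) (x ν : Vec d) : Prop :=
  ∃ ρ, IsDefiningAt Ω x ρ ∧ ν = ‖gradient ρ x‖⁻¹ • gradient ρ x

/-- The surface measure `dσ_x` on `∂Ω`: the `(d-1)`-dimensional Hausdorff measure, normalised so
that it agrees with Lebesgue measure on hyperplanes. -/
def surfaceMeasure {d : ℕ} (Ω : Set (Vec d)) : Measure (Vec d) :=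
  (Measure.euclideanHausdorffMeasure (d - 1)).restrict (frontier Ω)

/-! ### The Gaussian equilibrium and the linearised collision operator -/

/-- `M(v) = (2π)^{-d/2} exp(-|v|²/2)`. -/
def maxwellian {d : ℕ} (v : Vec d) : ℝ :=
  (2 * Real.pi) ^ (-(d : ℝ) / 2) * Real.exp (-‖v‖ ^ 2 / 2)

/-- The measure `dv_* dω` on `ℝ^d × S^{d-1}`. -/
def collisionMeasure (d : ℕ) : Measure (Vec d × Metric.sphere (0 : Vec d) 1) :=
  (volume : Measure (Vec d)).prod (volume : Measure (Vec d)).toSphere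

/-- Collision cross-sections `b(z, ω)` (hard potentials or Maxwell molecules with angular cutoff,
hard spheres `b(z, ω) = (z · ω)_+`, ...). The directions `ω` and `-ω` describe the same collision,
so only `b(z, ω) + b(z, -ω)` matters; this is a function of `|z|` and `|z · ω|`. -/
structure IsCrossSection {d : ℕ} (b : Vec d → Vec d → ℝ) : Prop where
  measurable : Measurable (Function.uncurry b)
  nonneg : ∀ z ω, ‖ω‖ = 1 → 0 ≤ b z ω
  invariant : ∀ z ω z' ω', ‖ω‖ = 1 → ‖ω'‖ = 1 → ‖z‖ = ‖z'‖ → |⟪z, ω⟫| = |⟪z', ω'⟫| →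
    b z ω + b z (-ω) = b z' ω' + b z' (-ω')
  upper : ∃ C : ℝ, ∃ k : ℕ, ∀ z ω, ‖ω‖ = 1 → b z ω ≤ C * (1 + ‖z‖) ^ k
  lower : ∃ c : ℝ, 0 < c ∧ ∃ k : ℕ, ∀ z ω, ‖ω‖ = 1 →
    c * |⟪z, ω⟫| ≤ (1 + ‖z‖) ^ k * (b z ω + b z (-ω))

/-- The collision frequency `a(v) = ∫ M(v_*) b(v - v_*, ω) dv_* dω`. -/
def collisionFrequency {d : ℕ} (b : Vec d → Vec d → ℝ) (v : Vec d) : ℝ :=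
  ∫ p, maxwellian p.1 * b (v - p.1) p.2 ∂(collisionMeasure d)

/-- The post-collisional velocity `v' = v - ((v - v_*) · ω) ω`. -/
def postVel {d : ℕ} (v vs ω : Vec d) : Vec d := v - ⟪v - vs, ω⟫ • ω

/-- The post-collisional velocity `v'_* = v_* + ((v - v_*) · ω) ω`. -/
def postVelStar {d : ℕ} (v vs ω : Vec d) : Vec d := vs + ⟪v - vs, ω⟫ • ω

/-- The linearised collision operator
`𝓛 h (v) = ∫ (h(v_*) + h(v) - h(v'_*) - h(v')) M(v_*) b(v - v_*, ω) dv_* dω`. -/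
def linColl {d : ℕ} (b : Vec d → Vec d → ℝ) (h : Vec d → ℝ) (v : Vec d) : ℝ :=
  ∫ p, (h p.1 + h v - h (postVelStar v p.1 p.2) - h (postVel v p.1 p.2))
    * maxwellian p.1 * b (v - p.1) p.2 ∂(collisionMeasure d)

/-! ### Reference measures -/

/-- The measure `w(v) M(v) dv dx` on `Ω × ℝ^d`, for a nonnegative weight `w`. -/
def phaseMeasure {d : ℕ} (Ω : Set (Vec d)) (w : Vec d → ℝ) : Measure (Vec d × Vec d) :=
  (volume.restrict Ω).prod
    (volume.withDensity fun v => ENNReal.ofReal (w v * maxwellian v))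

/-- The measure `w(x, v) M(v) dv dσ_x` on `∂Ω × ℝ^d`, for a nonnegative weight `w`. -/
def boundaryMeasure {d : ℕ} (Ω : Set (Vec d)) (w : Vec d × Vec d → ℝ) :
    Measure (Vec d × Vec d) :=
  ((surfaceMeasure Ω).prod volume).withDensity
    fun p => ENNReal.ofReal (w p * maxwellian p.2)

/-- `ds ⊗ μ` on `[t₁, t₂] × X`. -/
def timeProd {X : Type*} [MeasurableSpace X] (t₁ t₂ : ℝ) (μ : Measure X) : Measure (ℝ × X) :=
  (volume.restrict (Set.Icc t₁ t₂)).prod μ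

/-- The probability measure `dμ_x(v) = √(2π) M(v) (v · n(x))_+ dv`. -/
def wallMeasure {d : ℕ} (n : Vec d → Vec d) (x : Vec d) : Measure (Vec d) :=
  volume.withDensity
    fun v => ENNReal.ofReal (Real.sqrt (2 * Real.pi) * maxwellian v * max ⟪v, n x⟫ 0)

/-- The measure `dμ_x(v) dσ_x`; it is carried by `Σ_+ = {(x, v) : x ∈ ∂Ω, v · n(x) > 0}`. -/
def outgoingMeasure {d : ℕ} (Ω : Set (Vec d)) (n : Vec d → Vec d) : Measure (Vec d × Vec d) :=
  boundaryMeasure Ω fun p => Real.sqrt (2 * Real.pi) * max ⟪p.2, n p.1⟫ 0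

/-! ### Solutions of the scaled linearised Boltzmann equation -/

/-- Smooth compactly supported functions of `(t, x, v)`; they are used on `[0, ∞) × Ω̄ × ℝ^d`. -/
def IsTest {d : ℕ} (φ : ℝ × Vec d × Vec d → ℝ) : Prop :=
  ContDiff ℝ (⊤ : ℕ∞) φ ∧ HasCompactSupport φ

/-- `(α ∂_t + v · ∇_x) φ`. -/
def transport {d : ℕ} (α : ℝ) (φ : ℝ × Vec d × Vec d → ℝ) (p : ℝ × Vec d × Vec d) : ℝ :=
  fderiv ℝ φ p (α, p.2.2, 0)

/-- `g` is a strong `L²` solution on `[0, ∞) × Ω × ℝ^d`, with trace `γ` on `∂Ω × ℝ^d`, of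
`α ∂_t g + v · ∇_x g = -α⁻¹ 𝓛 g`, with the diffuse reflection condition
`g = θ (|v|² - (d+1))/2 + ∫ g dμ_x` on `Σ_- = {v · n(x) < 0}`. -/
structure IsSolution {d : ℕ} (Ω : Set (Vec d)) (n : Vec d → Vec d) (b : Vec d → Vec d → ℝ)
    (θ : Vec d → ℝ) (α : ℝ) (g γ : ℝ → Vec d → Vec d → ℝ) : Prop where
  measurable : Measurable fun p : ℝ × Vec d × Vec d => g p.1 p.2.1 p.2.2
  measurable_trace : Measurable fun p : ℝ × Vec d × Vec d => γ p.1 p.2.1 p.2.2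
  /-- `g(t) ∈ L²(M dv dx)` for every `t ≥ 0`. -/
  memLp : ∀ t, 0 ≤ t → MemLp (fun p : Vec d × Vec d => g t p.1 p.2) 2 (phaseMeasure Ω fun _ => 1)
  /-- `g ∈ L²([0, T]; L²(a M dv dx))`. -/
  memLp_freq : ∀ T, MemLp (fun p : ℝ × Vec d × Vec d => g p.1 p.2.1 p.2.2) 2
    (timeProd 0 T (phaseMeasure Ω (collisionFrequency b)))
  /-- `γ ∈ L²([0, T]; L²(|v · n| M dv dσ))`. -/
  memLp_trace : ∀ T, MemLp (fun p : ℝ × Vec d × Vec d => γ p.1 p.2.1 p.2.2) 2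
    (timeProd 0 T (boundaryMeasure Ω fun p => |⟪p.2, n p.1⟫|))
  /-- The weak form of the equation, with boundary values `γ` (Green's formula). -/
  green : ∀ φ, IsTest φ → ∀ t₁ t₂, 0 ≤ t₁ → t₁ ≤ t₂ →
    α * (∫ p, φ (t₂, p) * g t₂ p.1 p.2 ∂(phaseMeasure Ω fun _ => 1))
      - α * (∫ p, φ (t₁, p) * g t₁ p.1 p.2 ∂(phaseMeasure Ω fun _ => 1))
    = (∫ p, transport α φ p * g p.1 p.2.1 p.2.2 ∂(timeProd t₁ t₂ (phaseMeasure Ω fun _ => 1)))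
      - α⁻¹ * (∫ p, φ p * linColl b (g p.1 p.2.1) p.2.2
          ∂(timeProd t₁ t₂ (phaseMeasure Ω fun _ => 1)))
      - ∫ p, φ p * γ p.1 p.2.1 p.2.2 * ⟪p.2.2, n p.2.1⟫
          ∂(timeProd t₁ t₂ (boundaryMeasure Ω fun _ => 1))
  /-- The diffuse reflection condition on `Σ_-`. -/
  boundary : ∀ᵐ p : ℝ × Vec d × Vec d
      ∂((volume.restrict (Set.Ioi 0)).prod ((surfaceMeasure Ω).prod volume)),
    ⟪p.2.2, n p.2.1⟫ < 0 →
      γ p.1 p.2.1 p.2.2 = θ p.2.1 * ((‖p.2.2‖ ^ 2 - (d + 1)) / 2)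
        + ∫ w, γ p.1 p.2.1 w ∂(wallMeasure n p.2.1)
  /-- `g` lies in the closure of the smooth functions for the graph norm of the transport operator:
  on every `[0, T]` there are smooth `φ_k → g` with
  `(α ∂_t + v · ∇_x) φ_k → -α⁻¹ 𝓛 g`, together with their values at each time and on `∂Ω`. -/
  strong : ∀ T, ∃ φ : ℕ → ℝ × Vec d × Vec d → ℝ, (∀ k, IsTest (φ k)) ∧
    Tendsto (fun k => eLpNorm (fun p => φ k p - g p.1 p.2.1 p.2.2) 2
      (timeProd 0 T (phaseMeasure Ω (collisionFrequency b)))) atTop (𝓝 0) ∧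
    Tendsto (fun k => eLpNorm
      (fun p => transport α (φ k) p + α⁻¹ * linColl b (g p.1 p.2.1) p.2.2) 2
      (timeProd 0 T (phaseMeasure Ω fun v => (collisionFrequency b v)⁻¹))) atTop (𝓝 0) ∧
    Tendsto (fun k => eLpNorm (fun p => φ k p - γ p.1 p.2.1 p.2.2) 2
      (timeProd 0 T (boundaryMeasure Ω fun p => |⟪p.2, n p.1⟫|))) atTop (𝓝 0) ∧
    ∀ t ∈ Set.Icc 0 T, Tendsto (fun k => eLpNorm (fun p => φ k (t, p) - g t p.1 p.2) 2
      (phaseMeasure Ω fun _ => 1)) atTop (𝓝 0)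

/-- The modulated fluctuation `g̃(t, x, v) = g(t, x, v) - θ̃(x) (|v|² - (d+2))/2`; the same formula
gives the trace of `g̃` from the trace of `g`. -/
def modulated {d : ℕ} (θ : Vec d → ℝ) (g : ℝ → Vec d → Vec d → ℝ) : ℝ → Vec d → Vec d → ℝ :=
  fun t x v => g t x v - θ x * ((‖v‖ ^ 2 - (d + 2)) / 2)

/-- The integrand `M g̃²` relative to `M dv dx` at time `t`. -/
def entropyDensity {d : ℕ} (h : ℝ → Vec d → Vec d → ℝ) (t : ℝ) (p : Vec d × Vec d) : ℝ :=
  h t p.1 p.2 ^ 2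

/-- The integrand `h 𝓛 h` of the entropy dissipation. -/
def dissipationDensity {d : ℕ} (b : Vec d → Vec d → ℝ) (h : ℝ → Vec d → Vec d → ℝ)
    (p : ℝ × Vec d × Vec d) : ℝ :=
  h p.1 p.2.1 p.2.2 * linColl b (h p.1 p.2.1) p.2.2

/-- The integrand `(h - ∫ h dμ_x)²` of the boundary term. -/
def varianceDensity {d : ℕ} (n : Vec d → Vec d) (h : ℝ → Vec d → Vec d → ℝ)
    (p : ℝ × Vec d × Vec d) : ℝ :=
  (h p.1 p.2.1 p.2.2 - ∫ w, h p.1 p.2.1 w ∂(wallMeasure n p.2.1)) ^ 2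

end LinBoltz

end

noncomputable section

namespace LinBoltz

/-! ### Weighted `L²` spaces -/

section Weighted

variable {X : Type*} [MeasurableSpace X] {μ : Measure X}

lemma integrable_withDensity_ofReal {w : X → ℝ} (hw : Measurable w) (hw0 : ∀ x, 0 ≤ w x)
    {f : X → ℝ} : Integrable f (μ.withDensity fun x => ENNReal.ofReal (w x)) ↔
      Integrable (fun x => w x * f x) μ := by
  rw [integrable_withDensity_iff_integrable_smul' hw.ennreal_ofReal (by simp)]
  simp [ENNReal.toReal_ofReal (hw0 _)]

lemma integral_withDensity_ofReal {w : X → ℝ} (hw : Measurable w) (hw0 : ∀ x, 0 ≤ w x)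
    (f : X → ℝ) : ∫ x, f x ∂(μ.withDensity fun x => ENNReal.ofReal (w x)) =
      ∫ x, w x * f x ∂μ := by
  rw [integral_withDensity_eq_integral_toReal_smul hw.ennreal_ofReal (by simp)]
  simp [ENNReal.toReal_ofReal (hw0 _)]

lemma memLp_two_withDensity_ofReal {w : X → ℝ} (hw : Measurable w) (hw0 : ∀ x, 0 ≤ w x)
    {f : X → ℝ} (hf : Measurable f) :
    MemLp f 2 (μ.withDensity fun x => ENNReal.ofReal (w x)) ↔
      Integrable (fun x => w x * f x ^ 2) μ := by
  rw [memLp_two_iff_integrable_sq hf.aestronglyMeasurable, integrable_withDensity_ofReal hw hw0]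

lemma abs_mul_mul_le {c w₁ w₂ x y r : ℝ} (hr : 0 < r) (h₁ : 0 ≤ w₁) (h₂ : 0 ≤ w₂)
    (hc : c ^ 2 ≤ w₁ * w₂) :
    2 * |c * x * y| ≤ r * (w₁ * x ^ 2) + r⁻¹ * (w₂ * y ^ 2) := by
  have hA : 0 ≤ r * (w₁ * x ^ 2) + r⁻¹ * (w₂ * y ^ 2) := by positivity
  have h1 : (c * x * y) ^ 2 ≤ (w₁ * x ^ 2) * (w₂ * y ^ 2) := by
    have := mul_le_mul_of_nonneg_right hc (by positivity : 0 ≤ x ^ 2 * y ^ 2)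
    linarith
  have h2 : r * r⁻¹ = 1 := mul_inv_cancel₀ hr.ne'
  have h3 : (2 * |c * x * y|) ^ 2 = 4 * (c * x * y) ^ 2 := by rw [mul_pow, sq_abs]; ring
  have h4 : (w₁ * x ^ 2) * (w₂ * y ^ 2) = (r * (w₁ * x ^ 2)) * (r⁻¹ * (w₂ * y ^ 2)) := by
    linear_combination (-(w₁ * x ^ 2) * (w₂ * y ^ 2)) * h2
  refine (le_abs_self _).trans (abs_le_of_sq_le_sq ?_ hA)
  nlinarith [sq_nonneg (r * (w₁ * x ^ 2) - r⁻¹ * (w₂ * y ^ 2))]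

lemma integrable_mul_mul {c w₁ w₂ f g : X → ℝ} (hc : AEStronglyMeasurable c μ)
    (hf : AEStronglyMeasurable f μ) (hg : AEStronglyMeasurable g μ)
    (h₁ : ∀ x, 0 ≤ w₁ x) (h₂ : ∀ x, 0 ≤ w₂ x) (hcw : ∀ x, c x ^ 2 ≤ w₁ x * w₂ x)
    (hfi : Integrable (fun x => w₁ x * f x ^ 2) μ)
    (hgi : Integrable (fun x => w₂ x * g x ^ 2) μ) :
    Integrable (fun x => c x * f x * g x) μ := by
  refine (hfi.add hgi).mono' ((hc.mul hf).mul hg) (Eventually.of_forall fun x => ?_)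
  have := abs_mul_mul_le (x := f x) (y := g x) one_pos (h₁ x) (h₂ x) (hcw x)
  have h1 := h₁ x
  have h2 := h₂ x
  simp only [Real.norm_eq_abs, Pi.add_apply]
  have : 0 ≤ |c x * f x * g x| := abs_nonneg _
  linarith

lemma eLpNorm_two_withDensity_ofReal {w : X → ℝ} (hw : Measurable w) {f : X → ℝ}
    (hf : Measurable f) :
    eLpNorm f 2 (μ.withDensity fun x => ENNReal.ofReal (w x)) =
      (∫⁻ x, (ENNReal.ofReal (w x) ^ (1 / 2 : ℝ) * ‖f x‖ₑ) ^ (2 : ℝ) ∂μ) ^ (1 / 2 : ℝ) := by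
  rw [eLpNorm_eq_lintegral_rpow_enorm_toReal (by norm_num) (by norm_num),
    lintegral_withDensity_eq_lintegral_mul _ hw.ennreal_ofReal (by fun_prop)]
  simp only [ENNReal.toReal_ofNat, Pi.mul_apply]
  congr 2
  ext x
  rw [ENNReal.mul_rpow_of_nonneg _ _ (by norm_num), ← ENNReal.rpow_mul]
  norm_num

lemma enorm_integral_mul_mul_le {c w₁ w₂ f g : X → ℝ}
    (hf : Measurable f) (hg : Measurable g) (hw₁ : Measurable w₁) (hw₂ : Measurable w₂)
    (h₁ : ∀ x, 0 ≤ w₁ x) (hcw : ∀ x, c x ^ 2 ≤ w₁ x * w₂ x) :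
    ‖∫ x, c x * f x * g x ∂μ‖ₑ ≤ eLpNorm f 2 (μ.withDensity fun x => ENNReal.ofReal (w₁ x)) *
      eLpNorm g 2 (μ.withDensity fun x => ENNReal.ofReal (w₂ x)) := by
  refine (enorm_integral_le_lintegral_enorm _).trans ?_
  rw [eLpNorm_two_withDensity_ofReal hw₁ hf, eLpNorm_two_withDensity_ofReal hw₂ hg]
  refine le_trans (lintegral_mono fun x => ?_) (ENNReal.lintegral_mul_le_Lp_mul_Lq μ
    (Real.HolderConjugate.two_two) ?_ ?_)
  · simp only [Pi.mul_apply, enorm_mul]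
    have : ‖c x‖ₑ ≤ ENNReal.ofReal (w₁ x) ^ (1 / 2 : ℝ) * ENNReal.ofReal (w₂ x) ^ (1 / 2 : ℝ) := by
      have h : ‖c x‖ₑ = (ENNReal.ofReal (c x ^ 2)) ^ (1 / 2 : ℝ) := by
        rw [Real.enorm_eq_ofReal_abs, ENNReal.ofReal_rpow_of_nonneg (sq_nonneg _) (by norm_num),
          ← Real.sqrt_eq_rpow, Real.sqrt_sq_eq_abs]
      rw [← ENNReal.mul_rpow_of_nonneg _ _ (by norm_num), ← ENNReal.ofReal_mul (h₁ x), h]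
      gcongr
      exact hcw x
    calc _ ≤ (ENNReal.ofReal (w₁ x) ^ (1 / 2 : ℝ) * ENNReal.ofReal (w₂ x) ^ (1 / 2 : ℝ)) *
          ‖f x‖ₑ * ‖g x‖ₑ := by gcongr
      _ = _ := by ring
  · fun_prop
  · fun_prop

lemma tendsto_integral_mul_mul {c w₁ w₂ f g : X → ℝ} {φ : ℕ → X → ℝ}
    (hc : Measurable c) (hφ : ∀ k, Measurable (φ k))
    (hf : Measurable f) (hg : Measurable g) (hw₁ : Measurable w₁) (hw₂ : Measurable w₂)
    (h₁ : ∀ x, 0 ≤ w₁ x) (h₂ : ∀ x, 0 ≤ w₂ x) (hcw : ∀ x, c x ^ 2 ≤ w₁ x * w₂ x)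
    (hfi : Integrable (fun x => w₁ x * f x ^ 2) μ)
    (hgi : Integrable (fun x => w₂ x * g x ^ 2) μ)
    (hlim : Tendsto (fun k => eLpNorm (fun x => φ k x - f x) 2
      (μ.withDensity fun x => ENNReal.ofReal (w₁ x))) atTop (𝓝 0)) :
    Tendsto (fun k => ∫ x, c x * φ k x * g x ∂μ) atTop (𝓝 (∫ x, c x * f x * g x ∂μ)) := by
  have hcfg := integrable_mul_mul hc.aestronglyMeasurable hf.aestronglyMeasurable
    hg.aestronglyMeasurable h₁ h₂ hcw hfi hgi
  have hG : eLpNorm g 2 (μ.withDensity fun x => ENNReal.ofReal (w₂ x)) ≠ ∞ :=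
    ((memLp_two_withDensity_ofReal hw₂ h₂ hg).2 hgi).eLpNorm_ne_top
  rw [tendsto_iff_edist_tendsto_0]
  have hlim' := ENNReal.Tendsto.mul_const hlim (Or.inr hG)
  rw [zero_mul] at hlim'
  refine tendsto_of_tendsto_of_tendsto_of_le_of_le' tendsto_const_nhds hlim'
    (Eventually.of_forall fun _ => zero_le) ?_
  filter_upwards [hlim.eventually (gt_mem_nhds ENNReal.zero_lt_top)] with k hk
  have hd : Measurable fun x => φ k x - f x := (hφ k).sub hf
  have hm : MemLp (fun x => φ k x - f x) 2 (μ.withDensity fun x => ENNReal.ofReal (w₁ x)) :=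
    ⟨hd.aestronglyMeasurable, hk⟩
  have hi := integrable_mul_mul hc.aestronglyMeasurable hd.aestronglyMeasurable
    hg.aestronglyMeasurable h₁ h₂ hcw ((memLp_two_withDensity_ofReal hw₁ h₁ hd).1 hm) hgi
  have hci : Integrable (fun x => c x * φ k x * g x) μ := by
    refine (hi.add hcfg).congr (Eventually.of_forall fun x => ?_)
    simp only [Pi.add_apply]
    ring
  have : (∫ x, c x * φ k x * g x ∂μ) - (∫ x, c x * f x * g x ∂μ) =
      ∫ x, c x * (φ k x - f x) * g x ∂μ := by
    rw [← integral_sub hci hcfg]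
    congr 1
    ext x
    ring
  rw [edist_eq_enorm_sub, this]
  exact enorm_integral_mul_mul_le hd hg hw₁ hw₂ h₁ hcw

end Weighted

/-! ### Products of three measures -/

section Fiber

variable {X Y Z : Type*} [MeasurableSpace X] [MeasurableSpace Y] [MeasurableSpace Z]
  {μ : Measure X} {ν : Measure Y} {ρ : Measure Z} [SFinite μ] [SFinite ν] [SFinite ρ]

lemma ae_ae_integrable_of_prod_prod {F : X × Y × Z → ℝ} (hF : Integrable F (μ.prod (ν.prod ρ))) :
    ∀ᵐ x ∂μ, ∀ᵐ y ∂ν, Integrable (fun z => F (x, y, z)) ρ := by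
  filter_upwards [hF.prod_right_ae] with x hx
  exact hx.prod_right_ae

lemma integral_le_of_fiber {F G : X × Y × Z → ℝ} (hF : Integrable F (μ.prod (ν.prod ρ)))
    (hG : Integrable G (μ.prod (ν.prod ρ)))
    (h : ∀ᵐ x ∂μ, ∀ᵐ y ∂ν, ∫ z, F (x, y, z) ∂ρ ≤ ∫ z, G (x, y, z) ∂ρ) :
    ∫ p, F p ∂(μ.prod (ν.prod ρ)) ≤ ∫ p, G p ∂(μ.prod (ν.prod ρ)) := by
  rw [integral_prod _ hF, integral_prod _ hG]
  refine integral_mono_ae hF.integral_prod_left hG.integral_prod_left ?_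
  filter_upwards [hF.prod_right_ae, hG.prod_right_ae, h] with x hFx hGx hx
  rw [integral_prod _ hFx, integral_prod _ hGx]
  exact integral_mono_ae hFx.integral_prod_left hGx.integral_prod_left hx

lemma integral_eq_of_fiber {F G : X × Y × Z → ℝ} (hF : Integrable F (μ.prod (ν.prod ρ)))
    (hG : Integrable G (μ.prod (ν.prod ρ)))
    (h : ∀ᵐ x ∂μ, ∀ᵐ y ∂ν, ∫ z, F (x, y, z) ∂ρ = ∫ z, G (x, y, z) ∂ρ) :
    ∫ p, F p ∂(μ.prod (ν.prod ρ)) = ∫ p, G p ∂(μ.prod (ν.prod ρ)) :=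
  le_antisymm
    (integral_le_of_fiber hF hG (h.mono fun _ hx => hx.mono fun _ hy => hy.le))
    (integral_le_of_fiber hG hF (h.mono fun _ hx => hx.mono fun _ hy => hy.ge))

end Fiber

lemma integral_eq_zero_of_odd {E : Type*} [MeasurableSpace E] [AddGroup E] [MeasurableNeg E]
    {μ : Measure E} [μ.IsNegInvariant] {f : E → ℝ} (hf : ∀ x, f (-x) = -f x) :
    ∫ x, f x ∂μ = 0 := by
  have h := integral_neg_eq_self f μ
  simp only [hf, integral_neg] at h
  linarith

/-! ### Gaussian integrals -/

section Gaussian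

open ProbabilityTheory

variable {d : ℕ}

lemma maxwellian_pos (v : Vec d) : 0 < maxwellian v := by
  unfold maxwellian
  positivity

lemma maxwellian_nonneg (v : Vec d) : 0 ≤ maxwellian v := (maxwellian_pos v).le

@[fun_prop]
lemma continuous_maxwellian : Continuous (maxwellian (d := d)) := by
  unfold maxwellian
  fun_prop

@[fun_prop]
lemma measurable_maxwellian : Measurable (maxwellian (d := d)) := continuous_maxwellian.measurable

lemma maxwellian_neg (v : Vec d) : maxwellian (-v) = maxwellian v := by simp [maxwellian]

lemma one_add_pow_mul_exp_le (k : ℕ) {r : ℝ} (hr : 0 ≤ r) :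
    (1 + r) ^ k * Real.exp (-r ^ 2 / 2) ≤ k.factorial * Real.exp 2 * Real.exp (-(1 / 4) * r ^ 2) := by
  have h1 : (1 + r) ^ k ≤ k.factorial * Real.exp (1 + r) := by
    have := Real.pow_div_factorial_le_exp (1 + r) (by linarith) k
    rwa [div_le_iff₀' (by positivity)] at this
  calc (1 + r) ^ k * Real.exp (-r ^ 2 / 2)
      ≤ k.factorial * Real.exp (1 + r) * Real.exp (-r ^ 2 / 2) := by gcongr
    _ = k.factorial * Real.exp (1 + r + -r ^ 2 / 2) := by rw [Real.exp_add (1 + r)]; ring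
    _ ≤ k.factorial * Real.exp (2 + -(1 / 4) * r ^ 2) := by
      refine mul_le_mul_of_nonneg_left (Real.exp_le_exp.2 ?_) (by positivity)
      nlinarith [sq_nonneg (r - 2)]
    _ = _ := by rw [Real.exp_add]; ring

lemma integrable_exp_neg_quarter : Integrable fun v : Vec d => Real.exp (-(1 / 4) * ‖v‖ ^ 2) := by
  by_contra h
  have h1 := GaussianFourier.integral_rexp_neg_mul_sq_norm (V := Vec d) (b := 1 / 4) (by norm_num)
  rw [integral_undef h] at h1
  have : 0 < (Real.pi / (1 / 4)) ^ ((Module.finrank ℝ (Vec d) : ℝ) / 2) := by positivity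
  linarith

lemma integrable_maxwellian_mul_pow (k : ℕ) :
    Integrable fun v : Vec d => maxwellian v * (1 + ‖v‖) ^ k := by
  refine (integrable_exp_neg_quarter.const_mul
    ((2 * Real.pi) ^ (-(d : ℝ) / 2) * (k.factorial * Real.exp 2))).mono'
    (by fun_prop) (Eventually.of_forall fun v => ?_)
  rw [Real.norm_of_nonneg (mul_nonneg (maxwellian_nonneg v) (by positivity)), maxwellian]
  have := one_add_pow_mul_exp_le k (norm_nonneg v)
  calc _ = (2 * Real.pi) ^ (-(d : ℝ) / 2) * ((1 + ‖v‖) ^ k * Real.exp (-‖v‖ ^ 2 / 2)) := by ring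
    _ ≤ (2 * Real.pi) ^ (-(d : ℝ) / 2) *
        (k.factorial * Real.exp 2 * Real.exp (-(1 / 4) * ‖v‖ ^ 2)) := by gcongr
    _ = _ := by ring

lemma integrable_maxwellian_mul {f : Vec d → ℝ} (hf : AEStronglyMeasurable f) {C : ℝ} {k : ℕ}
    (h : ∀ v, |f v| ≤ C * (1 + ‖v‖) ^ k) : Integrable fun v => maxwellian v * f v := by
  refine ((integrable_maxwellian_mul_pow k).const_mul C).mono'
    (continuous_maxwellian.aestronglyMeasurable.mul hf) (Eventually.of_forall fun v => ?_)
  rw [norm_mul, Real.norm_of_nonneg (maxwellian_nonneg v), Real.norm_eq_abs]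
  nlinarith [h v, maxwellian_pos v]

lemma integral_maxwellian : ∫ v : Vec d, maxwellian v = 1 := by
  have h1 := GaussianFourier.integral_rexp_neg_mul_sq_norm (V := Vec d) (b := 1 / 2) (by norm_num)
  have h2 : ∀ v : Vec d, maxwellian v =
      (2 * Real.pi) ^ (-(d : ℝ) / 2) * Real.exp (-(1 / 2) * ‖v‖ ^ 2) := by
    intro v
    rw [maxwellian]
    congr 2
    ring
  simp_rw [h2]
  rw [integral_const_mul, h1, finrank_euclideanSpace_fin, neg_div, Real.rpow_neg (by positivity)]
  have : Real.pi / (1 / 2) = 2 * Real.pi := by ring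
  rw [this, inv_mul_cancel₀ (by positivity)]

lemma integrable_maxwellian : Integrable (maxwellian (d := d)) := by
  simpa using integrable_maxwellian_mul_pow (d := d) 0

lemma withDensity_maxwellian :
    (volume : Measure (Vec d)).withDensity (fun v => ENNReal.ofReal (maxwellian v)) =
      stdGaussian (Vec d) := by
  have : IsFiniteMeasure
      ((volume : Measure (Vec d)).withDensity (fun v => ENNReal.ofReal (maxwellian v))) :=
    isFiniteMeasure_withDensity_ofReal integrable_maxwellian.2
  apply Measure.ext_of_charFun
  ext t
  rw [charFun_stdGaussian, charFun_apply,
    integral_withDensity_eq_integral_toReal_smul (by fun_prop) (by simp)]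
  have h1 := GaussianFourier.integral_cexp_neg_mul_sq_norm_add (V := Vec d) (b := 1 / 2)
    (by norm_num) Complex.I t
  have h2 : ∀ v : Vec d, (ENNReal.ofReal (maxwellian v)).toReal •
      Complex.exp (⟪v, t⟫ * Complex.I) = (((2 * Real.pi) ^ (-(d : ℝ) / 2) : ℝ) : ℂ) *
        Complex.exp (-(1 / 2) * ‖v‖ ^ 2 + Complex.I * ⟪t, v⟫) := by
    intro v
    rw [ENNReal.toReal_ofReal (maxwellian_nonneg v), maxwellian, real_inner_comm, Complex.exp_add,
      Complex.real_smul, Complex.ofReal_mul, Complex.ofReal_exp]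
    rw [mul_assoc]
    congr 2
    · congr 1
      push_cast
      ring
    · rw [mul_comm]
  simp_rw [h2]
  rw [integral_const_mul, h1, finrank_euclideanSpace_fin]
  have h3 : ((Real.pi : ℂ) / (1 / 2)) ^ ((d : ℂ) / 2) =
      (((2 * Real.pi) ^ ((d : ℝ) / 2) : ℝ) : ℂ) := by
    rw [Complex.ofReal_cpow (by positivity)]
    push_cast
    congr 1
    ring
  rw [h3, ← mul_assoc, ← Complex.ofReal_mul, ← Real.rpow_add (by positivity)]
  simp only [Complex.I_sq]
  rw [show -(d : ℝ) / 2 + (d : ℝ) / 2 = 0 by ring, Real.rpow_zero, Complex.ofReal_one, one_mul]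
  congr 1
  ring

lemma integral_stdGaussian (f : Vec d → ℝ) :
    ∫ v, f v ∂(stdGaussian (Vec d)) = ∫ v, maxwellian v * f v := by
  rw [← withDensity_maxwellian, integral_withDensity_ofReal measurable_maxwellian maxwellian_nonneg]

lemma integral_maxwellian_mul_inner_sq {ω : Vec d} (hω : ‖ω‖ = 1) :
    ∫ v, maxwellian v * ⟪v, ω⟫ ^ 2 = 1 := by
  rw [← integral_stdGaussian]
  have h := variance_dual_stdGaussian (E := Vec d) (innerSL ℝ ω)
  rw [variance_of_integral_eq_zero (by fun_prop) (integral_strongDual_stdGaussian _)] at h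
  simpa [real_inner_comm, hω] using h

lemma integral_maxwellian_mul_eq_zero {f : Vec d → ℝ} (hf : ∀ v, f (-v) = -f v) :
    ∫ v, maxwellian v * f v = 0 :=
  integral_eq_zero_of_odd fun v => by rw [maxwellian_neg, hf, mul_neg]

lemma gaussianReal_posPart_moment (k : ℕ) (hk : k ≠ 0) :
    ∫ x, max x 0 ^ k ∂(gaussianReal 0 1) =
      (√(2 * Real.pi))⁻¹ * ((1 / 2 : ℝ) ^ (-((k : ℝ) + 1) / 2) * (1 / 2) *
        Real.Gamma (((k : ℝ) + 1) / 2)) := by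
  rw [integral_gaussianReal_eq_integral_smul (by norm_num)]
  have h := integral_rpow_mul_exp_neg_mul_rpow (p := 2) (q := k) (b := 1 / 2) (by norm_num)
    (by have : (0 : ℝ) ≤ k := Nat.cast_nonneg k
        linarith) (by norm_num)
  rw [← h, ← integral_const_mul, ← integral_indicator measurableSet_Ioi]
  congr 1
  ext x
  by_cases hx : 0 < x
  · rw [Set.indicator_of_mem (Set.mem_Ioi.2 hx), max_eq_left hx.le, gaussianPDFReal, smul_eq_mul,
      Real.rpow_natCast, Real.rpow_two]
    simp only [NNReal.coe_one, mul_one, sub_zero]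
    rw [show -x ^ 2 / 2 = -(1 / 2) * x ^ 2 by ring]
    ring
  · rw [Set.indicator_of_notMem (by simpa using hx), max_eq_right (not_lt.1 hx)]
    simp [hk]

lemma gaussianReal_posPart_one :
    ∫ x, max x 0 ∂(gaussianReal 0 1) = (√(2 * Real.pi))⁻¹ := by
  have h := gaussianReal_posPart_moment 1 one_ne_zero
  simp only [pow_one, Nat.cast_one] at h
  rw [h]
  norm_num [Real.rpow_neg_one]

lemma gaussianReal_posPart_three :
    ∫ x, max x 0 ^ 3 ∂(gaussianReal 0 1) = 2 * (√(2 * Real.pi))⁻¹ := by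
  have h := gaussianReal_posPart_moment 3 (by norm_num)
  rw [h]
  have : ((3 : ℕ) : ℝ) + 1 = 4 := by norm_num
  rw [this, show (4 : ℝ) / 2 = 2 by norm_num, show -(4 : ℝ) / 2 = -(2 : ℕ) by norm_num,
    Real.rpow_neg (by norm_num), Real.rpow_natCast, Real.Gamma_two]
  ring

lemma exists_orthonormalBasis_apply_eq {n : Vec d} (hn : ‖n‖ = 1) :
    ∃ (i : Fin d) (b : OrthonormalBasis (Fin d) ℝ (Vec d)), b i = n := by
  have hd : d ≠ 0 := by
    rintro rfl
    rw [Subsingleton.elim n 0] at hn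
    simp at hn
  let i : Fin d := ⟨0, Nat.pos_of_ne_zero hd⟩
  have ho : Orthonormal ℝ (Set.domRestrict {i} fun _ : Fin d => n) := by
    rw [orthonormal_subsingleton_iff]
    intro _
    exact hn
  obtain ⟨b, hb⟩ := ho.exists_orthonormalBasis_extension_of_card_eq (by simp)
  exact ⟨i, b, hb i rfl⟩

lemma stdGaussian_integral_basis (b : OrthonormalBasis (Fin d) ℝ (Vec d)) (f : Vec d → ℝ)
    (hf : Measurable f) : ∫ v, maxwellian v * f v =
      ∫ x, f (∑ i, x i • b i) ∂(Measure.pi fun _ : Fin d => gaussianReal 0 1) := by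
  rw [← integral_stdGaussian, stdGaussian_eq_map_pi_orthonormalBasis b,
    integral_map (Measurable.aemeasurable (by fun_prop)) hf.aestronglyMeasurable]

lemma integral_pi_gaussianReal_eval (i : Fin d) (f : ℝ → ℝ) (hf : Measurable f) :
    ∫ x, f (x i) ∂(Measure.pi fun _ : Fin d => gaussianReal 0 1) =
      ∫ s, f s ∂(gaussianReal 0 1) := by
  have := (measurePreserving_eval (fun _ : Fin d => gaussianReal 0 1) i)
  conv_rhs => rw [← this.map_eq, integral_map this.measurable.aemeasurable hf.aestronglyMeasurable]

lemma integral_maxwellian_mul_posPart {n : Vec d} (hn : ‖n‖ = 1) :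
    ∫ v, maxwellian v * max ⟪v, n⟫ 0 = (√(2 * Real.pi))⁻¹ := by
  obtain ⟨i, b, hb⟩ := exists_orthonormalBasis_apply_eq hn
  rw [stdGaussian_integral_basis b _ (by fun_prop), ← gaussianReal_posPart_one,
    ← integral_pi_gaussianReal_eval i _ (by fun_prop)]
  congr 1
  ext x
  rw [← hb, real_inner_comm, b.orthonormal.inner_right_fintype]

lemma integrable_maxwellian_mul_norm_sq_mul_posPart (n : Vec d) :
    Integrable fun v => maxwellian v * (‖v‖ ^ 2 * max ⟪v, n⟫ 0) := by
  refine integrable_maxwellian_mul (by fun_prop) (C := ‖n‖) (k := 3) fun v => ?_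
  have h1 : |max ⟪v, n⟫ 0| ≤ ‖v‖ * ‖n‖ := by
    rw [abs_of_nonneg (le_max_right _ _)]
    exact max_le (real_inner_le_norm v n) (by positivity)
  rw [abs_mul, abs_of_nonneg (sq_nonneg ‖v‖)]
  calc ‖v‖ ^ 2 * |max ⟪v, n⟫ 0| ≤ ‖v‖ ^ 2 * (‖v‖ * ‖n‖) := by gcongr
    _ = ‖n‖ * ‖v‖ ^ 3 := by ring
    _ ≤ ‖n‖ * (1 + ‖v‖) ^ 3 := by gcongr; linarith

lemma integral_maxwellian_mul_norm_sq_mul_posPart {n : Vec d} (hn : ‖n‖ = 1) :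
    ∫ v, maxwellian v * (‖v‖ ^ 2 * max ⟪v, n⟫ 0) = (d + 1) * (√(2 * Real.pi))⁻¹ := by
  obtain ⟨i, b, hb⟩ := exists_orthonormalBasis_apply_eq hn
  have hsum : ∀ v : Vec d, maxwellian v * (‖v‖ ^ 2 * max ⟪v, n⟫ 0) =
      ∑ j, maxwellian v * (⟪b j, v⟫ ^ 2 * max ⟪v, n⟫ 0) := by
    intro v
    rw [← Finset.mul_sum, ← Finset.sum_mul, b.sum_sq_inner_right]
  have hint : ∀ j, Integrable fun v => maxwellian v * (⟪b j, v⟫ ^ 2 * max ⟪v, n⟫ 0) := by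
    intro j
    refine (integrable_maxwellian_mul_norm_sq_mul_posPart n).mono' (by fun_prop)
      (Eventually.of_forall fun v => ?_)
    have h0 : 0 ≤ max ⟪v, n⟫ 0 := le_max_right _ _
    rw [Real.norm_of_nonneg (mul_nonneg (maxwellian_nonneg v) (by positivity))]
    have h1 : ⟪b j, v⟫ ^ 2 ≤ ‖v‖ ^ 2 := by
      rw [← sq_abs]
      have := abs_real_inner_le_norm (b j) v
      rw [b.norm_eq_one, one_mul] at this
      gcongr
    have := maxwellian_nonneg v
    gcongr
  have hterm : ∀ j, ∫ v, maxwellian v * (⟪b j, v⟫ ^ 2 * max ⟪v, n⟫ 0) =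
      (if j = i then 2 else 1) * (√(2 * Real.pi))⁻¹ := by
    intro j
    rw [stdGaussian_integral_basis b _ (by fun_prop)]
    have hx : ∀ x : Fin d → ℝ, ⟪b j, ∑ i, x i • b i⟫ ^ 2 * max ⟪∑ i, x i • b i, n⟫ 0 =
        x j ^ 2 * max (x i) 0 := by
      intro x
      rw [← hb, b.orthonormal.inner_right_fintype, real_inner_comm (b i),
        b.orthonormal.inner_right_fintype]
    simp_rw [hx]
    split_ifs with hji
    · subst hji
      rw [integral_pi_gaussianReal_eval j (fun s => s ^ 2 * max s 0) (by fun_prop),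
        ← gaussianReal_posPart_three]
      congr 1
      ext s
      rcases le_total s 0 with hs | hs
      · simp [max_eq_right hs]
      · rw [max_eq_left hs]; ring
    · have hind := (iIndepFun_pi (μ := fun _ : Fin d => gaussianReal 0 1)
        (X := fun _ s => s) fun _ => aemeasurable_id).indepFun hji
      have h2 := (hind.comp (φ := fun s : ℝ => s ^ 2) (ψ := fun s : ℝ => max s 0)
        (by fun_prop) (by fun_prop)).integral_mul_eq_mul_integral
        (Measurable.aestronglyMeasurable (by fun_prop))
        (Measurable.aestronglyMeasurable (by fun_prop))
      simp only [Pi.mul_apply, Function.comp_apply] at h2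
      rw [h2, integral_pi_gaussianReal_eval j (fun s => s ^ 2) (by fun_prop),
        integral_pi_gaussianReal_eval i (fun s => max s 0) (by fun_prop), gaussianReal_posPart_one]
      have h3 := variance_id_gaussianReal (μ := 0) (v := 1)
      rw [variance_of_integral_eq_zero (by fun_prop) (by simp)] at h3
      simp only [id, NNReal.coe_one] at h3
      rw [h3]
  simp_rw [hsum]
  rw [integral_finsetSum _ fun j _ => hint j]
  simp_rw [hterm]
  rw [← Finset.sum_mul]
  congr 1
  have : ∀ j, (if j = i then (2 : ℝ) else 1) = 1 + if j = i then 1 else 0 := by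
    intro j
    split_ifs <;> norm_num
  simp_rw [this]
  simp [Finset.sum_add_distrib]

end Gaussian

/-! ### Moments of the surface measure of the unit sphere -/

section Sphere

variable {d : ℕ}

/-- The unit sphere of `ℝ^d`. -/
abbrev Sph (d : ℕ) := Metric.sphere (0 : Vec d) 1

/-- The surface measure `dω` of the unit sphere. -/
abbrev sphMeasure (d : ℕ) : Measure (Sph d) := (volume : Measure (Vec d)).toSphere

lemma norm_sph (ω : Sph d) : ‖(ω : Vec d)‖ = 1 := by simp

/-- The action of a linear isometry on the unit sphere. -/
def sphMap (e : Vec d ≃ₗᵢ[ℝ] Vec d) (ω : Sph d) : Sph d :=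
  ⟨e ω, by simp⟩

lemma measurable_sphMap (e : Vec d ≃ₗᵢ[ℝ] Vec d) : Measurable (sphMap e) :=
  (e.continuous.measurable.comp measurable_subtype_coe).subtype_mk

lemma measurePreserving_sphMap (e : Vec d ≃ₗᵢ[ℝ] Vec d) :
    MeasurePreserving (sphMap e) (sphMeasure d) (sphMeasure d) := by
  refine ⟨measurable_sphMap e, ?_⟩
  ext s hs
  rw [Measure.map_apply (measurable_sphMap e) hs, Measure.toSphere_apply' _ hs,
    Measure.toSphere_apply' _ (measurable_sphMap e hs)]
  congr 1
  conv_rhs => rw [← e.measurePreserving.measure_preimage_emb e.toHomeomorph.measurableEmbedding]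
  congr 1
  ext x
  simp only [Set.mem_smul, Set.mem_image, Set.mem_preimage]
  constructor
  · rintro ⟨r, hr, _, ⟨ω, hω, rfl⟩, hx⟩
    exact ⟨r, hr, _, ⟨_, hω, rfl⟩, by simp [sphMap, ← hx]⟩
  · rintro ⟨r, hr, _, ⟨ω, hω, rfl⟩, hx⟩
    refine ⟨r, hr, _, ⟨sphMap e.symm ω, ?_, rfl⟩, ?_⟩
    · have : sphMap e (sphMap e.symm ω) = ω := by ext; simp [sphMap]
      rwa [this]
    · apply e.injective
      simpa [sphMap] using hx

lemma integrable_sph {f : Sph d → ℝ} (hf : Continuous f) : Integrable f (sphMeasure d) :=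
  hf.integrable_of_hasCompactSupport (HasCompactSupport.of_compactSpace f)

lemma integral_sph_inner_pow_congr (k : ℕ) {v w : Vec d} (h : ‖v‖ = ‖w‖) :
    ∫ ω : Sph d, ⟪v, ω⟫ ^ k ∂(sphMeasure d) = ∫ ω : Sph d, ⟪w, ω⟫ ^ k ∂(sphMeasure d) := by
  let e := (Submodule.span ℝ {v - w})ᗮ.reflection
  have he : e v = w := Submodule.reflection_sub h
  have h1 := (measurePreserving_sphMap e).map_eq
  conv_rhs => rw [← h1]
  rw [integral_map (measurable_sphMap e).aemeasurable (by fun_prop)]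
  congr 1
  ext ω
  rw [← he]
  simp [sphMap]

lemma integral_sph_inner_pow (k : ℕ) {u : Vec d} (hu : ‖u‖ = 1) (v : Vec d) :
    ∫ ω : Sph d, ⟪v, ω⟫ ^ k ∂(sphMeasure d) =
      ‖v‖ ^ k * ∫ ω : Sph d, ⟪u, ω⟫ ^ k ∂(sphMeasure d) := by
  rw [integral_sph_inner_pow_congr k (w := ‖v‖ • u) (by simp [norm_smul, hu]), ← integral_const_mul]
  simp_rw [real_inner_smul_left, mul_pow]

/-- The second and fourth moments of the sphere, in terms of a single positive constant. -/
lemma exists_sph_moments (hd : d ≠ 0) : ∃ κ : ℝ, 0 < κ ∧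
    (∫ _ : Sph d, (1 : ℝ) ∂(sphMeasure d)) = d * ((d + 2) * κ / 3) ∧
    (∀ v : Vec d, ∫ ω : Sph d, ⟪v, ω⟫ ^ 2 ∂(sphMeasure d) = (d + 2) * κ / 3 * ‖v‖ ^ 2) ∧
    (∀ v e : Vec d, ∫ ω : Sph d, ⟪v, ω⟫ * ⟪e, ω⟫ ∂(sphMeasure d) =
      (d + 2) * κ / 3 * ⟪v, e⟫) ∧
    ∀ v e : Vec d, ∫ ω : Sph d, ⟪v, ω⟫ ^ 3 * ⟪e, ω⟫ ∂(sphMeasure d) =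
      κ * (‖v‖ ^ 2 * ⟪v, e⟫) := by
  let i₀ : Fin d := ⟨0, Nat.pos_of_ne_zero hd⟩
  let b := EuclideanSpace.basisFun (Fin d) ℝ
  set m := ∫ ω : Sph d, ⟪b i₀, ω⟫ ^ 2 ∂(sphMeasure d) with hm
  set κ := ∫ ω : Sph d, ⟪b i₀, ω⟫ ^ 4 ∂(sphMeasure d) with hκ
  have hb : ‖b i₀‖ = 1 := b.norm_eq_one i₀
  have h2 : ∀ v : Vec d, ∫ ω : Sph d, ⟪v, ω⟫ ^ 2 ∂(sphMeasure d) = m * ‖v‖ ^ 2 := fun v => by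
    rw [integral_sph_inner_pow 2 hb v, mul_comm]
  have h4 : ∀ v : Vec d, ∫ ω : Sph d, ⟪v, ω⟫ ^ 4 ∂(sphMeasure d) = κ * (‖v‖ ^ 2) ^ 2 := fun v => by
    rw [integral_sph_inner_pow 4 hb v, mul_comm]
    ring
  have hn : ∀ (v e : Vec d) (t : ℝ), ‖v + t • e‖ ^ 2 = ‖v‖ ^ 2 + 2 * t * ⟪v, e⟫ + t ^ 2 * ‖e‖ ^ 2 := by
    intro v e t
    rw [norm_add_sq_real, real_inner_smul_right, norm_smul, mul_pow, Real.norm_eq_abs, sq_abs]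
    ring
  have h11 : ∀ v e : Vec d, ∫ ω : Sph d, ⟪v, ω⟫ * ⟪e, ω⟫ ∂(sphMeasure d) = m * ⟪v, e⟫ := by
    intro v e
    have key : ∀ t : ℝ, (∫ ω : Sph d, ⟪v, ω⟫ ^ 2 ∂(sphMeasure d)) +
        2 * t * (∫ ω : Sph d, ⟪v, ω⟫ * ⟪e, ω⟫ ∂(sphMeasure d)) +
        t ^ 2 * (∫ ω : Sph d, ⟪e, ω⟫ ^ 2 ∂(sphMeasure d)) =
        m * (‖v‖ ^ 2 + 2 * t * ⟪v, e⟫ + t ^ 2 * ‖e‖ ^ 2) := by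
      intro t
      rw [← hn, ← h2, ← integral_const_mul, ← integral_const_mul, ← integral_add, ← integral_add]
      · congr 1
        ext ω
        rw [inner_add_left, real_inner_smul_left]
        ring
      all_goals exact integrable_sph (by fun_prop)
    have k1 := key 1
    have k2 := key (-1)
    linarith
  have key : ∀ (v e : Vec d) (t : ℝ), (∫ ω : Sph d, ⟪v, ω⟫ ^ 4 ∂(sphMeasure d)) +
      4 * t * (∫ ω : Sph d, ⟪v, ω⟫ ^ 3 * ⟪e, ω⟫ ∂(sphMeasure d)) +
      6 * t ^ 2 * (∫ ω : Sph d, ⟪v, ω⟫ ^ 2 * ⟪e, ω⟫ ^ 2 ∂(sphMeasure d)) +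
      4 * t ^ 3 * (∫ ω : Sph d, ⟪v, ω⟫ * ⟪e, ω⟫ ^ 3 ∂(sphMeasure d)) +
      t ^ 4 * (∫ ω : Sph d, ⟪e, ω⟫ ^ 4 ∂(sphMeasure d)) =
      κ * (‖v‖ ^ 2 + 2 * t * ⟪v, e⟫ + t ^ 2 * ‖e‖ ^ 2) ^ 2 := by
    intro v e t
    rw [← hn, ← h4, ← integral_const_mul, ← integral_const_mul, ← integral_const_mul,
      ← integral_const_mul, ← integral_add, ← integral_add, ← integral_add, ← integral_add]
    · congr 1
      ext ω
      rw [inner_add_left, real_inner_smul_left]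
      ring
    all_goals exact integrable_sph (by fun_prop)
  have h31 : ∀ v e : Vec d, ∫ ω : Sph d, ⟪v, ω⟫ ^ 3 * ⟪e, ω⟫ ∂(sphMeasure d) =
      κ * (‖v‖ ^ 2 * ⟪v, e⟫) := by
    intro v e
    have k1 := key v e 1
    have k2 := key v e (-1)
    have k3 := key v e 2
    have k4 := key v e (-2)
    linarith
  have h22 : ∀ v e : Vec d, ∫ ω : Sph d, ⟪v, ω⟫ ^ 2 * ⟪e, ω⟫ ^ 2 ∂(sphMeasure d) =
      κ / 3 * (2 * ⟪v, e⟫ ^ 2 + ‖v‖ ^ 2 * ‖e‖ ^ 2) := by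
    intro v e
    have k1 := key v e 1
    have k2 := key v e (-1)
    have k3 := h4 v
    have k4 := h4 e
    linarith
  have hsum : ∀ w : Vec d, ∑ i, ⟪b i, w⟫ ^ 2 = ‖w‖ ^ 2 := fun w => b.sum_sq_inner_right w
  have hS : (∫ _ : Sph d, (1 : ℝ) ∂(sphMeasure d)) = d * m := by
    have h1 : ∀ ω : Sph d, (1 : ℝ) = ∑ i, ⟪b i, (ω : Vec d)⟫ ^ 2 := fun ω => by
      rw [hsum, norm_sph, one_pow]
    rw [integral_congr_ae (Eventually.of_forall h1),
      integral_finsetSum _ fun i _ => integrable_sph (by fun_prop)]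
    simp [h2, b.norm_eq_one]
  have hmκ : m = (d + 2) * κ / 3 := by
    have h1 : ∀ ω : Sph d, ⟪b i₀, (ω : Vec d)⟫ ^ 2 =
        ∑ i, ⟪b i₀, (ω : Vec d)⟫ ^ 2 * ⟪b i, (ω : Vec d)⟫ ^ 2 := fun ω => by
      rw [← Finset.mul_sum, hsum, norm_sph, one_pow, mul_one]
    rw [hm, integral_congr_ae (Eventually.of_forall h1),
      integral_finsetSum _ fun i _ => integrable_sph (by fun_prop)]
    simp_rw [h22]
    rw [← Finset.mul_sum, Finset.sum_add_distrib, ← Finset.mul_sum]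
    have h5 : ∑ i, ⟪b i₀, b i⟫ ^ 2 = 1 := by
      rw [Finset.sum_congr rfl fun i _ => by rw [real_inner_comm], hsum, hb, one_pow]
    rw [h5]
    simp [b.norm_eq_one]
    ring
  have hpos : 0 < ∫ _ : Sph d, (1 : ℝ) ∂(sphMeasure d) := by
    have : Nontrivial (Vec d) := ⟨⟨b i₀, 0, fun h => by simp [h] at hb⟩⟩
    rw [integral_const, smul_eq_mul, mul_one, Measure.toSphere_real_apply_univ,
      finrank_euclideanSpace_fin]
    have h1 : 0 < (volume : Measure (Vec d)).real (Metric.ball 0 1) :=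
      ENNReal.toReal_pos (Metric.measure_ball_pos _ _ one_pos).ne' measure_ball_lt_top.ne
    have h2 : (0 : ℝ) < d := by exact_mod_cast Nat.pos_of_ne_zero hd
    positivity
  refine ⟨κ, ?_, by rw [hS, hmκ], by simpa only [hmκ] using h2, by simpa only [hmκ] using h11, h31⟩
  have h2 : (0 : ℝ) < d := by exact_mod_cast Nat.pos_of_ne_zero hd
  rw [hS] at hpos
  have h3 : 0 < m := pos_of_mul_pos_right hpos h2.le
  rw [hmκ] at h3
  have h4 : 0 < (d + 2) * κ := by linarith
  exact pos_of_mul_pos_right h4 (by positivity)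

end Sphere

/-! ### Symmetries of collisions -/

section Symmetries

variable {d : ℕ}

lemma measurePreserving_of_involutive {E : Type*} [NormedAddCommGroup E] [NormedSpace ℝ E]
    [MeasurableSpace E] [BorelSpace E] [FiniteDimensional ℝ E] (μ : Measure E)
    [μ.IsAddHaarMeasure] (f : E →ₗ[ℝ] E) (hf : ∀ x, f (f x) = x) : MeasurePreserving f μ μ := by
  have h1 : f * f = 1 := LinearMap.ext hf
  have h2 : LinearMap.det f * LinearMap.det f = 1 := by rw [← map_mul, h1, map_one]
  have h3 : LinearMap.det f ≠ 0 := fun h => by simp [h] at h2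
  have h4 : |LinearMap.det f| = 1 := by
    rcases mul_self_eq_one_iff.1 h2 with h | h <;> simp [h]
  refine ⟨f.continuous_of_finiteDimensional.measurable, ?_⟩
  rw [Measure.map_linearMap_addHaar_eq_smul_addHaar μ h3, abs_inv, h4]
  simp

/-- The measure `dω dv dv_*`. -/
abbrev tripleMeasure (d : ℕ) : Measure (Sph d × Vec d × Vec d) :=
  (sphMeasure d).prod (volume.prod volume)

/-- Exchange of the two colliding particles. -/
def exchange (q : Sph d × Vec d × Vec d) : Sph d × Vec d × Vec d := (q.1, q.2.2, q.2.1)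

/-- The map from pre- to post-collisional velocities. -/
def collide (q : Sph d × Vec d × Vec d) : Sph d × Vec d × Vec d :=
  (q.1, postVel q.2.1 q.2.2 q.1, postVelStar q.2.1 q.2.2 q.1)

lemma measurePreserving_exchange :
    MeasurePreserving (exchange (d := d)) (tripleMeasure d) (tripleMeasure d) :=
  (MeasurePreserving.id _).prod Measure.measurePreserving_swap

/-- The collision map for a fixed direction, as a linear map. -/
def collideLinear (ω : Vec d) : Vec d × Vec d →ₗ[ℝ] Vec d × Vec d where
  toFun p := (postVel p.1 p.2 ω, postVelStar p.1 p.2 ω)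
  map_add' p q := by
    ext1
    · simp only [postVel, Prod.fst_add, Prod.snd_add, inner_sub_left, inner_add_left]
      module
    · simp only [postVelStar, Prod.fst_add, Prod.snd_add, inner_sub_left, inner_add_left]
      module
  map_smul' c p := by
    ext1
    · simp only [postVel, Prod.smul_fst, Prod.smul_snd, inner_sub_left, real_inner_smul_left,
        RingHom.id_apply]
      module
    · simp only [postVelStar, Prod.smul_fst, Prod.smul_snd, inner_sub_left, real_inner_smul_left,
        RingHom.id_apply]
      module

section Kinematics

variable (v w : Vec d) {ω : Vec d} (hω : ‖ω‖ = 1)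
include hω

lemma inner_self_unit : ⟪ω, ω⟫ = 1 := by rw [real_inner_self_eq_norm_sq, hω, one_pow]

lemma inner_postVel : ⟪postVel v w ω, ω⟫ = ⟪w, ω⟫ := by
  rw [postVel, inner_sub_left, real_inner_smul_left, inner_self_unit hω, inner_sub_left]
  ring

lemma inner_postVelStar : ⟪postVelStar v w ω, ω⟫ = ⟪v, ω⟫ := by
  rw [postVelStar, inner_add_left, real_inner_smul_left, inner_self_unit hω, inner_sub_left]
  ring

lemma postVel_postVel : postVel (postVel v w ω) (postVelStar v w ω) ω = v := by
  conv_lhs => rw [postVel]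
  rw [inner_sub_left, inner_postVel v w hω, inner_postVelStar v w hω, postVel, inner_sub_left]
  module

lemma postVelStar_postVel : postVelStar (postVel v w ω) (postVelStar v w ω) ω = w := by
  conv_lhs => rw [postVelStar]
  rw [inner_sub_left, inner_postVel v w hω, inner_postVelStar v w hω, postVelStar, inner_sub_left]
  module

lemma norm_sq_postVel_add : ‖postVel v w ω‖ ^ 2 + ‖postVelStar v w ω‖ ^ 2 = ‖v‖ ^ 2 + ‖w‖ ^ 2 := by
  rw [postVel, postVelStar, norm_sub_sq_real, norm_add_sq_real, norm_smul, real_inner_smul_right,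
    real_inner_smul_right, hω, mul_one, Real.norm_eq_abs, sq_abs, inner_sub_left]
  ring

lemma norm_postVel_sub : ‖postVel v w ω - postVelStar v w ω‖ = ‖v - w‖ := by
  have h : postVel v w ω - postVelStar v w ω = (v - w) - (2 * ⟪v - w, ω⟫) • ω := by
    rw [postVel, postVelStar]
    module
  rw [h, ← sq_eq_sq₀ (norm_nonneg _) (norm_nonneg _), norm_sub_sq_real, norm_smul,
    real_inner_smul_right, hω, mul_one, Real.norm_eq_abs, sq_abs]
  ring

end Kinematics

lemma postVel_swap (v w ω : Vec d) : postVel w v ω = postVelStar v w ω := by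
  rw [postVel, postVelStar, ← neg_sub v w, inner_neg_left]
  module

lemma postVelStar_swap (v w ω : Vec d) : postVelStar w v ω = postVel v w ω := by
  rw [postVel, postVelStar, ← neg_sub v w, inner_neg_left]
  module

lemma postVel_neg (v w ω : Vec d) : postVel v w (-ω) = postVel v w ω := by simp [postVel]

lemma postVelStar_neg (v w ω : Vec d) : postVelStar v w (-ω) = postVelStar v w ω := by
  simp [postVelStar]

lemma postVel_sub_postVelStar_smul (v w ω : Vec d) :
    postVel v w ω - postVelStar v w ω = (v - w) - (2 * ⟪v - w, ω⟫) • ω := by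
  rw [postVel, postVelStar]
  module

lemma measurePreserving_collide :
    MeasurePreserving (collide (d := d)) (tripleMeasure d) (tripleMeasure d) := by
  refine (MeasurePreserving.id (sphMeasure d)).skew_product
    (g := fun (ω : Sph d) (p : Vec d × Vec d) => (postVel p.1 p.2 (ω : Vec d), postVelStar p.1 p.2 (ω : Vec d))) ?_
    (Eventually.of_forall fun ω => ?_)
  · unfold Function.uncurry postVel postVelStar
    fun_prop
  · refine (measurePreserving_of_involutive (volume.prod volume) (collideLinear (ω : Vec d))
      fun p => ?_).map_eq
    ext1
    · exact postVel_postVel p.1 p.2 (norm_sph ω)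
    · exact postVelStar_postVel p.1 p.2 (norm_sph ω)

lemma maxwellian_collide (v w : Vec d) {ω : Vec d} (hω : ‖ω‖ = 1) :
    maxwellian (postVel v w ω) * maxwellian (postVelStar v w ω) = maxwellian v * maxwellian w := by
  simp only [maxwellian]
  rw [mul_mul_mul_comm, ← Real.exp_add, mul_mul_mul_comm, ← Real.exp_add, ← add_div, ← add_div,
    ← neg_add, ← neg_add, norm_sq_postVel_add v w hω]

lemma integrable_comp_exchange {F : Sph d × Vec d × Vec d → ℝ}
    (hF : Integrable F (tripleMeasure d)) :
    Integrable (fun q => F (exchange q)) (tripleMeasure d) :=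
  measurePreserving_exchange.integrable_comp_of_integrable hF

lemma integrable_comp_collide {F : Sph d × Vec d × Vec d → ℝ}
    (hF : Integrable F (tripleMeasure d)) :
    Integrable (fun q => F (collide q)) (tripleMeasure d) :=
  measurePreserving_collide.integrable_comp_of_integrable hF

lemma integral_comp_measurePreserving {X : Type*} [MeasurableSpace X] {μ : Measure X} {T : X → X}
    (hT : MeasurePreserving T μ μ) {F : X → ℝ} (hF : AEStronglyMeasurable F μ) :
    ∫ q, F (T q) ∂μ = ∫ q, F q ∂μ := by
  conv_rhs => rw [← hT.map_eq]
  rw [integral_map hT.measurable.aemeasurable]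
  rwa [hT.map_eq]

/-- Summation over the orbit of the two collisional symmetries. -/
lemma integral_orbit {F : Sph d × Vec d × Vec d → ℝ} (hF : Integrable F (tripleMeasure d)) :
    ∫ q, (F q + F (exchange q) + F (exchange (collide q)) + F (collide q)) ∂(tripleMeasure d) =
      4 * ∫ q, F q ∂(tripleMeasure d) := by
  have h1 := integrable_comp_exchange hF
  have h2 := integrable_comp_collide hF
  have h3 := integrable_comp_collide h1
  have h4 : Integrable (fun q => F q + F (exchange q)) (tripleMeasure d) := hF.add h1
  have h5 : Integrable (fun q => F q + F (exchange q) + F (exchange (collide q)))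
    (tripleMeasure d) := h4.add h3
  rw [integral_add h5 h2, integral_add h4 h3, integral_add hF h1,
    integral_comp_measurePreserving measurePreserving_exchange hF.1,
    integral_comp_measurePreserving measurePreserving_collide hF.1,
    integral_comp_measurePreserving measurePreserving_collide h1.1,
    integral_comp_measurePreserving measurePreserving_exchange hF.1]
  ring

/-- `(ω, v, v_*) ↦ (v, v_*, ω)`. -/
def reorder (d : ℕ) : Sph d × Vec d × Vec d ≃ᵐ Vec d × Vec d × Sph d :=
  MeasurableEquiv.prodComm.trans MeasurableEquiv.prodAssoc

@[simp]
lemma measurePreserving_reorder :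
    MeasurePreserving (reorder d) (tripleMeasure d) (volume.prod (collisionMeasure d)) :=
  (measurePreserving_prodAssoc _ _ _).comp Measure.measurePreserving_swap

instance : SFinite (sphMeasure d) := inferInstance

instance : SFinite (collisionMeasure d) :=
  Measure.prod.instSFinite (μ := (volume : Measure (Vec d))) (ν := sphMeasure d)

lemma integral_triple {F : Vec d × Vec d × Sph d → ℝ}
    (hF : Integrable (fun q : Sph d × Vec d × Vec d => F (q.2.1, q.2.2, q.1)) (tripleMeasure d)) :
    ∫ q, F (q.2.1, q.2.2, q.1) ∂(tripleMeasure d) = ∫ v, ∫ p, F (v, p) ∂(collisionMeasure d) := by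
  have h1 : Integrable F (volume.prod (collisionMeasure d)) :=
    (measurePreserving_reorder.integrable_comp_emb (reorder d).measurableEmbedding).1 hF
  rw [← integral_prod _ h1,
    ← measurePreserving_reorder.integral_comp (reorder d).measurableEmbedding]
  rfl

lemma lintegral_triple {F : Vec d × Vec d × Sph d → ℝ≥0∞} (hF : Measurable F) :
    ∫⁻ q, F (q.2.1, q.2.2, q.1) ∂(tripleMeasure d) =
      ∫⁻ v, ∫⁻ p, F (v, p) ∂(collisionMeasure d) := by
  rw [← lintegral_prod _ hF.aemeasurable,
    ← measurePreserving_reorder.lintegral_comp hF]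
  rfl

lemma integrable_collisionMeasure {f : Vec d × Sph d → ℝ}
    (hf : AEStronglyMeasurable f (collisionMeasure d)) {C : ℝ} {k : ℕ}
    (h : ∀ p, |f p| ≤ C * (1 + ‖p.1‖) ^ k) :
    Integrable (fun p => maxwellian p.1 * f p) (collisionMeasure d) := by
  have h1 : Integrable (fun p : Vec d × Sph d => C * (maxwellian p.1 * (1 + ‖p.1‖) ^ k))
      (collisionMeasure d) :=
    ((integrable_maxwellian_mul_pow k).comp_fst _).const_mul C
  refine h1.mono' (AEStronglyMeasurable.mul (by fun_prop) hf) (Eventually.of_forall fun p => ?_)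
  rw [norm_mul, Real.norm_of_nonneg (maxwellian_nonneg _), Real.norm_eq_abs]
  nlinarith [h p, maxwellian_pos p.1]

lemma measurePreserving_collision_neg :
    MeasurePreserving (fun p : Vec d × Sph d => (p.1, -p.2)) (collisionMeasure d)
      (collisionMeasure d) :=
  (MeasurePreserving.id _).prod (measurePreserving_sphMap (LinearIsometryEquiv.neg ℝ))

lemma integral_collision_neg (f : Vec d × Sph d → ℝ) :
    ∫ p, f (p.1, -p.2) ∂(collisionMeasure d) = ∫ p, f p ∂(collisionMeasure d) :=
  measurePreserving_collision_neg.integral_comp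
    ((Homeomorph.refl (Vec d)).prodCongr (Homeomorph.neg (Sph d))).measurableEmbedding f

end Symmetries

/-! ### Symmetric collision kernels -/

section Kernel

variable {d : ℕ}

/-- Collision kernels that are even in the direction. -/
structure IsSymKernel (β : Vec d → Vec d → ℝ) : Prop where
  measurable : Measurable (Function.uncurry β)
  nonneg : ∀ z ω, ‖ω‖ = 1 → 0 ≤ β z ω
  invariant : ∀ z ω z' ω', ‖ω‖ = 1 → ‖ω'‖ = 1 → ‖z‖ = ‖z'‖ → |⟪z, ω⟫| = |⟪z', ω'⟫| →
    β z ω = β z' ω'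
  upper : ∃ C : ℝ, ∃ k : ℕ, ∀ z ω, ‖ω‖ = 1 → β z ω ≤ C * (1 + ‖z‖) ^ k
  lower : ∃ c : ℝ, 0 < c ∧ ∃ k : ℕ, ∀ z ω, ‖ω‖ = 1 → c * |⟪z, ω⟫| ≤ (1 + ‖z‖) ^ k * β z ω

/-- The even part of a cross-section in the direction. -/
def symKernel (b : Vec d → Vec d → ℝ) (z ω : Vec d) : ℝ := (b z ω + b z (-ω)) / 2

lemma IsCrossSection.symKernel {b : Vec d → Vec d → ℝ} (hb : IsCrossSection b) :
    IsSymKernel (symKernel b) where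
  measurable := by
    have h1 := hb.measurable
    have h2 : Measurable fun p : Vec d × Vec d => b p.1 (-p.2) :=
      h1.comp (measurable_fst.prodMk measurable_snd.neg)
    exact (h1.add h2).div_const 2
  nonneg z ω hω := by
    have h1 := hb.nonneg z ω hω
    have h2 := hb.nonneg z (-ω) (by rwa [norm_neg])
    unfold LinBoltz.symKernel
    linarith
  invariant z ω z' ω' hω hω' hz hs := by
    unfold LinBoltz.symKernel
    rw [hb.invariant z ω z' ω' hω hω' hz hs]
  upper := by
    obtain ⟨C, k, h⟩ := hb.upper
    refine ⟨C, k, fun z ω hω => ?_⟩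
    have h1 := h z ω hω
    have h2 := h z (-ω) (by rwa [norm_neg])
    unfold LinBoltz.symKernel
    linarith
  lower := by
    obtain ⟨c, hc, k, h⟩ := hb.lower
    refine ⟨c / 2, by positivity, k, fun z ω hω => ?_⟩
    have h1 := h z ω hω
    unfold LinBoltz.symKernel
    linarith

lemma integral_collision_even {F B : Vec d × Sph d → ℝ} (hF : Measurable F) (hB : Measurable B)
    (hF' : ∀ p, F (p.1, -p.2) = F p) (hB0 : ∀ p, 0 ≤ B p) :
    ∫ p, F p * B p ∂(collisionMeasure d) =
      ∫ p, F p * ((B p + B (p.1, -p.2)) / 2) ∂(collisionMeasure d) := by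
  have hn : Measurable fun p : Vec d × Sph d => (p.1, -p.2) :=
    measurePreserving_collision_neg.measurable
  by_cases hi : Integrable (fun p => F p * B p) (collisionMeasure d)
  · have h1 : Integrable (fun p => F p * B (p.1, -p.2)) (collisionMeasure d) := by
      refine (measurePreserving_collision_neg.integrable_comp_of_integrable hi).congr
        (Eventually.of_forall fun p => ?_)
      simp only [Function.comp_apply, hF']
    have h2 : ∫ p, F p * B (p.1, -p.2) ∂(collisionMeasure d) =
        ∫ p, F p * B p ∂(collisionMeasure d) := by
      rw [← integral_collision_neg fun p => F p * B p]
      simp only [hF']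
    have h3 : ∀ p, F p * ((B p + B (p.1, -p.2)) / 2) =
        1 / 2 * (F p * B p + F p * B (p.1, -p.2)) := fun p => by ring
    simp_rw [h3]
    rw [integral_const_mul, integral_add hi h1, h2]
    ring
  · rw [integral_undef hi, integral_undef]
    refine fun h => hi ((h.const_mul 2).mono (hF.mul hB).aestronglyMeasurable
      (Eventually.of_forall fun p => ?_))
    have h1 := hB0 p
    have h2 := hB0 (p.1, -p.2)
    have e1 : ‖F p * B p‖ = ‖F p‖ * B p := by rw [norm_mul, Real.norm_of_nonneg h1]
    have e2 : ‖2 * (F p * ((B p + B (p.1, -p.2)) / 2))‖ = ‖F p‖ * (B p + B (p.1, -p.2)) := by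
      rw [show 2 * (F p * ((B p + B (p.1, -p.2)) / 2)) = F p * (B p + B (p.1, -p.2)) by ring,
        norm_mul, Real.norm_of_nonneg (add_nonneg h1 h2)]
    rw [e1, e2]
    nlinarith [norm_nonneg (F p)]

lemma measurable_cross {b : Vec d → Vec d → ℝ} (hb : Measurable (Function.uncurry b)) (v : Vec d) :
    Measurable fun p : Vec d × Sph d => b (v - p.1) p.2 := by
  have h : Measurable fun p : Vec d × Sph d => (v - p.1, (p.2 : Vec d)) :=
    (measurable_fst.const_sub v).prodMk (measurable_subtype_coe.comp measurable_snd)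
  exact hb.comp h

lemma collisionFrequency_symKernel {b : Vec d → Vec d → ℝ} (hb : IsCrossSection b) :
    collisionFrequency (symKernel b) = collisionFrequency b := by
  ext v
  have key := integral_collision_even (d := d) (F := fun p => maxwellian p.1)
    (B := fun p => b (v - p.1) p.2) (measurable_maxwellian.comp measurable_fst)
    (measurable_cross hb.measurable v) (fun _ => rfl) (fun p => hb.nonneg _ _ (norm_sph p.2))
  simp only [collisionFrequency, symKernel]
  rw [key]
  rfl

lemma linColl_symKernel {b : Vec d → Vec d → ℝ} (hb : IsCrossSection b) {h : Vec d → ℝ}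
    (hh : Measurable h) : linColl (symKernel b) h = linColl b h := by
  ext v
  refine (integral_collision_even (F := fun p => (h p.1 + h v - h (postVelStar v p.1 p.2) -
    h (postVel v p.1 p.2)) * maxwellian p.1) (B := fun p => b (v - p.1) p.2) ?_
    (measurable_cross hb.measurable v) (fun p => ?_) (fun p => hb.nonneg _ _ (norm_sph p.2))).symm
  · unfold postVel postVelStar
    fun_prop
  · have : ((-p.2 : Sph d) : Vec d) = -(p.2 : Vec d) := rfl
    simp only [this, postVel_neg, postVelStar_neg]

namespace IsSymKernel

variable {β : Vec d → Vec d → ℝ} (hβ : IsSymKernel β)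
include hβ

lemma measurable_triple :
    Measurable fun q : Sph d × Vec d × Vec d => β (q.2.1 - q.2.2) q.1 :=
  hβ.measurable.comp (f := fun q : Sph d × Vec d × Vec d => (q.2.1 - q.2.2, (q.1 : Vec d)))
    (by fun_prop)

lemma measurable_reordered :
    Measurable fun q : Vec d × Vec d × Sph d => β (q.1 - q.2.1) q.2.2 :=
  hβ.measurable.comp (f := fun q : Vec d × Vec d × Sph d => (q.1 - q.2.1, (q.2.2 : Vec d)))
    (by fun_prop)

lemma apply_exchange (v w : Vec d) (ω : Sph d) : β (w - v) ω = β (v - w) ω := by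
  refine hβ.invariant _ _ _ _ (norm_sph ω) (norm_sph ω) (norm_sub_rev _ _) ?_
  rw [← neg_sub v w, inner_neg_left, abs_neg]

lemma apply_collide (v w : Vec d) (ω : Sph d) :
    β (postVel v w ω - postVelStar v w ω) ω = β (v - w) ω := by
  refine hβ.invariant _ _ _ _ (norm_sph ω) (norm_sph ω) (norm_postVel_sub v w (norm_sph ω)) ?_
  rw [inner_sub_left, inner_postVel v w (norm_sph ω), inner_postVelStar v w (norm_sph ω),
    inner_sub_left, abs_sub_comm]

lemma exists_upper : ∃ C : ℝ, 0 ≤ C ∧ ∃ k : ℕ, ∀ (v w : Vec d) (ω : Sph d),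
    β (v - w) ω ≤ C * ((1 + ‖v‖) ^ k * (1 + ‖w‖) ^ k) := by
  obtain ⟨C, k, h⟩ := hβ.upper
  refine ⟨|C|, abs_nonneg C, k, fun v w ω => (h _ _ (norm_sph ω)).trans ?_⟩
  have h1 : 1 + ‖v - w‖ ≤ (1 + ‖v‖) * (1 + ‖w‖) := by
    have := norm_sub_le v w
    nlinarith [norm_nonneg v, norm_nonneg w]
  rw [← mul_pow]
  gcongr
  exact le_abs_self C

lemma integrable_freq (v : Vec d) :
    Integrable (fun p : Vec d × Sph d => maxwellian p.1 * β (v - p.1) p.2)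
      (collisionMeasure d) := by
  obtain ⟨C, -, k, h⟩ := hβ.exists_upper
  refine integrable_collisionMeasure (measurable_cross hβ.measurable v).aestronglyMeasurable
    (C := C * (1 + ‖v‖) ^ k) (k := k) fun p => ?_
  rw [abs_of_nonneg (hβ.nonneg _ _ (norm_sph p.2)), mul_assoc]
  exact h v p.1 p.2

lemma measurable_collisionFrequency : Measurable (collisionFrequency β) := by
  have : StronglyMeasurable fun q : Vec d × Vec d × Sph d =>
      maxwellian q.2.1 * β (q.1 - q.2.1) q.2.2 := by
    refine Measurable.stronglyMeasurable (Measurable.mul (by fun_prop) hβ.measurable_reordered)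
  exact this.integral_prod_right.measurable

lemma collisionFrequency_nonneg (v : Vec d) : 0 ≤ collisionFrequency β v :=
  integral_nonneg fun p => mul_nonneg (maxwellian_nonneg _) (hβ.nonneg _ _ (norm_sph p.2))

lemma ofReal_collisionFrequency (v : Vec d) : ENNReal.ofReal (collisionFrequency β v) =
    ∫⁻ p : Vec d × Sph d, ENNReal.ofReal (maxwellian p.1 * β (v - p.1) p.2)
      ∂(collisionMeasure d) :=
  ofReal_integral_eq_lintegral_ofReal (hβ.integrable_freq v)
    (Eventually.of_forall fun p => mul_nonneg (maxwellian_nonneg _) (hβ.nonneg _ _ (norm_sph p.2)))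

lemma exists_collisionFrequency_le : ∃ C : ℝ, 0 ≤ C ∧ ∃ k : ℕ, ∀ v,
    collisionFrequency β v ≤ C * (1 + ‖v‖) ^ k := by
  obtain ⟨C, hC, k, h⟩ := hβ.exists_upper
  have h1 : Integrable (fun p : Vec d × Sph d => maxwellian p.1 * (1 + ‖p.1‖) ^ k)
      (collisionMeasure d) := (integrable_maxwellian_mul_pow k).comp_fst _
  refine ⟨C * ∫ p, maxwellian p.1 * (1 + ‖p.1‖) ^ k ∂(collisionMeasure d),
    mul_nonneg hC (integral_nonneg fun p => mul_nonneg (maxwellian_nonneg _) (by positivity)), k,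
    fun v => ?_⟩
  rw [mul_right_comm, ← integral_const_mul]
  refine integral_mono (hβ.integrable_freq v) (h1.const_mul _) fun p => ?_
  have := mul_le_mul_of_nonneg_left (h v p.1 p.2) (maxwellian_nonneg p.1)
  simp only
  linarith

lemma exists_le_collisionFrequency (hd : d ≠ 0) : ∃ c : ℝ, 0 < c ∧ ∃ k : ℕ, ∀ v,
    c ≤ (1 + ‖v‖) ^ k * collisionFrequency β v := by
  obtain ⟨c, hc, k, h⟩ := hβ.lower
  let G : Vec d → Vec d × Sph d → ℝ := fun v p =>
    maxwellian p.1 * (((1 + ‖p.1‖) ^ k)⁻¹ * |⟪v - p.1, p.2⟫|)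
  have hinv : ∀ w : Vec d, ((1 + ‖w‖) ^ k)⁻¹ ≤ 1 := fun w =>
    inv_le_one_of_one_le₀ (one_le_pow₀ (by linarith [norm_nonneg w]))
  have hne : ∀ w : Vec d, (1 + ‖w‖) ^ k ≠ 0 := fun w => by positivity
  have hGc : ∀ v, Continuous (G v) := fun v => by
    have : Continuous fun p : Vec d × Sph d => ((1 + ‖p.1‖) ^ k)⁻¹ :=
      Continuous.inv₀ (by fun_prop) fun p => hne _
    fun_prop
  have hGi : ∀ v, Integrable (G v) (collisionMeasure d) := fun v => by
    refine integrable_collisionMeasure (C := 1 + ‖v‖) (k := 1) ?_ fun p => ?_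
    · have : Continuous fun p : Vec d × Sph d => ((1 + ‖p.1‖) ^ k)⁻¹ :=
        Continuous.inv₀ (by fun_prop) fun p => hne _
      exact Continuous.aestronglyMeasurable (by fun_prop)
    · rw [abs_mul, abs_abs, abs_of_nonneg (by positivity)]
      have h1 := abs_real_inner_le_norm (v - p.1) (p.2 : Vec d)
      rw [norm_sph, mul_one] at h1
      have h2 := norm_sub_le v p.1
      calc _ ≤ 1 * |⟪v - p.1, (p.2 : Vec d)⟫| := by gcongr; exact hinv _
        _ ≤ _ := by nlinarith [norm_nonneg v, norm_nonneg p.1]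
  have hpos : 0 < ∫ p, G 0 p ∂(collisionMeasure d) := by
    let e : Vec d := EuclideanSpace.basisFun (Fin d) ℝ ⟨0, Nat.pos_of_ne_zero hd⟩
    have he : ‖e‖ = 1 := (EuclideanSpace.basisFun (Fin d) ℝ).norm_eq_one _
    have : (collisionMeasure d).IsOpenPosMeasure :=
      Measure.prod.instIsOpenPosMeasure (μ := (volume : Measure (Vec d))) (ν := sphMeasure d)
    refine integral_pos_of_integrable_nonneg_nonzero (x := (e, ⟨e, by simp [he]⟩)) (hGc 0) (hGi 0)
      (fun p => mul_nonneg (maxwellian_nonneg _) (by positivity)) ?_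
    have h1 : e ≠ 0 := norm_ne_zero_iff.1 (by simp [he])
    have h2 := (maxwellian_pos e).ne'
    simp [G, h1, h2, hne]
  have hle : ∀ v, ∫ p, G 0 p ∂(collisionMeasure d) ≤ ∫ p, G v p ∂(collisionMeasure d) := by
    intro v
    have hmp : MeasurePreserving (fun p : Vec d × Sph d => (-p.1, p.2)) (collisionMeasure d)
        (collisionMeasure d) := (Measure.measurePreserving_neg _).prod (MeasurePreserving.id _)
    have h1 : ∫ p : Vec d × Sph d, G v (-p.1, p.2) ∂(collisionMeasure d) =
        ∫ p, G v p ∂(collisionMeasure d) :=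
      integral_comp_measurePreserving hmp (hGc v).aestronglyMeasurable
    have h2 : Integrable (fun p : Vec d × Sph d => G v (-p.1, p.2)) (collisionMeasure d) :=
      hmp.integrable_comp_of_integrable (hGi v)
    have h3 : ∫ p, 2 * G 0 p ∂(collisionMeasure d) ≤
        ∫ p : Vec d × Sph d, (G v p + G v (-p.1, p.2)) ∂(collisionMeasure d) := by
      refine integral_mono ((hGi 0).const_mul 2) ((hGi v).add h2) fun p => ?_
      simp only [G, maxwellian_neg, norm_neg]
      rw [← mul_add, ← mul_add, mul_left_comm, mul_left_comm 2]
      have := maxwellian_nonneg p.1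
      gcongr
      have h4 := abs_sub (⟪v - p.1, (p.2 : Vec d)⟫) (⟪v - -p.1, (p.2 : Vec d)⟫)
      rw [← inner_sub_left, show v - p.1 - (v - -p.1) = (2 : ℝ) • (0 - p.1) by module,
        real_inner_smul_left, abs_mul, abs_two] at h4
      exact h4
    rw [integral_const_mul, integral_add (hGi v) h2, h1] at h3
    linarith
  refine ⟨c * ∫ p, G 0 p ∂(collisionMeasure d), by positivity, k, fun v => ?_⟩
  refine (mul_le_mul_of_nonneg_left (hle v) hc.le).trans ?_
  unfold collisionFrequency
  rw [← integral_const_mul, ← integral_const_mul]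
  refine integral_mono ((hGi v).const_mul c) ((hβ.integrable_freq v).const_mul _) fun p => ?_
  have h1 := h (v - p.1) p.2 (norm_sph p.2)
  have h2 : (1 + ‖v - p.1‖) ^ k ≤ (1 + ‖v‖) ^ k * (1 + ‖p.1‖) ^ k := by
    rw [← mul_pow]
    gcongr
    have := norm_sub_le v p.1
    nlinarith [norm_nonneg v, norm_nonneg p.1]
  have h3 := hβ.nonneg (v - p.1) p.2 (norm_sph p.2)
  have h4 : c * |⟪v - p.1, (p.2 : Vec d)⟫| ≤ (1 + ‖v‖) ^ k * (1 + ‖p.1‖) ^ k *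
      β (v - p.1) p.2 := h1.trans (by gcongr)
  have h5 : ((1 + ‖p.1‖) ^ k)⁻¹ * (c * |⟪v - p.1, (p.2 : Vec d)⟫|) ≤
      (1 + ‖v‖) ^ k * β (v - p.1) p.2 := by
    rw [inv_mul_le_iff₀ (by positivity)]
    linarith
  have h6 := mul_le_mul_of_nonneg_left h5 (maxwellian_nonneg p.1)
  simp only [G]
  linarith

lemma collisionFrequency_pos (hd : d ≠ 0) (v : Vec d) : 0 < collisionFrequency β v := by
  obtain ⟨c, hc, k, h⟩ := hβ.exists_le_collisionFrequency hd
  exact pos_of_mul_pos_right (hc.trans_le (h v)) (by positivity)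

lemma exists_inv_collisionFrequency_le (hd : d ≠ 0) : ∃ C : ℝ, 0 ≤ C ∧ ∃ k : ℕ, ∀ v,
    (collisionFrequency β v)⁻¹ ≤ C * (1 + ‖v‖) ^ k := by
  obtain ⟨c, hc, k, h⟩ := hβ.exists_le_collisionFrequency hd
  refine ⟨c⁻¹, by positivity, k, fun v => ?_⟩
  have h1 := hβ.collisionFrequency_pos hd v
  rw [inv_le_iff_one_le_mul₀ h1, mul_assoc, ← div_eq_inv_mul, one_le_div hc]
  exact h v

end IsSymKernel

end Kernel

/-! ### The entropy dissipation -/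

section Dissipation

variable {d : ℕ}

/-- The density `M(v) M(v_*) β(v - v_*, ω)`. -/
def collisionWeight (β : Vec d → Vec d → ℝ) (q : Sph d × Vec d × Vec d) : ℝ :=
  maxwellian q.2.1 * maxwellian q.2.2 * β (q.2.1 - q.2.2) q.1

/-- The collision difference `h(v_*) + h(v) - h(v'_*) - h(v')`. -/
def collisionDiff (h : Vec d → ℝ) (q : Sph d × Vec d × Vec d) : ℝ :=
  h q.2.2 + h q.2.1 - h (postVelStar q.2.1 q.2.2 q.1) - h (postVel q.2.1 q.2.2 q.1)

lemma collisionDiff_exchange (h : Vec d → ℝ) (q : Sph d × Vec d × Vec d) :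
    collisionDiff h (exchange q) = collisionDiff h q := by
  unfold collisionDiff exchange
  rw [postVelStar_swap q.2.1 q.2.2, postVel_swap q.2.1 q.2.2]
  ring

lemma collisionDiff_collide (h : Vec d → ℝ) (q : Sph d × Vec d × Vec d) :
    collisionDiff h (collide q) = -collisionDiff h q := by
  simp only [collisionDiff, collide, postVel_postVel _ _ (norm_sph q.1),
    postVelStar_postVel _ _ (norm_sph q.1)]
  ring

lemma measurable_collisionDiff {Y : Type*} [MeasurableSpace Y] {G : Y → Vec d → ℝ}
    (hG : Measurable (Function.uncurry G)) :
    Measurable fun p : Y × Sph d × Vec d × Vec d => collisionDiff (G p.1) p.2 := by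
  have h1 : Measurable fun p : Y × Sph d × Vec d × Vec d => G p.1 p.2.2.2 :=
    hG.comp (f := fun p : Y × Sph d × Vec d × Vec d => (p.1, p.2.2.2)) (by fun_prop)
  have h2 : Measurable fun p : Y × Sph d × Vec d × Vec d => G p.1 p.2.2.1 :=
    hG.comp (f := fun p : Y × Sph d × Vec d × Vec d => (p.1, p.2.2.1)) (by fun_prop)
  have h3 : Measurable fun p : Y × Sph d × Vec d × Vec d =>
      G p.1 (postVelStar p.2.2.1 p.2.2.2 p.2.1) := by
    refine hG.comp (f := fun p : Y × Sph d × Vec d × Vec d =>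
      (p.1, postVelStar p.2.2.1 p.2.2.2 p.2.1)) ?_
    unfold postVelStar
    fun_prop
  have h4 : Measurable fun p : Y × Sph d × Vec d × Vec d =>
      G p.1 (postVel p.2.2.1 p.2.2.2 p.2.1) := by
    refine hG.comp (f := fun p : Y × Sph d × Vec d × Vec d =>
      (p.1, postVel p.2.2.1 p.2.2.2 p.2.1)) ?_
    unfold postVel
    fun_prop
  exact ((h1.add h2).sub h3).sub h4

lemma measurable_collisionDiff_apply {h : Vec d → ℝ} (hh : Measurable h) :
    Measurable (collisionDiff h) :=
  (measurable_collisionDiff (Y := Unit) (G := fun _ => h) (hh.comp measurable_snd)).comp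
    (measurable_const.prodMk measurable_id : Measurable fun q => ((), q))

lemma linColl_eq (β : Vec d → Vec d → ℝ) (h : Vec d → ℝ) (v : Vec d) :
    linColl β h v = ∫ p : Vec d × Sph d, maxwellian p.1 * β (v - p.1) p.2 *
      collisionDiff h (p.2, v, p.1) ∂(collisionMeasure d) := by
  unfold linColl collisionDiff
  congr 1
  ext p
  ring

lemma sq_collisionDiff_le (h : Vec d → ℝ) (q : Sph d × Vec d × Vec d) :
    collisionDiff h q ^ 2 ≤ 4 * (h q.2.1 ^ 2 + h (exchange q).2.1 ^ 2 +
      h (exchange (collide q)).2.1 ^ 2 + h (collide q).2.1 ^ 2) := by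
  simp only [collisionDiff, exchange, collide]
  generalize h q.2.2 = x
  generalize h q.2.1 = y
  generalize h (postVelStar _ _ _) = z
  generalize h (postVel _ _ _) = w
  nlinarith [sq_nonneg (x - y), sq_nonneg (x + z), sq_nonneg (x + w), sq_nonneg (y + z),
    sq_nonneg (y + w), sq_nonneg (z - w)]

lemma lintegral_sq_le {X : Type*} [MeasurableSpace X] (μ : Measure X) {f : X → ℝ≥0∞}
    (hf : AEMeasurable f μ) : (∫⁻ x, f x ∂μ) ^ 2 ≤ μ Set.univ * ∫⁻ x, f x ^ 2 ∂μ := by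
  have h := ENNReal.lintegral_mul_le_Lp_mul_Lq μ Real.HolderConjugate.two_two hf
    (aemeasurable_const (b := (1 : ℝ≥0∞)))
  simp only [Pi.mul_apply, mul_one, lintegral_const, one_mul, one_pow, ENNReal.rpow_two] at h
  calc (∫⁻ x, f x ∂μ) ^ 2
      ≤ ((∫⁻ x, f x ^ 2 ∂μ) ^ (1 / 2 : ℝ) * μ Set.univ ^ (1 / 2 : ℝ)) ^ 2 := by gcongr
    _ = _ := by
      rw [mul_pow, ← ENNReal.rpow_natCast, ← ENNReal.rpow_natCast, ← ENNReal.rpow_mul,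
        ← ENNReal.rpow_mul]
      norm_num
      rw [mul_comm]

namespace IsSymKernel

variable {β : Vec d → Vec d → ℝ} (hβ : IsSymKernel β)
include hβ

lemma weight_nonneg (q : Sph d × Vec d × Vec d) : 0 ≤ collisionWeight β q :=
  mul_nonneg (mul_nonneg (maxwellian_nonneg _) (maxwellian_nonneg _))
    (hβ.nonneg _ _ (norm_sph q.1))

lemma measurable_weight : Measurable (collisionWeight β) :=
  Measurable.mul (by fun_prop) hβ.measurable_triple

lemma weight_exchange (q : Sph d × Vec d × Vec d) :
    collisionWeight β (exchange q) = collisionWeight β q := by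
  simp only [collisionWeight, exchange, hβ.apply_exchange q.2.1 q.2.2 q.1]
  ring

lemma weight_collide (q : Sph d × Vec d × Vec d) :
    collisionWeight β (collide q) = collisionWeight β q := by
  simp only [collisionWeight, collide, hβ.apply_collide q.2.1 q.2.2 q.1,
    maxwellian_collide _ _ (norm_sph q.1)]

lemma lintegral_weight {F : Vec d → ℝ≥0∞} (hF : Measurable F) :
    ∫⁻ q, F q.2.1 * ENNReal.ofReal (collisionWeight β q) ∂(tripleMeasure d) =
      ∫⁻ v, F v * ENNReal.ofReal (collisionFrequency β v * maxwellian v) := by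
  have hm : Measurable fun q : Vec d × Vec d × Sph d =>
      F q.1 * ENNReal.ofReal (maxwellian q.1 * maxwellian q.2.1 * β (q.1 - q.2.1) q.2.2) :=
    (hF.comp measurable_fst).mul
      (Measurable.mul (by fun_prop) hβ.measurable_reordered).ennreal_ofReal
  refine (lintegral_triple hm).trans (lintegral_congr fun v => ?_)
  have h1 : ∀ p : Vec d × Sph d,
      F v * ENNReal.ofReal (maxwellian v * maxwellian p.1 * β (v - p.1) p.2) =
        F v * ENNReal.ofReal (maxwellian v) *
          ENNReal.ofReal (maxwellian p.1 * β (v - p.1) p.2) := fun p => by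
    rw [mul_assoc (maxwellian v), ENNReal.ofReal_mul (maxwellian_nonneg v), mul_assoc]
  simp only [h1]
  have h2 : Measurable fun p : Vec d × Sph d =>
      ENNReal.ofReal (maxwellian p.1 * β (v - p.1) p.2) :=
    ((measurable_maxwellian.comp measurable_fst).mul
      (measurable_cross hβ.measurable v)).ennreal_ofReal
  rw [lintegral_const_mul _ h2, ← hβ.ofReal_collisionFrequency, mul_assoc,
    ← ENNReal.ofReal_mul (maxwellian_nonneg v), mul_comm (maxwellian v)]

lemma integrable_weight_mul_sq {h : Vec d → ℝ} (hh : Measurable h)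
    (hi : Integrable fun v => collisionFrequency β v * maxwellian v * h v ^ 2) :
    Integrable (fun q => collisionWeight β q * h q.2.1 ^ 2) (tripleMeasure d) := by
  refine ⟨(hβ.measurable_weight.mul (by fun_prop)).aestronglyMeasurable, ?_⟩
  have h1 := hi.2
  rw [hasFiniteIntegral_iff_ofReal (Eventually.of_forall fun v => mul_nonneg (mul_nonneg
    (hβ.collisionFrequency_nonneg v) (maxwellian_nonneg v)) (sq_nonneg _))] at h1
  rw [hasFiniteIntegral_iff_ofReal (Eventually.of_forall fun q =>
    mul_nonneg (hβ.weight_nonneg q) (sq_nonneg _))]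
  refine lt_of_eq_of_lt ?_ h1
  have h2 := hβ.lintegral_weight (F := fun v => ENNReal.ofReal (h v ^ 2)) (by fun_prop)
  convert h2 using 1
  · refine lintegral_congr fun q => ?_
    rw [mul_comm, ENNReal.ofReal_mul (sq_nonneg _)]
  · refine lintegral_congr fun v => ?_
    rw [mul_comm, ENNReal.ofReal_mul (sq_nonneg _)]

lemma integrable_weight_mul_diff_sq {h : Vec d → ℝ} (hh : Measurable h)
    (hi : Integrable fun v => collisionFrequency β v * maxwellian v * h v ^ 2) :
    Integrable (fun q => collisionWeight β q * collisionDiff h q ^ 2) (tripleMeasure d) := by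
  have h0 := hβ.integrable_weight_mul_sq hh hi
  have h1 := integrable_comp_exchange h0
  have h2 := integrable_comp_collide h0
  have h3 := integrable_comp_collide h1
  refine ((((h0.add h1).add h3).add h2).const_mul 4).mono'
    (hβ.measurable_weight.mul ((measurable_collisionDiff_apply hh).pow_const 2)).aestronglyMeasurable
    (Eventually.of_forall fun q => ?_)
  rw [Real.norm_of_nonneg (mul_nonneg (hβ.weight_nonneg q) (sq_nonneg _))]
  simp only [Pi.add_apply, hβ.weight_exchange, hβ.weight_collide]
  have := mul_le_mul_of_nonneg_left (sq_collisionDiff_le h q) (hβ.weight_nonneg q)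
  linarith

/-- `∫ M h 𝓛h = ¼ ∫ (h + h_* - h' - h'_*)² M M_* β`. -/
lemma integral_mul_linColl {h : Vec d → ℝ} (hh : Measurable h)
    (hi : Integrable fun v => collisionFrequency β v * maxwellian v * h v ^ 2) :
    4 * ∫ v, maxwellian v * (h v * linColl β h v) =
      ∫ q, collisionWeight β q * collisionDiff h q ^ 2 ∂(tripleMeasure d) := by
  have hD := hβ.integrable_weight_mul_diff_sq hh hi
  have h0 := hβ.integrable_weight_mul_sq hh hi
  have hF : Integrable (fun q => collisionWeight β q * h q.2.1 * collisionDiff h q)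
      (tripleMeasure d) :=
    integrable_mul_mul hβ.measurable_weight.aestronglyMeasurable
      (hh.comp (measurable_fst.comp measurable_snd)).aestronglyMeasurable
      (measurable_collisionDiff_apply hh).aestronglyMeasurable hβ.weight_nonneg hβ.weight_nonneg
      (fun q => (sq _).le) h0 hD
  have h1 : ∫ v, maxwellian v * (h v * linColl β h v) =
      ∫ q, collisionWeight β q * h q.2.1 * collisionDiff h q ∂(tripleMeasure d) := by
    refine Eq.symm ((integral_triple (F := fun q => maxwellian q.1 * maxwellian q.2.1 *
      β (q.1 - q.2.1) q.2.2 * h q.1 * collisionDiff h (q.2.2, q.1, q.2.1)) hF).trans ?_)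
    congr 1
    ext v
    rw [linColl_eq, ← mul_assoc, ← integral_const_mul]
    congr 1
    ext p
    ring
  rw [h1, ← integral_orbit hF]
  congr 1
  ext q
  simp only [hβ.weight_exchange, hβ.weight_collide, collisionDiff_exchange, collisionDiff_collide]
  simp only [exchange, collide]
  nth_rw 5 [collisionDiff]
  unfold collisionDiff
  ring

lemma measurable_linColl {Y : Type*} [MeasurableSpace Y] {G : Y → Vec d → ℝ}
    (hG : Measurable (Function.uncurry G)) :
    Measurable fun p : Y × Vec d => linColl β (G p.1) p.2 := by
  have h1 : Measurable fun q : (Y × Vec d) × Vec d × Sph d =>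
      collisionDiff (G q.1.1) (q.2.2, q.1.2, q.2.1) :=
    (measurable_collisionDiff hG).comp
      (f := fun q : (Y × Vec d) × Vec d × Sph d => (q.1.1, q.2.2, q.1.2, q.2.1)) (by fun_prop)
  have h2 : Measurable fun q : (Y × Vec d) × Vec d × Sph d => β (q.1.2 - q.2.1) q.2.2 :=
    hβ.measurable_reordered.comp
      (f := fun q : (Y × Vec d) × Vec d × Sph d => (q.1.2, q.2.1, q.2.2)) (by fun_prop)
  have h3 : Measurable fun q : (Y × Vec d) × Vec d × Sph d =>
      maxwellian q.2.1 * β (q.1.2 - q.2.1) q.2.2 * collisionDiff (G q.1.1) (q.2.2, q.1.2, q.2.1) :=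
    (Measurable.mul (by fun_prop) h2).mul h1
  have h4 := h3.stronglyMeasurable.integral_prod_right' (ν := collisionMeasure d)
  simp_rw [linColl_eq]
  exact h4.measurable

lemma ofReal_sq_linColl_le {h : Vec d → ℝ} (hh : Measurable h) (v : Vec d) :
    ENNReal.ofReal (linColl β h v ^ 2) ≤ ENNReal.ofReal (collisionFrequency β v) *
      ∫⁻ p : Vec d × Sph d, ENNReal.ofReal (collisionDiff h (p.2, v, p.1) ^ 2) *
        ENNReal.ofReal (maxwellian p.1 * β (v - p.1) p.2) ∂(collisionMeasure d) := by
  set w : Vec d × Sph d → ℝ := fun p => maxwellian p.1 * β (v - p.1) p.2 with hw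
  have hwm : Measurable w := (measurable_maxwellian.comp measurable_fst).mul
    (measurable_cross hβ.measurable v)
  have hw0 : ∀ p, 0 ≤ w p := fun p =>
    mul_nonneg (maxwellian_nonneg _) (hβ.nonneg _ _ (norm_sph p.2))
  set ν := (collisionMeasure d).withDensity fun p => ENNReal.ofReal (w p) with hν
  have hδ : Measurable fun p : Vec d × Sph d => collisionDiff h (p.2, v, p.1) :=
    (measurable_collisionDiff_apply hh).comp
      (f := fun p : Vec d × Sph d => (p.2, v, p.1)) (by fun_prop)
  have h1 : linColl β h v = ∫ p, collisionDiff h (p.2, v, p.1) ∂ν := by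
    rw [linColl_eq, hν, integral_withDensity_ofReal hwm hw0]
  have hsq : ∀ x : ℝ, ENNReal.ofReal (x ^ 2) = ‖x‖ₑ ^ 2 := fun x => by
    rw [Real.enorm_eq_ofReal_abs, ← ENNReal.ofReal_pow (abs_nonneg x), sq_abs]
  have h2 : ν Set.univ = ENNReal.ofReal (collisionFrequency β v) := by
    rw [hν, withDensity_apply _ MeasurableSet.univ, Measure.restrict_univ,
      hβ.ofReal_collisionFrequency]
  rw [h1, hsq, ← h2]
  calc ‖∫ p, collisionDiff h (p.2, v, p.1) ∂ν‖ₑ ^ 2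
      ≤ (∫⁻ p, ‖collisionDiff h (p.2, v, p.1)‖ₑ ∂ν) ^ 2 := by
        gcongr
        exact enorm_integral_le_lintegral_enorm _
    _ ≤ ν Set.univ * ∫⁻ p, ‖collisionDiff h (p.2, v, p.1)‖ₑ ^ 2 ∂ν :=
        lintegral_sq_le ν hδ.enorm.aemeasurable
    _ = _ := by
        congr 1
        rw [hν, lintegral_withDensity_eq_lintegral_mul _ hwm.ennreal_ofReal (by fun_prop)]
        refine lintegral_congr fun p => ?_
        rw [Pi.mul_apply, mul_comm, hsq]

lemma lintegral_diff_sq_le {h : Vec d → ℝ} (hh : Measurable h) :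
    ∫⁻ q, ENNReal.ofReal (collisionDiff h q ^ 2) * ENNReal.ofReal (collisionWeight β q)
        ∂(tripleMeasure d) ≤
      16 * ∫⁻ v, ENNReal.ofReal (h v ^ 2) *
        ENNReal.ofReal (collisionFrequency β v * maxwellian v) := by
  set H : Sph d × Vec d × Vec d → ℝ≥0∞ := fun q =>
    ENNReal.ofReal (h q.2.1 ^ 2) * ENNReal.ofReal (collisionWeight β q) with hH
  have hHm : Measurable H :=
    Measurable.mul (by fun_prop) hβ.measurable_weight.ennreal_ofReal
  have e1 : ∫⁻ q, H (exchange q) ∂(tripleMeasure d) = ∫⁻ q, H q ∂(tripleMeasure d) :=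
    measurePreserving_exchange.lintegral_comp hHm
  have m1 : Measurable fun q => H (exchange q) := hHm.comp measurePreserving_exchange.measurable
  have m2 : Measurable fun q => H (collide q) := hHm.comp measurePreserving_collide.measurable
  have m3 : Measurable fun q => H (exchange (collide q)) :=
    m1.comp measurePreserving_collide.measurable
  have e2 : ∫⁻ q, H (collide q) ∂(tripleMeasure d) = ∫⁻ q, H q ∂(tripleMeasure d) :=
    measurePreserving_collide.lintegral_comp hHm
  have e3 : ∫⁻ q, H (exchange (collide q)) ∂(tripleMeasure d) = ∫⁻ q, H q ∂(tripleMeasure d) :=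
    (measurePreserving_collide.lintegral_comp m1).trans e1
  have h2 := hβ.lintegral_weight (F := fun v => ENNReal.ofReal (h v ^ 2)) (by fun_prop)
  rw [← h2]
  calc _ ≤ ∫⁻ q, 4 * (H q + H (exchange q) + H (exchange (collide q)) + H (collide q))
        ∂(tripleMeasure d) := by
        refine lintegral_mono fun q => ?_
        simp only [hH, hβ.weight_exchange, hβ.weight_collide]
        rw [← add_mul, ← add_mul, ← add_mul, ← mul_assoc]
        gcongr
        rw [← ENNReal.ofReal_add (by positivity) (by positivity),
          ← ENNReal.ofReal_add (by positivity) (by positivity),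
          ← ENNReal.ofReal_add (by positivity) (by positivity),
          show (4 : ℝ≥0∞) = ENNReal.ofReal 4 by norm_num, ← ENNReal.ofReal_mul (by norm_num)]
        exact ENNReal.ofReal_le_ofReal (sq_collisionDiff_le h q)
    _ = _ := by
        rw [lintegral_const_mul' _ _ (by norm_num), lintegral_add_right _ m2, lintegral_add_right _ m3,
          lintegral_add_right _ m1, e1, e2, e3]
        ring

lemma lintegral_sq_linColl_le (hd : d ≠ 0) {h : Vec d → ℝ} (hh : Measurable h) :
    ∫⁻ v, ENNReal.ofReal ((collisionFrequency β v)⁻¹ * maxwellian v * linColl β h v ^ 2) ≤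
      16 * ∫⁻ v, ENNReal.ofReal (collisionFrequency β v * maxwellian v * h v ^ 2) := by
  have hm : Measurable fun q : Vec d × Vec d × Sph d =>
      ENNReal.ofReal (collisionDiff h (q.2.2, q.1, q.2.1) ^ 2) *
      ENNReal.ofReal (maxwellian q.1 * maxwellian q.2.1 * β (q.1 - q.2.1) q.2.2) := by
    refine Measurable.mul ?_ (Measurable.mul (by fun_prop) hβ.measurable_reordered).ennreal_ofReal
    exact (((measurable_collisionDiff_apply hh).comp
      (f := fun q : Vec d × Vec d × Sph d => (q.2.2, q.1, q.2.1)) (by fun_prop)).pow_const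
        2).ennreal_ofReal
  have h1 := hβ.lintegral_diff_sq_le hh
  have h2 := lintegral_triple hm
  have h3 : ∀ v, ENNReal.ofReal (collisionFrequency β v * maxwellian v * h v ^ 2) =
      ENNReal.ofReal (h v ^ 2) * ENNReal.ofReal (collisionFrequency β v * maxwellian v) :=
    fun v => by rw [mul_comm, ENNReal.ofReal_mul (sq_nonneg _)]
  simp_rw [h3]
  refine le_trans (le_trans (lintegral_mono fun v => ?_) h2.symm.le) h1
  have ha := hβ.collisionFrequency_pos hd v
  have hM := maxwellian_nonneg v
  rw [ENNReal.ofReal_mul (by positivity)]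
  calc _ ≤ ENNReal.ofReal ((collisionFrequency β v)⁻¹ * maxwellian v) *
        (ENNReal.ofReal (collisionFrequency β v) *
      ∫⁻ p : Vec d × Sph d, ENNReal.ofReal (collisionDiff h (p.2, v, p.1) ^ 2) *
        ENNReal.ofReal (maxwellian p.1 * β (v - p.1) p.2) ∂(collisionMeasure d)) := by
        gcongr
        exact hβ.ofReal_sq_linColl_le hh v
    _ = ENNReal.ofReal (maxwellian v) * ∫⁻ p : Vec d × Sph d,
        ENNReal.ofReal (collisionDiff h (p.2, v, p.1) ^ 2) *
        ENNReal.ofReal (maxwellian p.1 * β (v - p.1) p.2) ∂(collisionMeasure d) := by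
        rw [← mul_assoc, ← ENNReal.ofReal_mul (by positivity)]
        congr 2
        field_simp
    _ ≤ _ := by
        rw [← lintegral_const_mul' _ _ ENNReal.ofReal_ne_top]
        refine lintegral_mono fun p => ?_
        rw [mul_left_comm, ← ENNReal.ofReal_mul hM, ← mul_assoc]

end IsSymKernel

end Dissipation

/-! ### Control of the heat flux by the entropy dissipation -/

section HeatFlux

variable {d : ℕ}

/-- A function on collisions, symmetric under exchange and antisymmetric under collision, whose
velocity average is the heat flux. -/
def fluxTest (e : Vec d) (q : Sph d × Vec d × Vec d) : ℝ :=
  (⟪q.2.1, q.1⟫ ^ 2 - ⟪q.2.2, q.1⟫ ^ 2) / 2 *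
    (⟪q.2.1 - q.2.2, e⟫ - (⟪q.2.1, q.1⟫ - ⟪q.2.2, q.1⟫) * ⟪(q.1 : Vec d), e⟫)

lemma continuous_fluxTest (e : Vec d) : Continuous (fluxTest e) := by
  unfold fluxTest
  fun_prop

lemma fluxTest_exchange (e : Vec d) (q : Sph d × Vec d × Vec d) :
    fluxTest e (exchange q) = fluxTest e q := by
  unfold fluxTest exchange
  simp only [inner_sub_left]
  ring

lemma fluxTest_collide (e : Vec d) (q : Sph d × Vec d × Vec d) :
    fluxTest e (collide q) = -fluxTest e q := by
  unfold fluxTest collide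
  simp only [inner_postVel _ _ (norm_sph q.1), inner_postVelStar _ _ (norm_sph q.1)]
  rw [postVel_sub_postVelStar_smul, inner_sub_left (q.2.1 - q.2.2), real_inner_smul_left,
    inner_sub_left q.2.1 q.2.2 (q.1 : Vec d)]
  ring

lemma abs_inner_le_of_norm_one {v ω : Vec d} (hω : ‖ω‖ = 1) : |⟪v, ω⟫| ≤ ‖v‖ := by
  simpa [hω] using abs_real_inner_le_norm v ω

lemma norm_sub_le_mul (v w : Vec d) : ‖v - w‖ ≤ (1 + ‖v‖) * (1 + ‖w‖) := by
  have := norm_sub_le v w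
  nlinarith [norm_nonneg v, norm_nonneg w]

lemma fluxTest_factors (e : Vec d) (q : Sph d × Vec d × Vec d) :
    ∃ x y : ℝ, fluxTest e q = ⟪q.2.1 - q.2.2, (q.1 : Vec d)⟫ * x * y / 2 ∧
      |⟪q.2.1 - q.2.2, (q.1 : Vec d)⟫| ≤ (1 + ‖q.2.1‖) * (1 + ‖q.2.2‖) ∧
      |x| ≤ (1 + ‖q.2.1‖) * (1 + ‖q.2.2‖) ∧ |y| ≤ 2 * ((1 + ‖q.2.1‖) * (1 + ‖q.2.2‖)) * ‖e‖ := by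
  obtain ⟨ω, v, w⟩ := q
  have hω := norm_sph ω
  have h1 := abs_inner_le_of_norm_one (v := v) hω
  have h2 := abs_inner_le_of_norm_one (v := w) hω
  have h3 := (abs_inner_le_of_norm_one (v := v - w) hω).trans (norm_sub_le_mul v w)
  have h4 := abs_inner_le_of_norm_one (v := e) hω
  have h5 := (abs_real_inner_le_norm (v - w) e).trans
    (mul_le_mul_of_nonneg_right (norm_sub_le_mul v w) (norm_nonneg e))
  refine ⟨⟪v, ω⟫ + ⟪w, ω⟫, ⟪v - w, e⟫ - ⟪v - w, (ω : Vec d)⟫ * ⟪(ω : Vec d), e⟫, ?_, h3, ?_, ?_⟩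
  · simp only [fluxTest, inner_sub_left]
    ring
  · refine (abs_add_le _ _).trans ?_
    nlinarith [norm_nonneg v, norm_nonneg w]
  · refine (abs_sub _ _).trans ?_
    rw [abs_mul, real_inner_comm e (ω : Vec d)]
    have := mul_le_mul h3 h4 (abs_nonneg _) (by positivity)
    linarith

lemma abs_fluxTest_le (e : Vec d) (q : Sph d × Vec d × Vec d) :
    |fluxTest e q| ≤ ‖e‖ * ((1 + ‖q.2.1‖) * (1 + ‖q.2.2‖)) ^ 3 := by
  obtain ⟨x, y, h, h1, h2, h3⟩ := fluxTest_factors e q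
  set A := (1 + ‖q.2.1‖) * (1 + ‖q.2.2‖) with hA
  have hA0 : 0 ≤ A := by positivity
  rw [h, abs_div, abs_mul, abs_mul, abs_two]
  calc _ ≤ A * A * (2 * A * ‖e‖) / 2 := by gcongr
    _ = _ := by ring

lemma IsSymKernel.exists_fluxTest_sq_le {β : Vec d → Vec d → ℝ} (hβ : IsSymKernel β) :
    ∃ C : ℝ, 0 ≤ C ∧ ∃ k : ℕ, ∀ (e : Vec d) (q : Sph d × Vec d × Vec d),
      fluxTest e q ^ 2 ≤ β (q.2.1 - q.2.2) q.1 *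
        (C * ‖e‖ ^ 2 * ((1 + ‖q.2.1‖) ^ k * (1 + ‖q.2.2‖) ^ k)) := by
  obtain ⟨c, hc, k, hl⟩ := hβ.lower
  refine ⟨c⁻¹, by positivity, k + 5, fun e q => ?_⟩
  obtain ⟨x, y, h, h1, h2, h3⟩ := fluxTest_factors e q
  rw [← mul_pow]
  set A := (1 + ‖q.2.1‖) * (1 + ‖q.2.2‖) with hA
  have hA0 : 0 ≤ A := by positivity
  have hb := hβ.nonneg (q.2.1 - q.2.2) q.1 (norm_sph q.1)
  have h4 := hl (q.2.1 - q.2.2) q.1 (norm_sph q.1)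
  set s := ⟪q.2.1 - q.2.2, (q.1 : Vec d)⟫ with hs
  have h5 : |s| ≤ c⁻¹ * (A ^ k * β (q.2.1 - q.2.2) q.1) := by
    rw [le_inv_mul_iff₀ hc]
    refine h4.trans ?_
    gcongr
    have := norm_sub_le q.2.1 q.2.2
    nlinarith [norm_nonneg q.2.1, norm_nonneg q.2.2]
  have h6 : fluxTest e q ^ 2 = |s| * |s| * |x| ^ 2 * |y| ^ 2 / 4 := by
    rw [h, sq_abs, sq_abs, abs_mul_abs_self]
    ring
  rw [h6]
  calc |s| * |s| * |x| ^ 2 * |y| ^ 2 / 4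
      ≤ c⁻¹ * (A ^ k * β (q.2.1 - q.2.2) q.1) * A * A ^ 2 * (2 * A * ‖e‖) ^ 2 / 4 := by gcongr
    _ = _ := by ring

lemma integrable_maxwellian_mul_inner_sq {ω : Vec d} (hω : ‖ω‖ = 1) :
    Integrable fun w => maxwellian w * ⟪w, ω⟫ ^ 2 := by
  refine integrable_maxwellian_mul (by fun_prop) (C := 1) (k := 2) fun w => ?_
  rw [abs_pow, one_mul]
  have := abs_inner_le_of_norm_one (v := w) hω
  gcongr
  linarith

lemma integral_fluxTest_maxwellian (e v : Vec d) (ω : Sph d) :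
    ∫ w, maxwellian w * fluxTest e (ω, v, w) =
      (⟪v, ω⟫ ^ 2 - 1) / 2 * (⟪v, e⟫ - ⟪v, ω⟫ * ⟪(ω : Vec d), e⟫) := by
  have hω := norm_sph ω
  set E := ⟪v, e⟫ - ⟪v, ω⟫ * ⟪(ω : Vec d), e⟫ with hE
  have i1 : Integrable fun w : Vec d => maxwellian w * fluxTest e (ω, v, w) := by
    refine integrable_maxwellian_mul ((continuous_fluxTest e).comp
      (by fun_prop)).aestronglyMeasurable (C := ‖e‖ * (1 + ‖v‖) ^ 3) (k := 3) fun w => ?_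
    refine (abs_fluxTest_le e (ω, v, w)).trans (le_of_eq ?_)
    ring
  have i2 : Integrable fun w : Vec d => E * ⟪v, ω⟫ ^ 2 / 2 * maxwellian w -
      E / 2 * (maxwellian w * ⟪w, ω⟫ ^ 2) :=
    (integrable_maxwellian.const_mul _).sub ((integrable_maxwellian_mul_inner_sq hω).const_mul _)
  have h1 : ∫ w, maxwellian w * ((⟪v, ω⟫ ^ 2 - ⟪w, ω⟫ ^ 2) / 2 *
      (⟪w, ω⟫ * ⟪(ω : Vec d), e⟫ - ⟪w, e⟫)) = 0 := by
    refine integral_maxwellian_mul_eq_zero fun w => ?_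
    simp only [inner_neg_left]
    ring
  have h2 : ∫ w : Vec d, (E * ⟪v, ω⟫ ^ 2 / 2 * maxwellian w -
      E / 2 * (maxwellian w * ⟪w, ω⟫ ^ 2)) = E * ⟪v, ω⟫ ^ 2 / 2 - E / 2 := by
    rw [integral_sub (integrable_maxwellian.const_mul _)
      ((integrable_maxwellian_mul_inner_sq hω).const_mul _), integral_const_mul,
      integral_const_mul, integral_maxwellian, integral_maxwellian_mul_inner_sq hω]
    ring
  have h3 : ∀ w, maxwellian w * ((⟪v, ω⟫ ^ 2 - ⟪w, ω⟫ ^ 2) / 2 *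
      (⟪w, ω⟫ * ⟪(ω : Vec d), e⟫ - ⟪w, e⟫)) = maxwellian w * fluxTest e (ω, v, w) -
        (E * ⟪v, ω⟫ ^ 2 / 2 * maxwellian w - E / 2 * (maxwellian w * ⟪w, ω⟫ ^ 2)) := fun w => by
    simp only [fluxTest, inner_sub_left, hE]
    ring
  simp_rw [h3] at h1
  rw [integral_sub i1 i2, h2] at h1
  linarith

/-- The velocity average of `fluxTest` is the heat flux. -/
lemma exists_integral_fluxTest (hd : 2 ≤ d) : ∃ κ : ℝ, 0 < κ ∧ ∀ e v : Vec d,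
    ∫ p : Vec d × Sph d, maxwellian p.1 * fluxTest e (p.2, v, p.1) ∂(collisionMeasure d) =
      κ * (⟪v, e⟫ * ((‖v‖ ^ 2 - (d + 2)) / 2)) := by
  obtain ⟨κ, hκ, m0, m2, m11, m31⟩ := exists_sph_moments (d := d) (by omega)
  have hd' : (2 : ℝ) ≤ d := by exact_mod_cast hd
  refine ⟨κ * (d - 1) / 3, div_pos (mul_pos hκ (by linarith)) (by norm_num), fun e v => ?_⟩
  have hi : Integrable (fun p : Vec d × Sph d => maxwellian p.1 * fluxTest e (p.2, v, p.1))
      ((volume : Measure (Vec d)).prod (sphMeasure d)) := by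
    refine integrable_collisionMeasure ((continuous_fluxTest e).comp
      (by fun_prop)).aestronglyMeasurable (C := ‖e‖ * (1 + ‖v‖) ^ 3) (k := 3) fun p => ?_
    refine (abs_fluxTest_le e (p.2, v, p.1)).trans (le_of_eq ?_)
    ring
  refine (integral_prod_symm _ hi).trans ?_
  simp_rw [integral_fluxTest_maxwellian]
  have h1 : ∀ ω : Sph d, (⟪v, ω⟫ ^ 2 - 1) / 2 * (⟪v, e⟫ - ⟪v, ω⟫ * ⟪(ω : Vec d), e⟫) =
      1 / 2 * (⟪v, e⟫ * ⟪v, ω⟫ ^ 2 - ⟪v, e⟫ * 1 - ⟪v, ω⟫ ^ 3 * ⟪e, ω⟫ + ⟪v, ω⟫ * ⟪e, ω⟫) :=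
    fun ω => by
      rw [real_inner_comm e (ω : Vec d)]
      ring
  simp_rw [h1]
  rw [integral_const_mul, integral_add, integral_sub, integral_sub, integral_const_mul,
    integral_const_mul, m0, m2, m11, m31]
  · ring
  all_goals exact integrable_sph (by fun_prop)

/-- Control of the heat flux by the entropy dissipation. -/
lemma IsSymKernel.exists_heatFlux_le {β : Vec d → Vec d → ℝ} (hβ : IsSymKernel β) (hd : 2 ≤ d) :
    ∃ K : ℝ, 0 ≤ K ∧ ∀ (e : Vec d) (h : Vec d → ℝ), Measurable h →
      (Integrable fun v => collisionFrequency β v * maxwellian v * h v ^ 2) → ∀ r : ℝ, 0 < r →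
      2 * |∫ v, maxwellian v * (⟪v, e⟫ * ((‖v‖ ^ 2 - (d + 2)) / 2) * h v)| ≤
        r * (∫ v, maxwellian v * (h v * linColl β h v)) + r⁻¹ * (K * ‖e‖ ^ 2) := by
  obtain ⟨κ, hκ, hflux⟩ := exists_integral_fluxTest hd
  obtain ⟨C, hC, k, hψ⟩ := hβ.exists_fluxTest_sq_le
  set N : ℝ := ∫ q : Sph d × Vec d × Vec d, maxwellian q.2.1 * maxwellian q.2.2 *
    ((1 + ‖q.2.1‖) ^ k * (1 + ‖q.2.2‖) ^ k) ∂(tripleMeasure d) with hN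
  have hN0 : 0 ≤ N := integral_nonneg fun q =>
    mul_nonneg (mul_nonneg (maxwellian_nonneg _) (maxwellian_nonneg _)) (by positivity)
  have iN : Integrable (fun q : Sph d × Vec d × Vec d => maxwellian q.2.1 * maxwellian q.2.2 *
      ((1 + ‖q.2.1‖) ^ k * (1 + ‖q.2.2‖) ^ k)) (tripleMeasure d) := by
    have h1 := (integrable_maxwellian_mul_pow (d := d) k).mul_prod
      (integrable_maxwellian_mul_pow (d := d) k)
    refine (h1.comp_snd (sphMeasure d)).congr (Eventually.of_forall fun q => ?_)
    simp only
    ring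
  refine ⟨C * N / (4 * κ ^ 2), by positivity, fun e h hh hi r hr => ?_⟩
  have iD := hβ.integrable_weight_mul_diff_sq hh hi
  have i0 := hβ.integrable_weight_mul_sq hh hi
  have iΨ : Integrable (fun q : Sph d × Vec d × Vec d => maxwellian q.2.1 * maxwellian q.2.2 *
      (C * ‖e‖ ^ 2 * ((1 + ‖q.2.1‖) ^ k * (1 + ‖q.2.2‖) ^ k)) * 1 ^ 2) (tripleMeasure d) := by
    refine (iN.const_mul (C * ‖e‖ ^ 2)).congr (Eventually.of_forall fun q => ?_)
    simp only
    ring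
  have hΨ0 : ∀ q : Sph d × Vec d × Vec d, 0 ≤ maxwellian q.2.1 * maxwellian q.2.2 *
      (C * ‖e‖ ^ 2 * ((1 + ‖q.2.1‖) ^ k * (1 + ‖q.2.2‖) ^ k)) := fun q =>
    mul_nonneg (mul_nonneg (maxwellian_nonneg _) (maxwellian_nonneg _)) (by positivity)
  have hcw : ∀ q : Sph d × Vec d × Vec d,
      (maxwellian q.2.1 * maxwellian q.2.2 * fluxTest e q) ^ 2 ≤ collisionWeight β q *
        (maxwellian q.2.1 * maxwellian q.2.2 *
          (C * ‖e‖ ^ 2 * ((1 + ‖q.2.1‖) ^ k * (1 + ‖q.2.2‖) ^ k))) := fun q => by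
    have := mul_le_mul_of_nonneg_left (hψ e q)
      (sq_nonneg (maxwellian q.2.1 * maxwellian q.2.2))
    unfold collisionWeight
    linarith
  have mc : AEStronglyMeasurable (fun q : Sph d × Vec d × Vec d =>
      maxwellian q.2.1 * maxwellian q.2.2 * fluxTest e q) (tripleMeasure d) := by
    have := continuous_fluxTest e
    exact Continuous.aestronglyMeasurable (by fun_prop)
  have iF : Integrable (fun q : Sph d × Vec d × Vec d =>
      maxwellian q.2.1 * maxwellian q.2.2 * fluxTest e q * h q.2.1 * 1) (tripleMeasure d) :=
    integrable_mul_mul mc (hh.comp (measurable_fst.comp measurable_snd)).aestronglyMeasurable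
      aestronglyMeasurable_const hβ.weight_nonneg hΨ0 hcw i0 iΨ
  have iG : Integrable (fun q : Sph d × Vec d × Vec d =>
      maxwellian q.2.1 * maxwellian q.2.2 * fluxTest e q * collisionDiff h q * 1)
      (tripleMeasure d) :=
    integrable_mul_mul mc (measurable_collisionDiff_apply hh).aestronglyMeasurable
      aestronglyMeasurable_const hβ.weight_nonneg hΨ0 hcw iD iΨ
  have hFv : ∫ q : Sph d × Vec d × Vec d,
      maxwellian q.2.1 * maxwellian q.2.2 * fluxTest e q * h q.2.1 * 1 ∂(tripleMeasure d) =
        κ * ∫ v, maxwellian v * (⟪v, e⟫ * ((‖v‖ ^ 2 - (d + 2)) / 2) * h v) := by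
    refine (integral_triple (F := fun q => maxwellian q.1 * maxwellian q.2.1 *
      fluxTest e (q.2.2, q.1, q.2.1) * h q.1 * 1) iF).trans ?_
    rw [← integral_const_mul]
    congr 1
    ext v
    have h1 : ∀ p : Vec d × Sph d, maxwellian v * maxwellian p.1 * fluxTest e (p.2, v, p.1) * h v *
        1 = maxwellian v * h v * (maxwellian p.1 * fluxTest e (p.2, v, p.1)) := fun p => by ring
    simp only [h1]
    rw [integral_const_mul, hflux]
    ring
  have hFG : ∫ q : Sph d × Vec d × Vec d, maxwellian q.2.1 * maxwellian q.2.2 * fluxTest e q *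
      collisionDiff h q * 1 ∂(tripleMeasure d) = 4 * ∫ q : Sph d × Vec d × Vec d,
      maxwellian q.2.1 * maxwellian q.2.2 * fluxTest e q * h q.2.1 * 1 ∂(tripleMeasure d) := by
    rw [← integral_orbit iF]
    congr 1
    ext q
    simp only [fluxTest_exchange, fluxTest_collide]
    simp only [exchange, collide]
    rw [mul_comm (maxwellian (postVelStar _ _ _)), maxwellian_collide _ _ (norm_sph q.1),
      collisionDiff]
    ring
  have hbound : 2 * |∫ q : Sph d × Vec d × Vec d, maxwellian q.2.1 * maxwellian q.2.2 *
      fluxTest e q * collisionDiff h q * 1 ∂(tripleMeasure d)| ≤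
      (r * κ) * (∫ q, collisionWeight β q * collisionDiff h q ^ 2 ∂(tripleMeasure d)) +
        (r * κ)⁻¹ * (C * ‖e‖ ^ 2 * N) := by
    have hrκ : 0 < r * κ := by positivity
    have h1 : C * ‖e‖ ^ 2 * N = ∫ q : Sph d × Vec d × Vec d, maxwellian q.2.1 * maxwellian q.2.2 *
        (C * ‖e‖ ^ 2 * ((1 + ‖q.2.1‖) ^ k * (1 + ‖q.2.2‖) ^ k)) * 1 ^ 2 ∂(tripleMeasure d) := by
      rw [hN, ← integral_const_mul]
      congr 1
      ext q
      ring
    rw [h1, ← integral_const_mul, ← integral_const_mul, ← integral_add (iD.const_mul _)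
      (iΨ.const_mul _)]
    refine (mul_le_mul_of_nonneg_left (abs_integral_le_integral_abs) two_pos.le).trans ?_
    rw [← integral_const_mul]
    exact integral_mono (iG.abs.const_mul 2) ((iD.const_mul _).add (iΨ.const_mul _)) fun q =>
      abs_mul_mul_le hrκ (hβ.weight_nonneg q) (hΨ0 q) (hcw q)
  rw [hFG, hFv, ← hβ.integral_mul_linColl hh hi, abs_mul, abs_mul, abs_of_pos hκ,
    abs_of_pos (by norm_num : (0 : ℝ) < 4)] at hbound
  have hκ4 : 0 < 4 * κ := by positivity
  refine le_of_mul_le_mul_left (le_trans (le_of_eq ?_) (hbound.trans (le_of_eq ?_))) hκ4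
  · ring
  · field_simp

end HeatFlux

/-! ### Geometry of the boundary -/

section Geometry

variable {d : ℕ} {Ω : Set (Vec d)}

lemma IsDefiningAt.eq_zero {x : Vec d} {ρ : Vec d → ℝ} (hΩ : IsOpen Ω) (hx : x ∈ frontier Ω)
    (h : IsDefiningAt Ω x ρ) : ρ x = 0 := by
  obtain ⟨hρ, -, hev⟩ := h
  refine le_antisymm ?_ ?_
  · by_contra! hpos
    obtain ⟨y, ⟨hy1, hy2⟩, hyΩ⟩ := (mem_closure_iff_nhds.1 (frontier_subset_closure hx)) _
      (hev.and (hρ.continuous.continuousAt.eventually (lt_mem_nhds hpos)))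
    exact lt_asymm hy2 (hy1.1 hyΩ)
  · by_contra! hneg
    have := hev.self_of_nhds.2 hneg
    rw [hΩ.frontier_eq] at hx
    exact hx.2 this

lemma eventually_slope {ρ : Vec d → ℝ} {x : Vec d} (hρ : ContDiff ℝ (⊤ : ℕ∞) ρ) (hx : ρ x = 0)
    (w : Vec d) : Tendsto (fun t : ℝ => t⁻¹ * ρ (x + t • w)) (𝓝[>] 0) (𝓝 ⟪gradient ρ x, w⟫) := by
  have h1 : HasDerivAt (fun t : ℝ => ρ (x + t • w)) ⟪gradient ρ x, w⟫ 0 := by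
    rw [inner_gradient_left]
    have h2 : HasDerivAt (fun t : ℝ => x + t • w) w 0 := by
      simpa using ((hasDerivAt_id (0 : ℝ)).smul_const w).const_add x
    have h3 : HasFDerivAt ρ (fderiv ℝ ρ x) (x + (0 : ℝ) • w) := by
      simpa using (hρ.differentiable (by simp) x).hasFDerivAt
    exact h3.comp_hasDerivAt 0 h2
  have h2 := (hasDerivAt_iff_tendsto_slope_zero.1 h1).mono_left
    (nhdsWithin_mono 0 (fun t (ht : 0 < t) => ht.ne') : 𝓝[>] (0 : ℝ) ≤ 𝓝[≠] 0)
  simpa [hx] using h2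

/-- The outward unit normal is unique. -/
lemma IsOutwardUnitNormal.unique (hΩ : IsOpen Ω) {x ν ν' : Vec d} (hx : x ∈ frontier Ω)
    (h : IsOutwardUnitNormal Ω x ν) (h' : IsOutwardUnitNormal Ω x ν') : ν = ν' := by
  obtain ⟨ρ, hρ, rfl⟩ := h
  obtain ⟨ρ', hρ', rfl⟩ := h'
  have key : ∀ w, ⟪gradient ρ x, w⟫ < 0 → ⟪gradient ρ' x, w⟫ ≤ 0 := by
    intro w hw
    by_contra! hw'
    have e1 := (eventually_slope hρ.1 (hρ.eq_zero hΩ hx) w).eventually (gt_mem_nhds hw)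
    have e2 := (eventually_slope hρ'.1 (hρ'.eq_zero hΩ hx) w).eventually (lt_mem_nhds hw')
    have hc : Tendsto (fun t : ℝ => x + t • w) (𝓝[>] 0) (𝓝 x) := by
      have : Continuous fun t : ℝ => x + t • w := by fun_prop
      simpa using (this.tendsto 0).mono_left nhdsWithin_le_nhds
    obtain ⟨t, h1, h2, h3, h4, ht⟩ := (e1.and (e2.and ((hc.eventually hρ.2.2).and
      ((hc.eventually hρ'.2.2).and eventually_mem_nhdsWithin)))).exists
    have ht' : 0 < t⁻¹ := inv_pos.2 ht
    have h5 : ρ (x + t • w) < 0 := by nlinarith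
    have h6 : 0 < ρ' (x + t • w) := pos_of_mul_pos_right h2 ht'.le
    exact lt_asymm h6 (h4.1 (h3.2 h5))
  have ha : 0 < ‖gradient ρ x‖ := norm_pos_iff.2 hρ.2.1
  have hb : 0 < ‖gradient ρ' x‖ := norm_pos_iff.2 hρ'.2.1
  set a := ‖gradient ρ x‖⁻¹ • gradient ρ x with hadef
  set b := ‖gradient ρ' x‖⁻¹ • gradient ρ' x with hbdef
  have ha1 : ‖a‖ = 1 := by rw [hadef, norm_smul, norm_inv, norm_norm, inv_mul_cancel₀ ha.ne']
  have hb1 : ‖b‖ = 1 := by rw [hbdef, norm_smul, norm_inv, norm_norm, inv_mul_cancel₀ hb.ne']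
  by_contra hab
  have hlt : ⟪a, b⟫ < 1 := (inner_lt_one_iff_real_of_norm_eq_one ha1 hb1).2 hab
  have h1 : ⟪a, b - a⟫ < 0 := by
    rw [inner_sub_right, inner_self_unit ha1]
    linarith
  have h2 : 0 < ⟪b, b - a⟫ := by
    rw [inner_sub_right, inner_self_unit hb1, real_inner_comm]
    linarith
  rw [hadef, real_inner_smul_left, ← hadef] at h1
  rw [hbdef, real_inner_smul_left, ← hbdef] at h2
  have h3 : ⟪gradient ρ x, b - a⟫ < 0 := by
    have : 0 < ‖gradient ρ x‖⁻¹ := by positivity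
    nlinarith
  have h4 := key _ h3
  have : 0 < ‖gradient ρ' x‖⁻¹ := by positivity
  nlinarith

lemma continuous_gradient {ρ : Vec d → ℝ} (hρ : ContDiff ℝ (⊤ : ℕ∞) ρ) :
    Continuous (gradient ρ) :=
  (InnerProductSpace.toDual ℝ (Vec d)).symm.continuous.comp (hρ.continuous_fderiv (by simp))

lemma IsSmoothBoundedDomain.continuousOn_normal (hΩ : IsSmoothBoundedDomain Ω)
    {n : Vec d → Vec d} (hn : ∀ x ∈ frontier Ω, IsOutwardUnitNormal Ω x (n x)) :
    ContinuousOn n (frontier Ω) := by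
  intro x hx
  obtain ⟨ρ, hρ⟩ := hΩ.smooth x hx
  have hc := continuous_gradient hρ.1
  have h1 : ContinuousAt (fun y => ‖gradient ρ y‖⁻¹ • gradient ρ y) x :=
    (hc.norm.continuousAt.inv₀ (norm_ne_zero_iff.2 hρ.2.1)).smul hc.continuousAt
  have h2 : ∀ᶠ y in 𝓝 x, IsDefiningAt Ω y ρ := by
    filter_upwards [hρ.2.2.eventually_nhds, hc.continuousAt.eventually_ne hρ.2.1] with y hy1 hy2
    exact ⟨hρ.1, hy2, hy1⟩
  have h3 : ∀ᶠ y in 𝓝[frontier Ω] x, n y = ‖gradient ρ y‖⁻¹ • gradient ρ y := by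
    filter_upwards [nhdsWithin_le_nhds h2, eventually_mem_nhdsWithin] with y hy hyΩ
    exact (hn y hyΩ).unique hΩ.isOpen hyΩ ⟨ρ, hy, rfl⟩
  exact (h1.continuousWithinAt).congr_of_eventuallyEq h3
    ((hn x hx).unique hΩ.isOpen hx ⟨ρ, hρ, rfl⟩)

lemma IsOutwardUnitNormal.norm_eq_one {x ν : Vec d} (h : IsOutwardUnitNormal Ω x ν) : ‖ν‖ = 1 := by
  obtain ⟨ρ, hρ, rfl⟩ := h
  rw [norm_smul, norm_inv, norm_norm, inv_mul_cancel₀ (norm_ne_zero_iff.2 hρ.2.1)]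

/-- The unit normal coincides on the boundary with a measurable field of unit vectors. -/
lemma IsSmoothBoundedDomain.exists_measurable_normal (hΩ : IsSmoothBoundedDomain Ω) (hd : d ≠ 0)
    {n : Vec d → Vec d} (hn : ∀ x ∈ frontier Ω, IsOutwardUnitNormal Ω x (n x)) :
    ∃ N : Vec d → Vec d, Measurable N ∧ (∀ x, ‖N x‖ = 1) ∧ ∀ x ∈ frontier Ω, N x = n x := by
  classical
  let e : Vec d := EuclideanSpace.basisFun (Fin d) ℝ ⟨0, Nat.pos_of_ne_zero hd⟩
  have he : ‖e‖ = 1 := (EuclideanSpace.basisFun (Fin d) ℝ).norm_eq_one _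
  refine ⟨(frontier Ω).piecewise n fun _ => e, ?_, fun x => ?_, fun x hx => by simp [hx]⟩
  · exact (hΩ.continuousOn_normal hn).measurable_piecewise continuousOn_const
      isClosed_frontier.measurableSet
  · by_cases hx : x ∈ frontier Ω
    · simpa [hx] using (hn x hx).norm_eq_one
    · simpa [hx] using he

lemma hausdorffMeasure_lt_top_of_le_inner {S : Set (Vec d)} (hS : Bornology.IsBounded S)
    {a : Vec d} (ha : ‖a‖ = 1)
    (h : ∀ y ∈ S, ∀ z ∈ S, |⟪a, y - z⟫| ≤ 1 / 2 * ‖y - z‖) :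
    Measure.hausdorffMeasure ((d - 1 : ℕ) : ℝ) S < ∞ := by
  let K : Submodule ℝ (Vec d) := Submodule.span ℝ {a}
  let P : Vec d →L[ℝ] Kᗮ := Kᗮ.orthogonalProjectionOnto
  let f : S → Kᗮ := fun y => P y
  have hf : AntilipschitzWith 2 f := by
    refine AntilipschitzWith.of_le_mul_dist fun y z => ?_
    have h1 := K.norm_sq_eq_add_norm_sq_starProjection (y.1 - z.1)
    have h0 : K.starProjection (y.1 - z.1) = ⟪a, y.1 - z.1⟫ • a :=
      Submodule.starProjection_unit_singleton ℝ ha _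
    rw [h0, norm_smul, ha, mul_one] at h1
    have h2 : dist (f y) (f z) = ‖Kᗮ.starProjection (y.1 - z.1)‖ := by
      rw [dist_eq_norm, ← map_sub]
      rfl
    rw [h2, Subtype.dist_eq, dist_eq_norm]
    have h3 := h y y.2 z z.2
    rw [Real.norm_eq_abs] at h1
    refine abs_le_of_sq_le_sq' ?_ (by positivity) |>.2
    push_cast
    nlinarith [abs_nonneg ⟪a, y.1 - z.1⟫, norm_nonneg (y.1 - z.1)]
  have hdim : Module.finrank ℝ Kᗮ = d - 1 := by
    have h1 := K.finrank_add_finrank_orthogonal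
    have h0 : Module.finrank ℝ K = 1 :=
      finrank_span_singleton (norm_ne_zero_iff.1 (by simp [ha]))
    rw [h0, finrank_euclideanSpace_fin] at h1
    omega
  have hfin : Measure.hausdorffMeasure ((d - 1 : ℕ) : ℝ) (f '' Set.univ) < ∞ := by
    have hb : Bornology.IsBounded (f '' Set.univ) := by
      refine (P.lipschitz.isBounded_image hS).subset ?_
      rintro _ ⟨y, -, rfl⟩
      exact ⟨y, y.2, rfl⟩
    rw [← hdim]
    exact hb.measure_lt_top
  have h1 := hf.le_hausdorffMeasure_image (d := ((d - 1 : ℕ) : ℝ)) (Nat.cast_nonneg _) Set.univ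
  have h2 := (isometry_subtype_coe (s := S)).hausdorffMeasure_image (d := ((d - 1 : ℕ) : ℝ))
    (Or.inl (Nat.cast_nonneg _)) Set.univ
  rw [Set.image_univ, Subtype.range_coe] at h2
  rw [h2]
  refine h1.trans_lt (ENNReal.mul_lt_top ?_ hfin)
  exact ENNReal.rpow_lt_top_of_nonneg (Nat.cast_nonneg _) (by simp)

lemma IsSmoothBoundedDomain.isFiniteMeasure_surfaceMeasure (hΩ : IsSmoothBoundedDomain Ω) :
    IsFiniteMeasure (surfaceMeasure Ω) := by
  have hcomp : IsCompact (frontier Ω) :=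
    Metric.isCompact_of_isClosed_isBounded isClosed_frontier
      (hΩ.isBounded.closure.subset frontier_subset_closure)
  have key : Measure.hausdorffMeasure ((d - 1 : ℕ) : ℝ) (frontier Ω) < ∞ := by
    refine hcomp.measure_lt_top_of_nhdsWithin fun x hx => ?_
    obtain ⟨ρ, hρ⟩ := hΩ.smooth x hx
    have hpos : 0 < ‖gradient ρ x‖ := norm_pos_iff.2 hρ.2.1
    have h1 : HasStrictFDerivAt ρ (fderiv ℝ ρ x) x :=
      hρ.1.contDiffAt.hasStrictFDerivAt (by simp)
    have h2 := h1.isLittleO.bound (half_pos hpos)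
    have h3 : ∀ᶠ y in 𝓝 x, y ∈ frontier Ω → ρ y = 0 := by
      filter_upwards [hρ.2.2.eventually_nhds, (continuous_gradient hρ.1).continuousAt.eventually_ne
        hρ.2.1] with y hy1 hy2 hy
      exact IsDefiningAt.eq_zero hΩ.isOpen hy ⟨hρ.1, hy2, hy1⟩
    rw [nhds_prod_eq] at h2
    obtain ⟨U, hU, hU2⟩ := mem_prod_self_iff.1 h2
    refine ⟨frontier Ω ∩ {y | (y ∈ frontier Ω → ρ y = 0) ∧ y ∈ U},
      inter_mem self_mem_nhdsWithin (nhdsWithin_le_nhds (h3.and hU)), ?_⟩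
    refine hausdorffMeasure_lt_top_of_le_inner (hcomp.isBounded.subset Set.inter_subset_left)
      (a := ‖gradient ρ x‖⁻¹ • gradient ρ x)
      (by rw [norm_smul, norm_inv, norm_norm, inv_mul_cancel₀ hpos.ne']) fun y hy z hz => ?_
    have h4 := hU2 (Set.mk_mem_prod hy.2.2 hz.2.2)
    simp only [Set.mem_ofPred_eq] at h4
    rw [hy.2.1 hy.1, hz.2.1 hz.1, sub_zero, zero_sub, norm_neg, Real.norm_eq_abs] at h4
    rw [real_inner_smul_left, inner_gradient_left, abs_mul, abs_inv, abs_norm,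
      inv_mul_le_iff₀ hpos]
    linarith
  refine ⟨?_⟩
  rw [surfaceMeasure, Measure.restrict_apply_univ, Measure.euclideanHausdorffMeasure_def,
    Measure.smul_apply, ENNReal.smul_def, smul_eq_mul]
  exact ENNReal.mul_lt_top ENNReal.coe_lt_top key

end Geometry

/-! ### Diffuse reflection at a boundary point -/

section Wall

variable {d : ℕ}

/-- The velocity profile `(|v|² - (d + 2)) / 2` of the modulation. -/
def heatProfile (v : Vec d) : ℝ := (‖v‖ ^ 2 - (d + 2)) / 2

@[fun_prop]
lemma continuous_heatProfile : Continuous (heatProfile (d := d)) := by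
  unfold heatProfile
  fun_prop

lemma heatProfile_neg (v : Vec d) : heatProfile (-v) = heatProfile v := by simp [heatProfile]

lemma abs_heatProfile_le (v : Vec d) : |heatProfile v| ≤ (d + 2) * (1 + ‖v‖) ^ 2 := by
  unfold heatProfile
  have h1 := norm_nonneg v
  have h2 : (0 : ℝ) ≤ d := Nat.cast_nonneg d
  rw [abs_le]
  constructor <;> nlinarith [mul_nonneg h2 h1, mul_nonneg h2 (sq_nonneg ‖v‖)]

lemma integral_wallMeasure {n : Vec d → Vec d} (x : Vec d) (f : Vec d → ℝ) :
    ∫ v, f v ∂(wallMeasure n x) =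
      √(2 * Real.pi) * ∫ v, maxwellian v * max ⟪v, n x⟫ 0 * f v := by
  unfold wallMeasure
  rw [integral_withDensity_ofReal (by fun_prop) fun v => mul_nonneg
    (mul_nonneg (Real.sqrt_nonneg _) (maxwellian_nonneg v)) (le_max_right _ _),
    ← integral_const_mul]
  congr 1
  ext v
  ring

variable {n : Vec d}

lemma integrable_maxwellian_mul_posPart (n : Vec d) :
    Integrable fun v => maxwellian v * max ⟪v, n⟫ 0 := by
  refine integrable_maxwellian_mul (by fun_prop) (C := ‖n‖) (k := 1) fun v => ?_
  rw [abs_of_nonneg (le_max_right _ _)]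
  refine max_le ((real_inner_le_norm v n).trans ?_) (by positivity)
  nlinarith [norm_nonneg v, norm_nonneg n]

lemma integrable_posPart_mul_sq {f : Vec d → ℝ} (hf : Measurable f)
    (hi : Integrable fun v => |⟪v, n⟫| * maxwellian v * f v ^ 2) :
    Integrable fun v => maxwellian v * max ⟪v, n⟫ 0 * f v ^ 2 := by
  refine hi.mono' (Measurable.aestronglyMeasurable (by fun_prop)) (Eventually.of_forall fun v => ?_)
  have h1 : 0 ≤ max ⟪v, n⟫ 0 := le_max_right _ _
  have h2 := maxwellian_nonneg v
  have h3 : max ⟪v, n⟫ 0 ≤ |⟪v, n⟫| := max_le (le_abs_self _) (abs_nonneg _)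
  rw [Real.norm_of_nonneg (by positivity), mul_comm (maxwellian v)]
  gcongr

lemma integrable_posPart_mul {f : Vec d → ℝ} (hf : Measurable f)
    (hi : Integrable fun v => |⟪v, n⟫| * maxwellian v * f v ^ 2) :
    Integrable fun v => maxwellian v * max ⟪v, n⟫ 0 * f v := by
  have h0 : ∀ v, 0 ≤ maxwellian v * max ⟪v, n⟫ 0 := fun v =>
    mul_nonneg (maxwellian_nonneg v) (le_max_right _ _)
  have := integrable_mul_mul (μ := volume) (c := fun v => maxwellian v * max ⟪v, n⟫ 0)
    (f := f) (g := fun _ => 1) (Measurable.aestronglyMeasurable (by fun_prop))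
    hf.aestronglyMeasurable aestronglyMeasurable_const h0 h0 (fun v => (sq _).le)
    (integrable_posPart_mul_sq hf hi) (by simpa using integrable_maxwellian_mul_posPart n)
  simpa using this

/-- The variance of the outgoing values. -/
lemma integral_posPart_variance (hn : ‖n‖ = 1) {f : Vec d → ℝ} (hf : Measurable f)
    (hi : Integrable fun v => |⟪v, n⟫| * maxwellian v * f v ^ 2) {c : ℝ}
    (hc : c = √(2 * Real.pi) * ∫ v, maxwellian v * max ⟪v, n⟫ 0 * f v) :
    Integrable (fun v => maxwellian v * max ⟪v, n⟫ 0 * (f v - c) ^ 2) ∧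
    ∫ v, maxwellian v * max ⟪v, n⟫ 0 * (f v - c) ^ 2 =
      (∫ v, maxwellian v * max ⟪v, n⟫ 0 * f v ^ 2) - c ^ 2 * (√(2 * Real.pi))⁻¹ := by
  have i2 := integrable_posPart_mul_sq hf hi
  have i1 := (integrable_posPart_mul hf hi).const_mul (2 * c)
  have i0 := (integrable_maxwellian_mul_posPart n).const_mul (c ^ 2)
  have i21 : Integrable fun v => maxwellian v * max ⟪v, n⟫ 0 * f v ^ 2 -
    2 * c * (maxwellian v * max ⟪v, n⟫ 0 * f v) := i2.sub i1
  have h1 : ∀ v, maxwellian v * max ⟪v, n⟫ 0 * (f v - c) ^ 2 =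
      maxwellian v * max ⟪v, n⟫ 0 * f v ^ 2 - 2 * c * (maxwellian v * max ⟪v, n⟫ 0 * f v) +
        c ^ 2 * (maxwellian v * max ⟪v, n⟫ 0) := fun v => by ring
  simp_rw [h1]
  refine ⟨i21.add i0, ?_⟩
  have hs : √(2 * Real.pi) ≠ 0 := by positivity
  have h2 : ∫ v, maxwellian v * max ⟪v, n⟫ 0 * f v = c * (√(2 * Real.pi))⁻¹ := by
    rw [hc]
    field_simp
  rw [integral_add i21 i0, integral_sub i2 i1, integral_const_mul, integral_const_mul, h2,
    integral_maxwellian_mul_posPart hn]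
  ring

lemma integral_inner_mul_sq (hn : ‖n‖ = 1) {f : Vec d → ℝ} (hf : Measurable f)
    (hi : Integrable fun v => |⟪v, n⟫| * maxwellian v * f v ^ 2) {c : ℝ}
    (hc : c = √(2 * Real.pi) * ∫ v, maxwellian v * max ⟪v, n⟫ 0 * f v)
    (hb : ∀ᵐ v, ⟪v, n⟫ < 0 → f v = c) :
    ∫ v, maxwellian v * ⟪v, n⟫ * f v ^ 2 =
      ∫ v, maxwellian v * max ⟪v, n⟫ 0 * (f v - c) ^ 2 := by
  rw [(integral_posPart_variance hn hf hi hc).2]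
  have h1 : (fun v => maxwellian v * ⟪v, n⟫ * f v ^ 2) =ᵐ[volume] fun v =>
      maxwellian v * max ⟪v, n⟫ 0 * f v ^ 2 - c ^ 2 * (maxwellian v * max ⟪v, -n⟫ 0) := by
    filter_upwards [hb] with v hv
    rw [inner_neg_right]
    rcases lt_or_ge ⟪v, n⟫ 0 with h | h
    · rw [hv h, max_eq_right h.le, max_eq_left (by linarith)]
      ring
    · rw [max_eq_left h, max_eq_right (by linarith)]
      ring
  rw [integral_congr_ae h1, integral_sub (integrable_posPart_mul_sq hf hi)
    ((integrable_maxwellian_mul_posPart (-n)).const_mul _), integral_const_mul,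
    integral_maxwellian_mul_posPart (by rwa [norm_neg])]

lemma integrable_abs_inner_mul_heatProfile_sq (hn : ‖n‖ = 1) :
    Integrable fun v => |⟪v, n⟫| * maxwellian v * heatProfile v ^ 2 := by
  have := integrable_maxwellian_mul (f := fun v => |⟪v, n⟫| * heatProfile v ^ 2)
    (Continuous.aestronglyMeasurable (by fun_prop)) (C := (d + 2) ^ 2) (k := 5) fun v => by
      rw [abs_mul, abs_abs, abs_pow]
      have h1 := abs_inner_le_of_norm_one (v := v) hn
      have h2 := abs_heatProfile_le v
      have h3 : ‖v‖ ≤ 1 + ‖v‖ := by linarith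
      calc |⟪v, n⟫| * |heatProfile v| ^ 2
          ≤ (1 + ‖v‖) * ((d + 2) * (1 + ‖v‖) ^ 2) ^ 2 := by gcongr; exact h1.trans h3
        _ = _ := by ring
  refine this.congr (Eventually.of_forall fun v => ?_)
  simp only
  ring

lemma integral_posPart_mul_heatProfile (hn : ‖n‖ = 1) :
    √(2 * Real.pi) * ∫ v, maxwellian v * max ⟪v, n⟫ 0 * heatProfile v = -1 / 2 := by
  have h1 : ∀ v : Vec d, maxwellian v * max ⟪v, n⟫ 0 * heatProfile v =
      1 / 2 * (maxwellian v * (‖v‖ ^ 2 * max ⟪v, n⟫ 0)) -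
        (d + 2) / 2 * (maxwellian v * max ⟪v, n⟫ 0) := fun v => by
    unfold heatProfile
    ring
  have hs : √(2 * Real.pi) ≠ 0 := by positivity
  simp_rw [h1]
  rw [integral_sub ((integrable_maxwellian_mul_norm_sq_mul_posPart n).const_mul _)
    ((integrable_maxwellian_mul_posPart n).const_mul _), integral_const_mul, integral_const_mul,
    integral_maxwellian_mul_norm_sq_mul_posPart hn, integral_maxwellian_mul_posPart hn]
  field_simp
  ring

lemma integrable_modulated_wall (hn : ‖n‖ = 1) {f : Vec d → ℝ} (hf : Measurable f)
    (hi : Integrable fun v => |⟪v, n⟫| * maxwellian v * f v ^ 2) (a : ℝ) :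
    Integrable fun v => |⟪v, n⟫| * maxwellian v * (f v - a * heatProfile v) ^ 2 := by
  refine ((hi.const_mul 2).add ((integrable_abs_inner_mul_heatProfile_sq hn).const_mul
    (2 * a ^ 2))).mono' (Measurable.aestronglyMeasurable (by fun_prop))
    (Eventually.of_forall fun v => ?_)
  have h1 := maxwellian_nonneg v
  rw [Real.norm_of_nonneg (by positivity), Pi.add_apply]
  have h2 : (f v - a * heatProfile v) ^ 2 ≤ 2 * f v ^ 2 + 2 * a ^ 2 * heatProfile v ^ 2 := by
    nlinarith [sq_nonneg (f v + a * heatProfile v)]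
  have h3 := mul_le_mul_of_nonneg_left h2 (by positivity : 0 ≤ |⟪v, n⟫| * maxwellian v)
  linarith

/-- The boundary flux of the modulated entropy. -/
lemma integral_boundary_flux (hn : ‖n‖ = 1) {f : Vec d → ℝ} (hf : Measurable f)
    (hi : Integrable fun v => |⟪v, n⟫| * maxwellian v * f v ^ 2) {a c : ℝ}
    (hb : ∀ᵐ v, ⟪v, n⟫ < 0 → f v = a * ((‖v‖ ^ 2 - (d + 1)) / 2) +
      √(2 * Real.pi) * ∫ w, maxwellian w * max ⟪w, n⟫ 0 * f w)
    (hc : c = √(2 * Real.pi) *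
      ∫ v, maxwellian v * max ⟪v, n⟫ 0 * (f v - a * heatProfile v)) :
    ∫ v, maxwellian v * ⟪v, n⟫ * (f v ^ 2 - 2 * (a * heatProfile v) * f v) =
      ∫ v, maxwellian v * max ⟪v, n⟫ 0 * (f v - a * heatProfile v - c) ^ 2 := by
  have hi' := integrable_modulated_wall hn hf hi a
  have hf' : Measurable fun v => f v - a * heatProfile v := by fun_prop
  have iq := integrable_abs_inner_mul_heatProfile_sq hn
  have hc' : c = √(2 * Real.pi) * (∫ w, maxwellian w * max ⟪w, n⟫ 0 * f w) + a / 2 := by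
    have h1 : ∀ v, maxwellian v * max ⟪v, n⟫ 0 * (f v - a * heatProfile v) =
        maxwellian v * max ⟪v, n⟫ 0 * f v - a * (maxwellian v * max ⟪v, n⟫ 0 * heatProfile v) :=
      fun v => by ring
    rw [hc]
    simp_rw [h1]
    rw [integral_sub (integrable_posPart_mul hf hi)
      ((integrable_posPart_mul continuous_heatProfile.measurable iq).const_mul a),
      integral_const_mul]
    linear_combination -a * integral_posPart_mul_heatProfile (d := d) hn
  have hb' : ∀ᵐ v, ⟪v, n⟫ < 0 → f v - a * heatProfile v = c := by
    filter_upwards [hb] with v hv h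
    rw [hv h, hc', heatProfile]
    ring
  rw [← integral_inner_mul_sq hn hf' hi' hc hb']
  have h2 : ∀ v, maxwellian v * ⟪v, n⟫ * (f v ^ 2 - 2 * (a * heatProfile v) * f v) =
      maxwellian v * ⟪v, n⟫ * (f v - a * heatProfile v) ^ 2 -
        a ^ 2 * (maxwellian v * (⟪v, n⟫ * heatProfile v ^ 2)) := fun v => by ring
  have h3 : ∀ {φ : Vec d → ℝ}, Measurable φ →
      Integrable (fun v => |⟪v, n⟫| * maxwellian v * φ v ^ 2) →
      Integrable fun v => maxwellian v * ⟪v, n⟫ * φ v ^ 2 := fun {φ} hφ h => by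
    refine h.mono (Measurable.aestronglyMeasurable (by fun_prop))
      (Eventually.of_forall fun v => le_of_eq ?_)
    rw [norm_mul, norm_mul, norm_mul, norm_mul, Real.norm_eq_abs |⟪v, n⟫|, abs_abs,
      Real.norm_eq_abs ⟪v, n⟫, mul_comm ‖maxwellian v‖]
  have h4 : Integrable fun v : Vec d => maxwellian v * (⟪v, n⟫ * heatProfile v ^ 2) := by
    refine (h3 continuous_heatProfile.measurable iq).congr (Eventually.of_forall fun v => ?_)
    simp only
    ring
  simp_rw [h2]
  rw [integral_sub (h3 hf' hi') (h4.const_mul _), integral_const_mul,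
    integral_maxwellian_mul_eq_zero fun v => by rw [heatProfile_neg, inner_neg_left]; ring]
  ring

end Wall

/-! ### Reference measures as weighted products -/

section Reference

variable {d : ℕ} {Ω : Set (Vec d)}

/-- `dx dv` on `Ω × ℝ^d`. -/
abbrev spaceBase (Ω : Set (Vec d)) : Measure (Vec d × Vec d) := (volume.restrict Ω).prod volume

/-- `dt dx dv` on `[t₁, t₂] × Ω × ℝ^d`. -/
abbrev timeBase (t₁ t₂ : ℝ) (Ω : Set (Vec d)) : Measure (ℝ × Vec d × Vec d) :=
  (volume.restrict (Set.Icc t₁ t₂)).prod ((volume.restrict Ω).prod volume)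

/-- `dt dσ_x dv` on `[t₁, t₂] × ∂Ω × ℝ^d`. -/
abbrev boundaryBase (t₁ t₂ : ℝ) (Ω : Set (Vec d)) : Measure (ℝ × Vec d × Vec d) :=
  (volume.restrict (Set.Icc t₁ t₂)).prod ((surfaceMeasure Ω).prod volume)

lemma phaseMeasure_eq {w : Vec d → ℝ} (hw : Measurable w) :
    phaseMeasure Ω w =
      (spaceBase Ω).withDensity fun p => ENNReal.ofReal (w p.2 * maxwellian p.2) :=
  prod_withDensity_right (hw.mul measurable_maxwellian).ennreal_ofReal

lemma timeProd_phaseMeasure {w : Vec d → ℝ} (hw : Measurable w) (t₁ t₂ : ℝ) :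
    timeProd t₁ t₂ (phaseMeasure Ω w) = (timeBase t₁ t₂ Ω).withDensity fun p =>
      ENNReal.ofReal (w p.2.2 * maxwellian p.2.2) := by
  rw [phaseMeasure_eq hw]
  exact prod_withDensity_right (μ := volume.restrict (Set.Icc t₁ t₂))
    (g := fun p : Vec d × Vec d => ENNReal.ofReal (w p.2 * maxwellian p.2)) (by fun_prop)

lemma timeProd_boundaryMeasure [IsFiniteMeasure (surfaceMeasure Ω)] {w : Vec d × Vec d → ℝ}
    (hw : Measurable w) (t₁ t₂ : ℝ) :
    timeProd t₁ t₂ (boundaryMeasure Ω w) = (boundaryBase t₁ t₂ Ω).withDensity fun p =>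
      ENNReal.ofReal (w p.2 * maxwellian p.2.2) :=
  prod_withDensity_right (μ := volume.restrict (Set.Icc t₁ t₂))
    (g := fun p : Vec d × Vec d => ENNReal.ofReal (w p * maxwellian p.2)) (by fun_prop)

lemma ae_mem_of_prod {X Y Z : Type*} [MeasurableSpace X] [MeasurableSpace Y] [MeasurableSpace Z]
    (μ : Measure X) {ν : Measure Y} (ρ : Measure Z) [SFinite ν] [SFinite ρ] {P : Y → Prop}
    (h : ∀ᵐ y ∂ν, P y) : ∀ᵐ p ∂(μ.prod (ν.prod ρ)), P p.2.1 :=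
  Measure.quasiMeasurePreserving_snd.ae (Measure.quasiMeasurePreserving_fst.ae h)

lemma integrable_prod_of_bound {X Y : Type*} [MeasurableSpace X] [MeasurableSpace Y]
    {μ : Measure X} {ν : Measure Y} [IsFiniteMeasure μ] [IsFiniteMeasure ν]
    {F : X × Y × Vec d → ℝ} (hF : Measurable F) {C : ℝ} {k : ℕ}
    (h : ∀ᵐ p ∂(μ.prod (ν.prod volume)), |F p| ≤ C * (1 + ‖p.2.2‖) ^ k) :
    Integrable (fun p => maxwellian p.2.2 * F p) (μ.prod (ν.prod volume)) := by
  have h1 : Integrable (fun p : X × Y × Vec d => C * (maxwellian p.2.2 * (1 + ‖p.2.2‖) ^ k))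
      (μ.prod (ν.prod volume)) :=
    (((integrable_maxwellian_mul_pow k).comp_snd ν).comp_snd μ).const_mul C
  refine h1.mono' (Measurable.aestronglyMeasurable (by fun_prop)) (h.mono fun p hp => ?_)
  rw [norm_mul, Real.norm_of_nonneg (maxwellian_nonneg _), Real.norm_eq_abs]
  nlinarith [hp, maxwellian_pos p.2.2]

lemma integrable_of_fiber_le {X Y Z : Type*} [MeasurableSpace X] [MeasurableSpace Y]
    [MeasurableSpace Z] {μ : Measure X} {ν : Measure Y} {ρ : Measure Z} [SFinite μ] [SFinite ν]
    [SFinite ρ] {F G : X × Y × Z → ℝ} (hF : Measurable F) (hF0 : ∀ p, 0 ≤ F p)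
    (hGm : Measurable G) (hG0 : ∀ p, 0 ≤ G p) (hG : Integrable G (μ.prod (ν.prod ρ)))
    (h : ∀ᵐ x ∂μ, ∀ᵐ y ∂ν, Integrable (fun z => F (x, y, z)) ρ ∧
      ∫ z, F (x, y, z) ∂ρ ≤ ∫ z, G (x, y, z) ∂ρ) : Integrable F (μ.prod (ν.prod ρ)) := by
  refine ⟨hF.aestronglyMeasurable, ?_⟩
  have h1 := hG.2
  rw [hasFiniteIntegral_iff_ofReal (Eventually.of_forall hF0)]
  rw [hasFiniteIntegral_iff_ofReal (Eventually.of_forall hG0)] at h1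
  refine lt_of_le_of_lt ?_ h1
  rw [lintegral_prod _ (by fun_prop), lintegral_prod _ (by fun_prop)]
  refine lintegral_mono_ae ?_
  filter_upwards [h, ae_ae_integrable_of_prod_prod hG] with x hx hGx
  rw [lintegral_prod _ (Measurable.aemeasurable (by fun_prop)),
    lintegral_prod _ (Measurable.aemeasurable (by fun_prop))]
  refine lintegral_mono_ae ?_
  filter_upwards [hx, hGx] with y hy hGy
  rw [← ofReal_integral_eq_lintegral_ofReal hy.1 (Eventually.of_forall fun z => hF0 _),
    ← ofReal_integral_eq_lintegral_ofReal hGy (Eventually.of_forall fun z => hG0 _)]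
  exact ENNReal.ofReal_le_ofReal hy.2

end Reference

lemma lintegral_mono_of_fiber {X Y Z : Type*} [MeasurableSpace X] [MeasurableSpace Y]
    [MeasurableSpace Z] {μ : Measure X} {ν : Measure Y} {ρ : Measure Z} [SFinite μ] [SFinite ν]
    [SFinite ρ] {F G : X × Y × Z → ℝ≥0∞} (hF : Measurable F) (hG : Measurable G)
    (h : ∀ x y, ∫⁻ z, F (x, y, z) ∂ρ ≤ ∫⁻ z, G (x, y, z) ∂ρ) :
    ∫⁻ p, F p ∂(μ.prod (ν.prod ρ)) ≤ ∫⁻ p, G p ∂(μ.prod (ν.prod ρ)) := by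
  rw [lintegral_prod _ hF.aemeasurable, lintegral_prod _ hG.aemeasurable]
  refine lintegral_mono fun x => ?_
  rw [lintegral_prod _ (Measurable.aemeasurable (by fun_prop)),
    lintegral_prod _ (Measurable.aemeasurable (by fun_prop))]
  exact lintegral_mono fun y => h x y

/-! ### Quadratic bounds and identities for solutions -/

section Solution

variable {d : ℕ} {Ω : Set (Vec d)} {N : Vec d → Vec d} {β : Vec d → Vec d → ℝ} {θ : Vec d → ℝ}
  {α : ℝ} {g γ : ℝ → Vec d → Vec d → ℝ}

namespace IsSolution

lemma measurable_at (hs : IsSolution Ω N β θ α g γ) (t : ℝ) :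
    Measurable fun p : Vec d × Vec d => g t p.1 p.2 :=
  hs.measurable.comp (g := fun p : ℝ × Vec d × Vec d => g p.1 p.2.1 p.2.2)
    (f := fun p : Vec d × Vec d => (t, p)) (by fun_prop)

lemma measurable_section (hs : IsSolution Ω N β θ α g γ) (t : ℝ) (x : Vec d) :
    Measurable (g t x) :=
  hs.measurable.comp (g := fun p : ℝ × Vec d × Vec d => g p.1 p.2.1 p.2.2)
    (f := fun v : Vec d => (t, x, v)) (by fun_prop)

lemma measurable_trace_section (hs : IsSolution Ω N β θ α g γ) (t : ℝ) (x : Vec d) :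
    Measurable (γ t x) :=
  hs.measurable_trace.comp (g := fun p : ℝ × Vec d × Vec d => γ p.1 p.2.1 p.2.2)
    (f := fun v : Vec d => (t, x, v)) (by fun_prop)

lemma measurable_linColl (hs : IsSolution Ω N β θ α g γ) (hβ : IsSymKernel β) :
    Measurable fun p : ℝ × Vec d × Vec d => linColl β (g p.1 p.2.1) p.2.2 := by
  have h : Measurable (Function.uncurry fun (y : ℝ × Vec d) (v : Vec d) => g y.1 y.2 v) :=
    hs.measurable.comp (g := fun p : ℝ × Vec d × Vec d => g p.1 p.2.1 p.2.2)
      (f := fun q : (ℝ × Vec d) × Vec d => (q.1.1, q.1.2, q.2)) (by fun_prop)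
  exact (hβ.measurable_linColl h).comp
    (f := fun p : ℝ × Vec d × Vec d => ((p.1, p.2.1), p.2.2)) (by fun_prop)

lemma integrable_sq (hs : IsSolution Ω N β θ α g γ) {t : ℝ} (ht : 0 ≤ t) :
    Integrable (fun p => maxwellian p.2 * g t p.1 p.2 ^ 2) (spaceBase Ω) := by
  have h := hs.memLp t ht
  rw [phaseMeasure_eq measurable_const, memLp_two_withDensity_ofReal (by fun_prop)
    (fun p => by simpa using maxwellian_nonneg _) (hs.measurable_at t)] at h
  simpa using h

lemma integrable_freq_sq (hs : IsSolution Ω N β θ α g γ) (hβ : IsSymKernel β) (T : ℝ) :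
    Integrable (fun p => collisionFrequency β p.2.2 * maxwellian p.2.2 * g p.1 p.2.1 p.2.2 ^ 2)
      (timeBase 0 T Ω) := by
  have hm := hβ.measurable_collisionFrequency
  have h := hs.memLp_freq T
  rwa [timeProd_phaseMeasure hm, memLp_two_withDensity_ofReal (by fun_prop)
    (fun p => mul_nonneg (hβ.collisionFrequency_nonneg _) (maxwellian_nonneg _)) hs.measurable] at h

lemma integrable_trace_sq [IsFiniteMeasure (surfaceMeasure Ω)] (hs : IsSolution Ω N β θ α g γ)
    (hN : Measurable N) (T : ℝ) :
    Integrable (fun p => |⟪p.2.2, N p.2.1⟫| * maxwellian p.2.2 * γ p.1 p.2.1 p.2.2 ^ 2)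
      (boundaryBase 0 T Ω) := by
  have h := hs.memLp_trace T
  rwa [timeProd_boundaryMeasure (by fun_prop), memLp_two_withDensity_ofReal (by fun_prop)
    (fun p => mul_nonneg (abs_nonneg _) (maxwellian_nonneg _)) hs.measurable_trace] at h

lemma integrable_linColl_sq (hs : IsSolution Ω N β θ α g γ) (hβ : IsSymKernel β) (hd : d ≠ 0)
    (T : ℝ) :
    Integrable (fun p => (collisionFrequency β p.2.2)⁻¹ * maxwellian p.2.2 *
      linColl β (g p.1 p.2.1) p.2.2 ^ 2) (timeBase 0 T Ω) := by
  have hm := hβ.measurable_collisionFrequency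
  have hL := hs.measurable_linColl hβ
  have hg := hs.measurable
  refine ⟨Measurable.aestronglyMeasurable (by fun_prop), ?_⟩
  rw [hasFiniteIntegral_iff_ofReal (Eventually.of_forall fun p => mul_nonneg (mul_nonneg
    (inv_nonneg.2 (hβ.collisionFrequency_nonneg _)) (maxwellian_nonneg _)) (sq_nonneg _))]
  have h1 := (hs.integrable_freq_sq hβ T).2
  rw [hasFiniteIntegral_iff_ofReal (Eventually.of_forall fun p => mul_nonneg (mul_nonneg
    (hβ.collisionFrequency_nonneg _) (maxwellian_nonneg _)) (sq_nonneg _))] at h1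
  refine lt_of_le_of_lt ?_ (ENNReal.mul_lt_top (a := 16) (by simp) h1)
  rw [← lintegral_const_mul _ (by fun_prop)]
  refine lintegral_mono_of_fiber (by fun_prop) (by fun_prop) fun s x => ?_
  have hsec := hs.measurable_section s x
  rw [lintegral_const_mul _ (by fun_prop)]
  have key := hβ.lintegral_sq_linColl_le hd hsec
  simp only at key ⊢
  exact key

/-- Green's formula relative to Lebesgue measure and surface measure. -/
lemma green_base [IsFiniteMeasure (surfaceMeasure Ω)] (hs : IsSolution Ω N β θ α g γ)
    {φ : ℝ × Vec d × Vec d → ℝ} (hφ : IsTest φ) {t : ℝ} (ht : 0 ≤ t) :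
    α * (∫ p, maxwellian p.2 * φ (t, p) * g t p.1 p.2 ∂(spaceBase Ω))
      - α * (∫ p, maxwellian p.2 * φ (0, p) * g 0 p.1 p.2 ∂(spaceBase Ω))
    = (∫ p, maxwellian p.2.2 * transport α φ p * g p.1 p.2.1 p.2.2 ∂(timeBase 0 t Ω))
      - α⁻¹ * (∫ p, maxwellian p.2.2 * φ p * linColl β (g p.1 p.2.1) p.2.2 ∂(timeBase 0 t Ω))
      - ∫ p, maxwellian p.2.2 * ⟪p.2.2, N p.2.1⟫ * φ p * γ p.1 p.2.1 p.2.2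
          ∂(boundaryBase 0 t Ω) := by
  have h := hs.green φ hφ 0 t le_rfl ht
  rw [timeProd_boundaryMeasure measurable_const, timeProd_phaseMeasure measurable_const,
    phaseMeasure_eq measurable_const] at h
  have h1 : ∀ F : Vec d × Vec d → ℝ, ∫ p, F p ∂((spaceBase Ω).withDensity fun p =>
      ENNReal.ofReal (1 * maxwellian p.2)) = ∫ p, maxwellian p.2 * F p ∂(spaceBase Ω) := fun F => by
    rw [integral_withDensity_ofReal (by fun_prop) fun p => by simpa using maxwellian_nonneg _]
    simp
  have h2 : ∀ (μ : Measure (ℝ × Vec d × Vec d)) (F : ℝ × Vec d × Vec d → ℝ),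
      ∫ p, F p ∂(μ.withDensity fun p => ENNReal.ofReal (1 * maxwellian p.2.2)) =
      ∫ p, maxwellian p.2.2 * F p ∂μ := fun μ F => by
    rw [integral_withDensity_ofReal (by fun_prop) fun p => by simpa using maxwellian_nonneg _]
    simp
  rw [h1, h1, h2, h2, h2] at h
  simp only [← mul_assoc] at h
  rw [h]
  congr 2
  ext p
  ring

lemma transport_measurable {φ : ℝ × Vec d × Vec d → ℝ} (hφ : ContDiff ℝ (⊤ : ℕ∞) φ) (α : ℝ) :
    Measurable (transport α φ) := by
  have := hφ.continuous_fderiv (by simp)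
  have h : Continuous (transport α φ) := by
    unfold transport
    fun_prop
  exact h.measurable

/-- The energy identity. -/
lemma energy [IsFiniteMeasure (surfaceMeasure Ω)] (hs : IsSolution Ω N β θ α g γ)
    (hβ : IsSymKernel β) (hd : d ≠ 0) (hN : Measurable N) {t : ℝ} (ht : 0 ≤ t) :
    α * (∫ p, maxwellian p.2 * g t p.1 p.2 ^ 2 ∂(spaceBase Ω))
      - α * (∫ p, maxwellian p.2 * g 0 p.1 p.2 ^ 2 ∂(spaceBase Ω))
    = -(2 * α⁻¹) * (∫ p, maxwellian p.2.2 * (g p.1 p.2.1 p.2.2 * linColl β (g p.1 p.2.1) p.2.2)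
        ∂(timeBase 0 t Ω))
      - ∫ p, maxwellian p.2.2 * ⟪p.2.2, N p.2.1⟫ * γ p.1 p.2.1 p.2.2 ^ 2
          ∂(boundaryBase 0 t Ω) := by
  obtain ⟨φ, hφ, h1, h2, h3, h4⟩ := hs.strong t
  have hm := hβ.measurable_collisionFrequency
  have hg := hs.measurable
  have hγ := hs.measurable_trace
  have hL := hs.measurable_linColl hβ
  have hφm : ∀ k, Measurable (φ k) := fun k => (hφ k).1.continuous.measurable
  have hM := fun v : Vec d => maxwellian_nonneg v
  have ha := fun v : Vec d => hβ.collisionFrequency_nonneg v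
  have haM : ∀ p : ℝ × Vec d × Vec d, 0 ≤ collisionFrequency β p.2.2 * maxwellian p.2.2 :=
    fun p => mul_nonneg (ha _) (hM _)
  have haM' : ∀ p : ℝ × Vec d × Vec d, 0 ≤ (collisionFrequency β p.2.2)⁻¹ * maxwellian p.2.2 :=
    fun p => mul_nonneg (inv_nonneg.2 (ha _)) (hM _)
  have haa : ∀ v, collisionFrequency β v * (collisionFrequency β v)⁻¹ = 1 := fun v =>
    mul_inv_cancel₀ (hβ.collisionFrequency_pos hd v).ne'
  rw [timeProd_phaseMeasure hm] at h1
  rw [timeProd_phaseMeasure (w := fun v => (collisionFrequency β v)⁻¹) (by fun_prop)] at h2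
  rw [timeProd_boundaryMeasure (by fun_prop)] at h3
  rw [phaseMeasure_eq measurable_const] at h4
  have l4 : ∀ s ∈ Set.Icc 0 t, Tendsto
      (fun k => ∫ p, maxwellian p.2 * φ k (s, p) * g s p.1 p.2 ∂(spaceBase Ω)) atTop
      (𝓝 (∫ p, maxwellian p.2 * g s p.1 p.2 * g s p.1 p.2 ∂(spaceBase Ω))) := fun s hst =>
    tendsto_integral_mul_mul (μ := spaceBase Ω) (c := fun p => maxwellian p.2)
      (φ := fun k p => φ k (s, p)) (f := fun p => g s p.1 p.2) (g := fun p => g s p.1 p.2)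
      (w₁ := fun p => 1 * maxwellian p.2) (w₂ := fun p => maxwellian p.2)
      (by fun_prop) (fun k => (hφm k).comp (by fun_prop)) (hs.measurable_at s) (hs.measurable_at s)
      (by fun_prop) (by fun_prop) (fun p => by simpa using hM _) (fun p => hM _)
      (fun p => by rw [one_mul, sq]) (by simpa using hs.integrable_sq hst.1)
      (hs.integrable_sq hst.1) (h4 s hst)
  have l1 : Tendsto (fun k => ∫ p, maxwellian p.2.2 * φ k p * linColl β (g p.1 p.2.1) p.2.2
      ∂(timeBase 0 t Ω)) atTop (𝓝 (∫ p, maxwellian p.2.2 * g p.1 p.2.1 p.2.2 *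
        linColl β (g p.1 p.2.1) p.2.2 ∂(timeBase 0 t Ω))) :=
    tendsto_integral_mul_mul (μ := timeBase 0 t Ω) (c := fun p => maxwellian p.2.2)
      (φ := φ) (f := fun p => g p.1 p.2.1 p.2.2) (g := fun p => linColl β (g p.1 p.2.1) p.2.2)
      (w₁ := fun p => collisionFrequency β p.2.2 * maxwellian p.2.2)
      (w₂ := fun p => (collisionFrequency β p.2.2)⁻¹ * maxwellian p.2.2) (by fun_prop) hφm hg hL
      (by fun_prop) (by fun_prop) haM haM'
      (fun p => le_of_eq (by linear_combination -maxwellian p.2.2 ^ 2 * haa p.2.2))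
      (hs.integrable_freq_sq hβ t) (hs.integrable_linColl_sq hβ hd t) h1
  have l2 : Tendsto (fun k => ∫ p, maxwellian p.2.2 * transport α (φ k) p * g p.1 p.2.1 p.2.2
      ∂(timeBase 0 t Ω)) atTop (𝓝 (∫ p, maxwellian p.2.2 * (-(α⁻¹ *
        linColl β (g p.1 p.2.1) p.2.2)) * g p.1 p.2.1 p.2.2 ∂(timeBase 0 t Ω))) :=
    tendsto_integral_mul_mul (μ := timeBase 0 t Ω) (c := fun p => maxwellian p.2.2)
      (φ := fun k => transport α (φ k)) (f := fun p => -(α⁻¹ * linColl β (g p.1 p.2.1) p.2.2))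
      (g := fun p => g p.1 p.2.1 p.2.2)
      (w₂ := fun p => collisionFrequency β p.2.2 * maxwellian p.2.2)
      (w₁ := fun p => (collisionFrequency β p.2.2)⁻¹ * maxwellian p.2.2) (by fun_prop)
      (fun k => transport_measurable (hφ k).1 α) (by fun_prop) hg
      (by fun_prop) (by fun_prop) haM' haM
      (fun p => le_of_eq (by linear_combination -maxwellian p.2.2 ^ 2 * haa p.2.2))
      (((hs.integrable_linColl_sq hβ hd t).const_mul (α⁻¹ ^ 2)).congr
        (Eventually.of_forall fun p => by ring))
      (hs.integrable_freq_sq hβ t) (by simpa only [sub_neg_eq_add] using h2)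
  have l3 : Tendsto (fun k => ∫ p, maxwellian p.2.2 * ⟪p.2.2, N p.2.1⟫ * φ k p *
      γ p.1 p.2.1 p.2.2 ∂(boundaryBase 0 t Ω)) atTop (𝓝 (∫ p, maxwellian p.2.2 *
        ⟪p.2.2, N p.2.1⟫ * γ p.1 p.2.1 p.2.2 * γ p.1 p.2.1 p.2.2 ∂(boundaryBase 0 t Ω))) :=
    tendsto_integral_mul_mul (μ := boundaryBase 0 t Ω)
      (c := fun p => maxwellian p.2.2 * ⟪p.2.2, N p.2.1⟫) (φ := φ)
      (f := fun p => γ p.1 p.2.1 p.2.2) (g := fun p => γ p.1 p.2.1 p.2.2)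
      (w₁ := fun p => |⟪p.2.2, N p.2.1⟫| * maxwellian p.2.2)
      (w₂ := fun p => |⟪p.2.2, N p.2.1⟫| * maxwellian p.2.2) (by fun_prop) hφm hγ hγ
      (by fun_prop) (by fun_prop) (fun p => mul_nonneg (abs_nonneg _) (hM _))
      (fun p => mul_nonneg (abs_nonneg _) (hM _))
      (fun p => le_of_eq (by rw [mul_pow, ← sq_abs ⟪p.2.2, N p.2.1⟫]; ring))
      (hs.integrable_trace_sq hN t) (hs.integrable_trace_sq hN t) h3
  have key := tendsto_nhds_unique (((l4 t ⟨ht, le_rfl⟩).const_mul α).sub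
    ((l4 0 ⟨le_rfl, ht⟩).const_mul α))
    (((l2.sub (l1.const_mul α⁻¹)).sub l3).congr fun k => (hs.green_base (hφ k) ht).symm)
  have e1 : ∫ p, maxwellian p.2.2 * (-(α⁻¹ * linColl β (g p.1 p.2.1) p.2.2)) *
      g p.1 p.2.1 p.2.2 ∂(timeBase 0 t Ω) = -α⁻¹ * ∫ p, maxwellian p.2.2 *
        (g p.1 p.2.1 p.2.2 * linColl β (g p.1 p.2.1) p.2.2) ∂(timeBase 0 t Ω) := by
    rw [← integral_const_mul]
    congr 1
    ext p
    ring
  rw [e1] at key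
  simp only [mul_assoc, ← sq] at key ⊢
  rw [key]
  ring

end IsSolution

end Solution

/-! ### The profile `θ(x) (|v|² - (d + 2)) / 2` in the weighted spaces -/

section Profile

variable {d : ℕ} {Ω : Set (Vec d)}

lemma isFiniteMeasure_restrict (hΩ : Bornology.IsBounded Ω) :
    IsFiniteMeasure ((volume : Measure (Vec d)).restrict Ω) :=
  ⟨by simpa using hΩ.measure_lt_top⟩

lemma exists_norm_le_closure (hΩ : Bornology.IsBounded Ω) {E : Type*} [NormedAddCommGroup E]
    {f : Vec d → E} (hf : Continuous f) : ∃ C, 0 ≤ C ∧ ∀ x ∈ closure Ω, ‖f x‖ ≤ C := by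
  obtain ⟨C, hC⟩ := hΩ.isCompact_closure.exists_bound_of_continuousOn hf.continuousOn
  exact ⟨max C 0, le_max_right _ _, fun x hx => (hC x hx).trans (le_max_left _ _)⟩

lemma ae_space_mem (hΩ : IsOpen Ω) : ∀ᵐ p ∂(spaceBase Ω), p.1 ∈ Ω :=
  Measure.quasiMeasurePreserving_fst.ae (ae_restrict_mem hΩ.measurableSet)

lemma ae_time_mem (hΩ : IsOpen Ω) (t₁ t₂ : ℝ) :
    ∀ᵐ p ∂(timeBase t₁ t₂ Ω), p.1 ∈ Set.Icc t₁ t₂ ∧ p.2.1 ∈ Ω :=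
  (Measure.quasiMeasurePreserving_fst.ae (ae_restrict_mem measurableSet_Icc)).and
    (ae_mem_of_prod _ _ (ae_restrict_mem hΩ.measurableSet))

lemma ae_boundary_mem [IsFiniteMeasure (surfaceMeasure Ω)] (t₁ t₂ : ℝ) :
    ∀ᵐ p ∂(boundaryBase t₁ t₂ Ω), p.1 ∈ Set.Icc t₁ t₂ ∧ p.2.1 ∈ frontier Ω :=
  (Measure.quasiMeasurePreserving_fst.ae (ae_restrict_mem measurableSet_Icc)).and
    (ae_mem_of_prod (P := fun x => x ∈ frontier Ω) _ _
      (ae_restrict_mem isClosed_frontier.measurableSet))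

lemma sq_mul_heatProfile_le {x C : ℝ} (hx : |x| ≤ C) (v : Vec d) :
    (x * heatProfile v) ^ 2 ≤ C ^ 2 * (d + 2) ^ 2 * (1 + ‖v‖) ^ 4 := by
  have h1 := abs_heatProfile_le v
  calc (x * heatProfile v) ^ 2 = |x| ^ 2 * |heatProfile v| ^ 2 := by rw [mul_pow, sq_abs, sq_abs]
    _ ≤ C ^ 2 * ((d + 2) * (1 + ‖v‖) ^ 2) ^ 2 := by gcongr
    _ = _ := by ring

lemma integrable_profile_sq (ho : IsOpen Ω) (hb : Bornology.IsBounded Ω) {θ : Vec d → ℝ}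
    (hθ : Continuous θ) :
    Integrable (fun p => maxwellian p.2 * (θ p.1 * heatProfile p.2) ^ 2) (spaceBase Ω) := by
  have := isFiniteMeasure_restrict hb
  obtain ⟨C, hC, hθC⟩ := exists_norm_le_closure hb hθ
  have h1 : Integrable (fun p : Vec d × Vec d => C ^ 2 * (d + 2) ^ 2 *
      (maxwellian p.2 * (1 + ‖p.2‖) ^ 4)) (spaceBase Ω) :=
    ((integrable_maxwellian_mul_pow 4).comp_snd _).const_mul _
  refine h1.mono' (Continuous.aestronglyMeasurable (by fun_prop))
    ((ae_space_mem ho).mono fun p hp => ?_)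
  have h2 := sq_mul_heatProfile_le (hθC p.1 (subset_closure hp)) p.2
  have h3 := maxwellian_nonneg p.2
  rw [Real.norm_of_nonneg (by positivity)]
  nlinarith

lemma integrable_freq_profile_sq (ho : IsOpen Ω) (hb : Bornology.IsBounded Ω) {θ : Vec d → ℝ}
    (hθ : Continuous θ) {β : Vec d → Vec d → ℝ} (hβ : IsSymKernel β) (t₁ t₂ : ℝ) :
    Integrable (fun p => collisionFrequency β p.2.2 * maxwellian p.2.2 *
      (θ p.2.1 * heatProfile p.2.2) ^ 2) (timeBase t₁ t₂ Ω) := by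
  have := isFiniteMeasure_restrict hb
  obtain ⟨C, hC, hθC⟩ := exists_norm_le_closure hb hθ
  obtain ⟨A, hA, k, hAk⟩ := hβ.exists_collisionFrequency_le
  have hm := hβ.measurable_collisionFrequency
  have ha := hβ.collisionFrequency_nonneg
  refine (integrable_prod_of_bound (F := fun p : ℝ × Vec d × Vec d => collisionFrequency β p.2.2 *
    (θ p.2.1 * heatProfile p.2.2) ^ 2) (by fun_prop) (C := A * (C ^ 2 * (d + 2) ^ 2)) (k := k + 4)
    ((ae_time_mem ho t₁ t₂).mono fun p hp => ?_)).congr (Eventually.of_forall fun p => by ring)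
  rw [abs_of_nonneg (mul_nonneg (ha _) (sq_nonneg _))]
  calc _ ≤ A * (1 + ‖p.2.2‖) ^ k * (C ^ 2 * (d + 2) ^ 2 * (1 + ‖p.2.2‖) ^ 4) :=
        mul_le_mul (hAk _) (sq_mul_heatProfile_le (hθC _ (subset_closure hp.2)) _) (sq_nonneg _)
          (by positivity)
    _ = _ := by ring

lemma integrable_inv_freq_flux_sq (ho : IsOpen Ω) (hb : Bornology.IsBounded Ω) {e : Vec d → Vec d}
    (he : Continuous e) {β : Vec d → Vec d → ℝ} (hβ : IsSymKernel β) (hd : d ≠ 0) (t₁ t₂ : ℝ) :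
    Integrable (fun p => (collisionFrequency β p.2.2)⁻¹ * maxwellian p.2.2 *
      (⟪p.2.2, e p.2.1⟫ * heatProfile p.2.2) ^ 2) (timeBase t₁ t₂ Ω) := by
  have := isFiniteMeasure_restrict hb
  obtain ⟨C, hC, heC⟩ := exists_norm_le_closure hb he
  obtain ⟨A, hA, k, hAk⟩ := hβ.exists_inv_collisionFrequency_le hd
  have hm := hβ.measurable_collisionFrequency
  have hem := he.measurable
  have ha := hβ.collisionFrequency_nonneg
  refine (integrable_prod_of_bound (F := fun p : ℝ × Vec d × Vec d =>
    (collisionFrequency β p.2.2)⁻¹ * (⟪p.2.2, e p.2.1⟫ * heatProfile p.2.2) ^ 2) (by fun_prop)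
    (C := A * (C ^ 2 * (d + 2) ^ 2)) (k := k + 6)
    ((ae_time_mem ho t₁ t₂).mono fun p hp => ?_)).congr (Eventually.of_forall fun p => by ring)
  rw [abs_of_nonneg (mul_nonneg (inv_nonneg.2 (ha _)) (sq_nonneg _))]
  have h1 : |⟪p.2.2, e p.2.1⟫| ≤ C * (1 + ‖p.2.2‖) := by
    refine (abs_real_inner_le_norm _ _).trans ?_
    rw [mul_comm]
    exact mul_le_mul (heC _ (subset_closure hp.2)) (by linarith) (norm_nonneg _) hC
  calc _ ≤ A * (1 + ‖p.2.2‖) ^ k *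
        ((C * (1 + ‖p.2.2‖)) ^ 2 * (d + 2) ^ 2 * (1 + ‖p.2.2‖) ^ 4) :=
        mul_le_mul (hAk _) (sq_mul_heatProfile_le h1 _) (sq_nonneg _) (by positivity)
    _ = _ := by ring

lemma integrable_wall_profile_sq (hb : Bornology.IsBounded Ω) [IsFiniteMeasure (surfaceMeasure Ω)]
    {θ : Vec d → ℝ} (hθ : Continuous θ) {N : Vec d → Vec d} (hN : Measurable N)
    (hN1 : ∀ x, ‖N x‖ = 1) (t₁ t₂ : ℝ) :
    Integrable (fun p => |⟪p.2.2, N p.2.1⟫| * maxwellian p.2.2 *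
      (θ p.2.1 * heatProfile p.2.2) ^ 2) (boundaryBase t₁ t₂ Ω) := by
  obtain ⟨C, hC, hθC⟩ := exists_norm_le_closure hb hθ
  refine (integrable_prod_of_bound (F := fun p : ℝ × Vec d × Vec d => |⟪p.2.2, N p.2.1⟫| *
    (θ p.2.1 * heatProfile p.2.2) ^ 2) (by fun_prop) (C := C ^ 2 * (d + 2) ^ 2) (k := 5)
    ((ae_boundary_mem t₁ t₂).mono fun p hp => ?_)).congr (Eventually.of_forall fun p => by ring)
  rw [abs_of_nonneg (mul_nonneg (abs_nonneg _) (sq_nonneg _))]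
  have h1 : |⟪p.2.2, N p.2.1⟫| ≤ 1 + ‖p.2.2‖ :=
    (abs_inner_le_of_norm_one (hN1 _)).trans (by linarith)
  calc _ ≤ (1 + ‖p.2.2‖) * (C ^ 2 * (d + 2) ^ 2 * (1 + ‖p.2.2‖) ^ 4) :=
        mul_le_mul h1 (sq_mul_heatProfile_le (hθC _ (frontier_subset_closure hp.2)) _)
          (sq_nonneg _) (by positivity)
    _ = _ := by ring

end Profile

/-! ### Truncated profiles as test functions -/

section Truncation

variable {d : ℕ}

/-- A smooth cutoff in the velocity, equal to `1` on the ball of radius `k + 1`. -/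
def velocityCutoff (k : ℕ) (v : Vec d) : ℝ :=
  (⟨1, 2, by norm_num, by norm_num⟩ : ContDiffBump (0 : Vec d)) (((k : ℝ) + 1)⁻¹ • v)

lemma contDiff_velocityCutoff (k : ℕ) : ContDiff ℝ (⊤ : ℕ∞) (velocityCutoff (d := d) k) :=
  (ContDiffBump.contDiff _).comp (contDiff_const_smul _)

lemma abs_velocityCutoff_le (k : ℕ) (v : Vec d) : |velocityCutoff k v| ≤ 1 := by
  unfold velocityCutoff
  rw [abs_of_nonneg (ContDiffBump.nonneg _)]
  exact ContDiffBump.le_one _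

lemma velocityCutoff_eq_zero {k : ℕ} {v : Vec d} (h : 2 * ((k : ℝ) + 1) ≤ ‖v‖) :
    velocityCutoff k v = 0 := by
  refine ContDiffBump.zero_of_le_dist _ ?_
  have hk : (0 : ℝ) < k + 1 := by positivity
  rw [dist_zero_right, norm_smul, Real.norm_of_nonneg (by positivity), inv_mul_eq_div,
    le_div_iff₀ hk]
  exact h

lemma tendsto_velocityCutoff (v : Vec d) :
    Tendsto (fun k => velocityCutoff k v) atTop (𝓝 1) := by
  refine tendsto_const_nhds.congr' ?_
  obtain ⟨n, hn⟩ := exists_nat_ge ‖v‖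
  filter_upwards [eventually_ge_atTop n] with k hk
  symm
  refine ContDiffBump.one_of_mem_closedBall _ ?_
  have hk' : (0 : ℝ) < k + 1 := by positivity
  have : (n : ℝ) ≤ k := by exact_mod_cast hk
  rw [mem_closedBall_zero_iff, norm_smul, Real.norm_of_nonneg (by positivity), inv_mul_eq_div,
    div_le_iff₀ hk']
  simp only [one_mul]
  linarith

lemma tendsto_integral_velocityCutoff {X : Type*} [MeasurableSpace X] {μ : Measure X}
    {w : X → Vec d} (hw : Measurable w) {F : X → ℝ} (hF : Integrable F μ) :
    Tendsto (fun k => ∫ p, velocityCutoff k (w p) * F p ∂μ) atTop (𝓝 (∫ p, F p ∂μ)) := by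
  refine tendsto_integral_of_dominated_convergence (fun p => |F p|) (fun k => ?_) hF.abs
    (fun k => Eventually.of_forall fun p => ?_) (Eventually.of_forall fun p => ?_)
  · exact ((contDiff_velocityCutoff k).continuous.measurable.comp hw).aestronglyMeasurable.mul
      hF.aestronglyMeasurable
  · rw [Real.norm_eq_abs, abs_mul]
    exact mul_le_of_le_one_left (abs_nonneg _) (abs_velocityCutoff_le _ _)
  · simpa using (tendsto_velocityCutoff (w p)).mul_const (F p)

/-- Truncations of a profile `θ(x) q(v)` which agree with it on a ball of `(t, x)`. -/
lemma exists_truncation {θ : Vec d → ℝ} (hθ : ContDiff ℝ (⊤ : ℕ∞) θ) {q : Vec d → ℝ}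
    (hq : ContDiff ℝ (⊤ : ℕ∞) q) {R : ℝ} (hR : 0 < R) (α : ℝ) (k : ℕ) :
    ∃ φ : ℝ × Vec d × Vec d → ℝ, IsTest φ ∧ ∀ p : ℝ × Vec d × Vec d, |p.1| < R → ‖p.2.1‖ < R →
      φ p = velocityCutoff k p.2.2 * (θ p.2.1 * q p.2.2) ∧
      transport α φ p = velocityCutoff k p.2.2 * (⟪p.2.2, gradient θ p.2.1⟫ * q p.2.2) := by
  let χ : ContDiffBump (0 : ℝ × Vec d) := ⟨R, R + 1, hR, by linarith⟩
  let Q : Vec d → ℝ := fun v => velocityCutoff k v * q v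
  have hQ : ContDiff ℝ (⊤ : ℕ∞) Q := (contDiff_velocityCutoff k).mul hq
  let φ : ℝ × Vec d × Vec d → ℝ := fun p => χ (p.1, p.2.1) * (θ p.2.1 * Q p.2.2)
  have hφ : ContDiff ℝ (⊤ : ℕ∞) φ := by
    refine (χ.contDiff.comp (by fun_prop)).mul (ContDiff.mul ?_ ?_)
    · exact hθ.comp (by fun_prop)
    · exact hQ.comp (by fun_prop)
  refine ⟨φ, ⟨hφ, ?_⟩, fun p h1 h2 => ?_⟩
  · refine HasCompactSupport.intro (isCompact_closedBall (0 : ℝ × Vec d × Vec d)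
      (max (R + 1) (2 * ((k : ℝ) + 1)))) fun p hp => ?_
    rw [mem_closedBall_zero_iff, not_le, max_lt_iff] at hp
    by_cases h : R + 1 ≤ ‖(p.1, p.2.1)‖
    · have : χ (p.1, p.2.1) = 0 := χ.zero_of_le_dist (by rw [dist_zero_right]; exact h)
      simp only [φ, this, zero_mul]
    · rw [not_le, Prod.norm_mk, max_lt_iff] at h
      have h3 : 2 * ((k : ℝ) + 1) ≤ ‖p.2.2‖ := by
        by_contra! h4
        have h5 : ‖p‖ < max (R + 1) (2 * ((k : ℝ) + 1)) := by
          rw [Prod.norm_def, Prod.norm_def, max_lt_iff, max_lt_iff]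
          exact ⟨lt_max_of_lt_left h.1, lt_max_of_lt_left h.2, lt_max_of_lt_right h4⟩
        rw [lt_max_iff] at h5
        rcases h5 with h5 | h5 <;> linarith [hp.1, hp.2]
      simp only [φ, Q, velocityCutoff_eq_zero h3, zero_mul, mul_zero]
  · have hball : (p.1, p.2.1) ∈ Metric.ball (0 : ℝ × Vec d) χ.rIn := by
      rw [mem_ball_zero_iff, Prod.norm_mk, max_lt_iff]
      exact ⟨h1, h2⟩
    have hev : φ =ᶠ[𝓝 p] fun p => θ p.2.1 * Q p.2.2 := by
      have hc : ContinuousAt (fun p : ℝ × Vec d × Vec d => (p.1, p.2.1)) p := by fun_prop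
      filter_upwards [hc.eventually (χ.eventuallyEq_one_of_mem_ball hball)] with r hr
      simp only [φ, hr, Pi.one_apply, one_mul]
    constructor
    · rw [hev.eq_of_nhds]
      simp only [Q]
      ring
    · have d1 : HasFDerivAt (fun p : ℝ × Vec d × Vec d => θ p.2.1)
          ((fderiv ℝ θ p.2.1).comp ((ContinuousLinearMap.fst ℝ (Vec d) (Vec d)).comp
            (ContinuousLinearMap.snd ℝ ℝ (Vec d × Vec d)))) p :=
        ((hθ.differentiable (by simp)) p.2.1).hasFDerivAt.comp p
          ((hasFDerivAt_fst).comp p hasFDerivAt_snd)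
      have d2 : HasFDerivAt (fun p : ℝ × Vec d × Vec d => Q p.2.2)
          ((fderiv ℝ Q p.2.2).comp ((ContinuousLinearMap.snd ℝ (Vec d) (Vec d)).comp
            (ContinuousLinearMap.snd ℝ ℝ (Vec d × Vec d)))) p :=
        HasFDerivAt.comp (g := Q) p ((hQ.differentiable (by simp)) p.2.2).hasFDerivAt
          ((hasFDerivAt_snd (p := p.2)).comp p hasFDerivAt_snd)
      have h3 : ⟪p.2.2, gradient θ p.2.1⟫ = fderiv ℝ θ p.2.1 p.2.2 := by
        rw [real_inner_comm, inner_gradient_left]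
      unfold transport
      rw [hev.fderiv_eq, (d1.fun_mul d2).fderiv, h3]
      simp [Q]
      ring

end Truncation

/-! ### The solution tested against the profile -/

section Linear

variable {d : ℕ} {Ω : Set (Vec d)} {N : Vec d → Vec d} {β : Vec d → Vec d → ℝ} {θ : Vec d → ℝ}
  {α : ℝ} {g γ : ℝ → Vec d → Vec d → ℝ}

lemma contDiff_heatProfile : ContDiff ℝ (⊤ : ℕ∞) (heatProfile (d := d)) := by
  unfold heatProfile
  exact ((contDiff_id.norm_sq ℝ).sub contDiff_const).div_const 2

lemma tendsto_integral_truncation {X : Type*} [MeasurableSpace X] {μ : Measure X}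
    {w : X → Vec d} (hw : Measurable w) {c f g : X → ℝ} {φ : ℕ → X → ℝ}
    (hi : Integrable (fun p => c p * f p * g p) μ)
    (hφ : ∀ k, ∀ᵐ p ∂μ, φ k p = velocityCutoff k (w p) * f p) :
    Tendsto (fun k => ∫ p, c p * φ k p * g p ∂μ) atTop (𝓝 (∫ p, c p * f p * g p ∂μ)) := by
  refine (tendsto_integral_velocityCutoff hw hi).congr fun k => integral_congr_ae ?_
  filter_upwards [hφ k] with p hp
  rw [hp]
  ring

lemma integrable_freq_mul {X Y : Type*} [MeasurableSpace X] [MeasurableSpace Y]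
    {μ : Measure (X × Y × Vec d)} (hβ : IsSymKernel β) (hd : d ≠ 0)
    {f g : X × Y × Vec d → ℝ} (hf : Measurable f) (hg : Measurable g)
    (hfi : Integrable (fun p => collisionFrequency β p.2.2 * maxwellian p.2.2 * f p ^ 2) μ)
    (hgi : Integrable (fun p => (collisionFrequency β p.2.2)⁻¹ * maxwellian p.2.2 * g p ^ 2) μ) :
    Integrable (fun p => maxwellian p.2.2 * f p * g p) μ := by
  have hc : Measurable fun p : X × Y × Vec d => maxwellian p.2.2 := by fun_prop
  refine integrable_mul_mul (μ := μ) (f := f) (g := g) (c := fun p => maxwellian p.2.2)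
    (w₁ := fun p => collisionFrequency β p.2.2 * maxwellian p.2.2)
    (w₂ := fun p => (collisionFrequency β p.2.2)⁻¹ * maxwellian p.2.2)
    hc.aestronglyMeasurable hf.aestronglyMeasurable hg.aestronglyMeasurable
    (fun p => ?_) (fun p => ?_) (fun p => le_of_eq ?_) hfi hgi
  · exact mul_nonneg (hβ.collisionFrequency_nonneg _) (maxwellian_nonneg _)
  · exact mul_nonneg (inv_nonneg.2 (hβ.collisionFrequency_nonneg _)) (maxwellian_nonneg _)
  · have h := mul_inv_cancel₀ (hβ.collisionFrequency_pos hd p.2.2).ne'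
    linear_combination -maxwellian p.2.2 ^ 2 * h

lemma integrable_wall_mul {X : Type*} [MeasurableSpace X] {μ : Measure (X × Vec d × Vec d)}
    (hN : Measurable N) {f g : X × Vec d × Vec d → ℝ} (hf : Measurable f) (hg : Measurable g)
    (hfi : Integrable (fun p => |⟪p.2.2, N p.2.1⟫| * maxwellian p.2.2 * f p ^ 2) μ)
    (hgi : Integrable (fun p => |⟪p.2.2, N p.2.1⟫| * maxwellian p.2.2 * g p ^ 2) μ) :
    Integrable (fun p => maxwellian p.2.2 * ⟪p.2.2, N p.2.1⟫ * f p * g p) μ := by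
  have hc : Measurable fun p : X × Vec d × Vec d => maxwellian p.2.2 * ⟪p.2.2, N p.2.1⟫ := by
    fun_prop
  refine integrable_mul_mul (μ := μ) (f := f) (g := g) (c := fun p => maxwellian p.2.2 * ⟪p.2.2, N p.2.1⟫)
    (w₁ := fun p => |⟪p.2.2, N p.2.1⟫| * maxwellian p.2.2)
    (w₂ := fun p => |⟪p.2.2, N p.2.1⟫| * maxwellian p.2.2)
    hc.aestronglyMeasurable hf.aestronglyMeasurable hg.aestronglyMeasurable
    (fun p => ?_) (fun p => ?_) (fun p => le_of_eq ?_) hfi hgi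
  · exact mul_nonneg (abs_nonneg _) (maxwellian_nonneg _)
  · exact mul_nonneg (abs_nonneg _) (maxwellian_nonneg _)
  · rw [mul_pow, ← sq_abs ⟪p.2.2, N p.2.1⟫]
    ring

namespace IsSolution

lemma integrable_profile_mul (hs : IsSolution Ω N β θ α g γ) {κ : Vec d → ℝ} (ho : IsOpen Ω)
    (hb : Bornology.IsBounded Ω) (hκ : Continuous κ) {t : ℝ} (ht : 0 ≤ t) :
    Integrable (fun p => maxwellian p.2 * (κ p.1 * heatProfile p.2) * g t p.1 p.2)
      (spaceBase Ω) :=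
  integrable_mul_mul (c := fun p : Vec d × Vec d => maxwellian p.2)
    (f := fun p => κ p.1 * heatProfile p.2) (g := fun p => g t p.1 p.2)
    (w₁ := fun p => maxwellian p.2) (w₂ := fun p => maxwellian p.2)
    (Measurable.aestronglyMeasurable (by fun_prop)) (Measurable.aestronglyMeasurable (by fun_prop))
    (hs.measurable_at t).aestronglyMeasurable (fun p => maxwellian_nonneg p.2)
    (fun p => maxwellian_nonneg p.2) (fun p => (sq (maxwellian p.2)).le)
    (integrable_profile_sq ho hb hκ) (hs.integrable_sq ht)

lemma integrable_mul_linColl (hs : IsSolution Ω N β θ α g γ) (hβ : IsSymKernel β) (hd : d ≠ 0)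
    (t : ℝ) :
    Integrable (fun p => maxwellian p.2.2 * g p.1 p.2.1 p.2.2 * linColl β (g p.1 p.2.1) p.2.2)
      (timeBase 0 t Ω) :=
  integrable_freq_mul hβ hd hs.measurable (hs.measurable_linColl hβ)
    (hs.integrable_freq_sq hβ t) (hs.integrable_linColl_sq hβ hd t)

lemma integrable_profile_mul_linColl (hs : IsSolution Ω N β θ α g γ) {κ : Vec d → ℝ}
    (ho : IsOpen Ω) (hb : Bornology.IsBounded Ω) (hκ : Continuous κ) (hβ : IsSymKernel β)
    (hd : d ≠ 0) (t : ℝ) :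
    Integrable (fun p => maxwellian p.2.2 * (κ p.2.1 * heatProfile p.2.2) *
      linColl β (g p.1 p.2.1) p.2.2) (timeBase 0 t Ω) :=
  integrable_freq_mul (f := fun p => κ p.2.1 * heatProfile p.2.2) hβ hd (by fun_prop)
    (hs.measurable_linColl hβ) (integrable_freq_profile_sq ho hb hκ hβ 0 t)
    (hs.integrable_linColl_sq hβ hd t)

lemma integrable_flux_mul (hs : IsSolution Ω N β θ α g γ) (ho : IsOpen Ω)
    (hb : Bornology.IsBounded Ω) {e : Vec d → Vec d} (he : Continuous e) (hβ : IsSymKernel β)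
    (hd : d ≠ 0) (t : ℝ) :
    Integrable (fun p => maxwellian p.2.2 * (⟪p.2.2, e p.2.1⟫ * heatProfile p.2.2) *
      g p.1 p.2.1 p.2.2) (timeBase 0 t Ω) := by
  have hem := he.measurable
  refine (integrable_freq_mul (g := fun p => ⟪p.2.2, e p.2.1⟫ * heatProfile p.2.2) hβ hd
    hs.measurable (by fun_prop) (hs.integrable_freq_sq hβ t)
    (integrable_inv_freq_flux_sq ho hb he hβ hd 0 t)).congr (Eventually.of_forall fun p => ?_)
  simp only
  ring

lemma integrable_trace_flux [IsFiniteMeasure (surfaceMeasure Ω)]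
    (hs : IsSolution Ω N β θ α g γ) (hN : Measurable N) (t : ℝ) :
    Integrable (fun p => maxwellian p.2.2 * ⟪p.2.2, N p.2.1⟫ * γ p.1 p.2.1 p.2.2 ^ 2)
      (boundaryBase 0 t Ω) := by
  have h := integrable_wall_mul hN hs.measurable_trace hs.measurable_trace
    (hs.integrable_trace_sq hN t) (hs.integrable_trace_sq hN t)
  simpa only [sq, mul_assoc] using h

lemma integrable_profile_mul_trace [IsFiniteMeasure (surfaceMeasure Ω)]
    (hs : IsSolution Ω N β θ α g γ) {κ : Vec d → ℝ} (hb : Bornology.IsBounded Ω)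
    (hκ : Continuous κ) (hN : Measurable N) (hN1 : ∀ x, ‖N x‖ = 1) (t : ℝ) :
    Integrable (fun p => maxwellian p.2.2 * ⟪p.2.2, N p.2.1⟫ * (κ p.2.1 * heatProfile p.2.2) *
      γ p.1 p.2.1 p.2.2) (boundaryBase 0 t Ω) :=
  integrable_wall_mul (f := fun p => κ p.2.1 * heatProfile p.2.2) hN (by fun_prop)
    hs.measurable_trace (integrable_wall_profile_sq hb hκ hN hN1 0 t) (hs.integrable_trace_sq hN t)

/-- Green's formula against the profile `θ(x) (|v|² - (d + 2)) / 2`. -/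
lemma profile_identity [IsFiniteMeasure (surfaceMeasure Ω)] (hs : IsSolution Ω N β θ α g γ)
    (ho : IsOpen Ω) (hb : Bornology.IsBounded Ω)
    (hθ : ContDiff ℝ (⊤ : ℕ∞) θ) (hβ : IsSymKernel β) (hd : d ≠ 0) (hN : Measurable N)
    (hN1 : ∀ x, ‖N x‖ = 1) {t : ℝ} (ht : 0 ≤ t) :
    α * (∫ p, maxwellian p.2 * (θ p.1 * heatProfile p.2) * g t p.1 p.2 ∂(spaceBase Ω))
      - α * (∫ p, maxwellian p.2 * (θ p.1 * heatProfile p.2) * g 0 p.1 p.2 ∂(spaceBase Ω))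
    = (∫ p, maxwellian p.2.2 * (⟪p.2.2, gradient θ p.2.1⟫ * heatProfile p.2.2) *
        g p.1 p.2.1 p.2.2 ∂(timeBase 0 t Ω))
      - α⁻¹ * (∫ p, maxwellian p.2.2 * (θ p.2.1 * heatProfile p.2.2) *
        linColl β (g p.1 p.2.1) p.2.2 ∂(timeBase 0 t Ω))
      - ∫ p, maxwellian p.2.2 * ⟪p.2.2, N p.2.1⟫ * (θ p.2.1 * heatProfile p.2.2) *
        γ p.1 p.2.1 p.2.2 ∂(boundaryBase 0 t Ω) := by
  obtain ⟨r, hr, hrΩ⟩ := exists_norm_le_closure hb continuous_id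
  set R := max r t + 1 with hRdef
  have hR : 0 < R := by positivity
  choose φ hφ hφ' using exists_truncation hθ (contDiff_heatProfile (d := d)) hR α
  have htime : ∀ s ∈ Set.Icc 0 t, |s| < R := fun s hst => by
    rw [abs_of_nonneg hst.1]
    linarith [hst.2, le_max_right r t]
  have hspace : ∀ x ∈ closure Ω, ‖x‖ < R := fun x hx =>
    lt_of_le_of_lt (hrΩ x hx) (by linarith [le_max_left r t])
  have ae1 : ∀ᵐ p ∂(timeBase 0 t Ω), |p.1| < R ∧ ‖p.2.1‖ < R :=
    (ae_time_mem ho 0 t).mono fun p hp => ⟨htime _ hp.1, hspace _ (subset_closure hp.2)⟩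
  have ae2 : ∀ᵐ p ∂(boundaryBase 0 t Ω), |p.1| < R ∧ ‖p.2.1‖ < R :=
    (ae_boundary_mem 0 t).mono fun p hp => ⟨htime _ hp.1, hspace _ (frontier_subset_closure hp.2)⟩
  have hg := continuous_gradient hθ
  have l4 : ∀ s ∈ Set.Icc 0 t, _ := fun s hst =>
    tendsto_integral_truncation (μ := spaceBase Ω) (w := fun p => p.2)
      (c := fun p => maxwellian p.2) (f := fun p => θ p.1 * heatProfile p.2)
      (g := fun p => g s p.1 p.2) (φ := fun k p => φ k (s, p)) measurable_snd
      (hs.integrable_profile_mul ho hb hθ.continuous hst.1)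
      (fun k => (ae_space_mem ho).mono fun p hp =>
        (hφ' k (s, p) (htime s hst) (hspace _ (subset_closure hp))).1)
  have l1 := tendsto_integral_truncation (μ := timeBase 0 t Ω) (w := fun p => p.2.2)
    (c := fun p => maxwellian p.2.2) (f := fun p => θ p.2.1 * heatProfile p.2.2)
    (g := fun p => linColl β (g p.1 p.2.1) p.2.2) (φ := φ) (by fun_prop)
    (hs.integrable_profile_mul_linColl ho hb hθ.continuous hβ hd t)
    (fun k => ae1.mono fun p hp => (hφ' k p hp.1 hp.2).1)
  have l2 := tendsto_integral_truncation (μ := timeBase 0 t Ω) (w := fun p => p.2.2)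
    (c := fun p => maxwellian p.2.2) (f := fun p => ⟪p.2.2, gradient θ p.2.1⟫ * heatProfile p.2.2)
    (g := fun p => g p.1 p.2.1 p.2.2) (φ := fun k => transport α (φ k)) (by fun_prop)
    (hs.integrable_flux_mul ho hb hg hβ hd t)
    (fun k => ae1.mono fun p hp => (hφ' k p hp.1 hp.2).2)
  have l3 := tendsto_integral_truncation (μ := boundaryBase 0 t Ω) (w := fun p => p.2.2)
    (c := fun p => maxwellian p.2.2 * ⟪p.2.2, N p.2.1⟫)
    (f := fun p => θ p.2.1 * heatProfile p.2.2)
    (g := fun p => γ p.1 p.2.1 p.2.2) (φ := φ) (by fun_prop)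
    (hs.integrable_profile_mul_trace hb hθ.continuous hN hN1 t)
    (fun k => ae2.mono fun p hp => (hφ' k p hp.1 hp.2).1)
  exact tendsto_nhds_unique (((l4 t ⟨ht, le_rfl⟩).const_mul α).sub
    ((l4 0 ⟨le_rfl, ht⟩).const_mul α))
    (((l2.sub (l1.const_mul α⁻¹)).sub l3).congr fun k => (hs.green_base (hφ k) ht).symm)

end IsSolution

end Linear

/-! ### The modulated entropy inequality -/

section Modulated

variable {d : ℕ} {Ω : Set (Vec d)} {N : Vec d → Vec d} {β : Vec d → Vec d → ℝ} {θ : Vec d → ℝ}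
  {α : ℝ} {g γ : ℝ → Vec d → Vec d → ℝ}

/-- Mass and energy are collision invariants. -/
lemma linColl_sub_profile (β : Vec d → Vec d → ℝ) (h : Vec d → ℝ) (a : ℝ) (v : Vec d) :
    linColl β (fun w => h w - a * heatProfile w) v = linColl β h v := by
  unfold linColl
  congr 1
  ext p
  have h1 := norm_sq_postVel_add (v := v) (w := p.1) (norm_sph p.2)
  simp only [heatProfile]
  linear_combination a / 2 * maxwellian p.1 * β (v - p.1) p.2 * h1

lemma sq_sub_le (x y : ℝ) : (x - y) ^ 2 ≤ 2 * x ^ 2 + 2 * y ^ 2 := by nlinarith [sq_nonneg (x + y)]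

lemma integrable_mul_sub_sq {X : Type*} [MeasurableSpace X] {μ : Measure X} {w f h : X → ℝ}
    (hw : Measurable w) (hf : Measurable f) (hh : Measurable h) (hw0 : ∀ x, 0 ≤ w x)
    (hfi : Integrable (fun x => w x * f x ^ 2) μ) (hhi : Integrable (fun x => w x * h x ^ 2) μ) :
    Integrable (fun x => w x * (f x - h x) ^ 2) μ := by
  refine ((hfi.const_mul 2).add (hhi.const_mul 2)).mono'
    (Measurable.aestronglyMeasurable (by fun_prop)) (Eventually.of_forall fun x => ?_)
  have h1 := hw0 x
  rw [Real.norm_of_nonneg (by positivity), Pi.add_apply]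
  have h2 := mul_le_mul_of_nonneg_left (sq_sub_le (f x) (h x)) h1
  linarith

lemma integrable_freq_heatProfile_sq (hβ : IsSymKernel β) (a : ℝ) :
    Integrable fun v => collisionFrequency β v * maxwellian v * (a * heatProfile v) ^ 2 := by
  obtain ⟨A, hA, k, hAk⟩ := hβ.exists_collisionFrequency_le
  have hm := hβ.measurable_collisionFrequency
  have ha := hβ.collisionFrequency_nonneg
  refine (integrable_maxwellian_mul (f := fun v => collisionFrequency β v * (a * heatProfile v) ^ 2)
    (Measurable.aestronglyMeasurable (by fun_prop)) (C := A * (|a| ^ 2 * (d + 2) ^ 2)) (k := k + 4)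
    fun v => ?_).congr (Eventually.of_forall fun v => by ring)
  rw [abs_of_nonneg (mul_nonneg (ha _) (sq_nonneg _))]
  calc _ ≤ A * (1 + ‖v‖) ^ k * (|a| ^ 2 * (d + 2) ^ 2 * (1 + ‖v‖) ^ 4) :=
        mul_le_mul (hAk _) (sq_mul_heatProfile_le le_rfl _) (sq_nonneg _) (by positivity)
    _ = _ := by ring

/-- The heat flux of `h` is controlled by the dissipation of its modulation. -/
lemma IsSymKernel.neg_heatFlux_le (hβ : IsSymKernel β) {K : ℝ}
    (hK : ∀ (e : Vec d) (h : Vec d → ℝ), Measurable h →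
      Integrable (fun v => collisionFrequency β v * maxwellian v * h v ^ 2) → ∀ r > 0,
      2 * |∫ v, maxwellian v * (⟪v, e⟫ * ((‖v‖ ^ 2 - (d + 2)) / 2) * h v)| ≤
        r * (∫ v, maxwellian v * (h v * linColl β h v)) + r⁻¹ * (K * ‖e‖ ^ 2))
    {h : Vec d → ℝ} (hh : Measurable h)
    (hi : Integrable fun v => collisionFrequency β v * maxwellian v * h v ^ 2) {e : Vec d} (a : ℝ)
    (hf : Integrable fun v => maxwellian v * (⟪v, e⟫ * heatProfile v) * h v) (hα : 0 < α) :
    -2 * (∫ v, maxwellian v * (⟪v, e⟫ * heatProfile v) * h v) ≤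
      α⁻¹ * (∫ v, maxwellian v * ((h v - a * heatProfile v) * linColl β h v)) +
        α * (K * ‖e‖ ^ 2) := by
  have hm := hβ.measurable_collisionFrequency
  have hi' : Integrable fun v => collisionFrequency β v * maxwellian v *
      (h v - a * heatProfile v) ^ 2 :=
    integrable_mul_sub_sq (by fun_prop) hh (by fun_prop)
      (fun v => mul_nonneg (hβ.collisionFrequency_nonneg v) (maxwellian_nonneg v)) hi
      (integrable_freq_heatProfile_sq hβ a)
  have key := hK e (fun v => h v - a * heatProfile v) (by fun_prop) hi' α⁻¹ (by positivity)
  simp only [linColl_sub_profile, inv_inv] at key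
  have h0 : Integrable fun v : Vec d => maxwellian v * (⟪v, e⟫ * heatProfile v ^ 2) := by
    refine integrable_maxwellian_mul (Continuous.aestronglyMeasurable (by fun_prop))
      (C := ‖e‖ * (d + 2) ^ 2) (k := 5) fun v => ?_
    rw [abs_mul, abs_pow]
    have h1 := abs_heatProfile_le v
    have h2 : |⟪v, e⟫| ≤ (1 + ‖v‖) * ‖e‖ :=
      (abs_real_inner_le_norm v e).trans (by gcongr; linarith)
    calc _ ≤ (1 + ‖v‖) * ‖e‖ * ((d + 2) * (1 + ‖v‖) ^ 2) ^ 2 := by gcongr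
      _ = _ := by ring
  have h1 : ∫ v, maxwellian v * (⟪v, e⟫ * ((‖v‖ ^ 2 - (d + 2)) / 2) * (h v - a * heatProfile v)) =
      ∫ v, maxwellian v * (⟪v, e⟫ * heatProfile v) * h v := by
    have h2 : ∀ v, maxwellian v * (⟪v, e⟫ * ((‖v‖ ^ 2 - (d + 2)) / 2) * (h v - a * heatProfile v)) =
        maxwellian v * (⟪v, e⟫ * heatProfile v) * h v -
          a * (maxwellian v * (⟪v, e⟫ * heatProfile v ^ 2)) := fun v => by
      unfold heatProfile
      ring
    simp_rw [h2]
    rw [integral_sub hf (h0.const_mul a), integral_const_mul,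
      integral_maxwellian_mul_eq_zero fun v => by rw [heatProfile_neg, inner_neg_left]; ring]
    ring
  rw [h1] at key
  refine le_trans ?_ key
  linarith [neg_abs_le (∫ v, maxwellian v * (⟪v, e⟫ * heatProfile v) * h v)]

namespace IsSolution

lemma neg_flux_le (hs : IsSolution Ω N β θ α g γ) (ho : IsOpen Ω) (hb : Bornology.IsBounded Ω)
    (hθ : ContDiff ℝ (⊤ : ℕ∞) θ) (hβ : IsSymKernel β) (hd : d ≠ 0) (hα : 0 < α) {K E : ℝ}
    (hK0 : 0 ≤ K) (hE : ∀ x ∈ closure Ω, ‖gradient θ x‖ ≤ E)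
    (hK : ∀ (e : Vec d) (h : Vec d → ℝ), Measurable h →
      Integrable (fun v => collisionFrequency β v * maxwellian v * h v ^ 2) → ∀ r > 0,
      2 * |∫ v, maxwellian v * (⟪v, e⟫ * ((‖v‖ ^ 2 - (d + 2)) / 2) * h v)| ≤
        r * (∫ v, maxwellian v * (h v * linColl β h v)) + r⁻¹ * (K * ‖e‖ ^ 2)) (t : ℝ) :
    -2 * (∫ p, maxwellian p.2.2 * (⟪p.2.2, gradient θ p.2.1⟫ * heatProfile p.2.2) *
        g p.1 p.2.1 p.2.2 ∂(timeBase 0 t Ω)) ≤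
      α⁻¹ * (∫ p, maxwellian p.2.2 * ((g p.1 p.2.1 p.2.2 - θ p.2.1 * heatProfile p.2.2) *
        linColl β (g p.1 p.2.1) p.2.2) ∂(timeBase 0 t Ω)) +
      α * (K * E ^ 2) * ∫ p, maxwellian p.2.2 ∂(timeBase 0 t Ω) := by
  have := isFiniteMeasure_restrict hb
  have hi1 := hs.integrable_flux_mul ho hb (continuous_gradient hθ) hβ hd t
  have hi2 : Integrable (fun p => maxwellian p.2.2 * ((g p.1 p.2.1 p.2.2 -
      θ p.2.1 * heatProfile p.2.2) * linColl β (g p.1 p.2.1) p.2.2)) (timeBase 0 t Ω) := by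
    refine ((hs.integrable_mul_linColl hβ hd t).sub (hs.integrable_profile_mul_linColl ho hb
      hθ.continuous hβ hd t)).congr (Eventually.of_forall fun p => ?_)
    simp only [Pi.sub_apply]
    ring
  have hi3 : Integrable (fun p => maxwellian p.2.2) (timeBase 0 t Ω) :=
    (integrable_maxwellian.comp_snd _).comp_snd _
  have hi4 := hi2.const_mul α⁻¹
  have hi5 := hi3.const_mul (α * (K * E ^ 2))
  rw [← integral_const_mul, ← integral_const_mul, ← integral_const_mul, ← integral_add hi4 hi5]
  refine integral_le_of_fiber (hi1.const_mul (-2)) (hi4.add hi5) ?_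
  have hx : ∀ᵐ s ∂(volume.restrict (Set.Icc 0 t)), ∀ᵐ x ∂(volume.restrict Ω), x ∈ Ω :=
    Eventually.of_forall fun _ => ae_restrict_mem ho.measurableSet
  filter_upwards [hx, ae_ae_integrable_of_prod_prod hi1, ae_ae_integrable_of_prod_prod hi2,
    ae_ae_integrable_of_prod_prod (hs.integrable_freq_sq hβ t)] with s k0 k1 k2 k3
  filter_upwards [k0, k1, k2, k3] with x j0 j1 j2 j3
  have key := hβ.neg_heatFlux_le hK (hs.measurable_section s x) j3 (θ x) j1 hα
  rw [integral_const_mul, integral_add (j2.const_mul _) (integrable_maxwellian.const_mul _),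
    integral_const_mul, integral_const_mul, integral_maxwellian, mul_one]
  refine key.trans ?_
  have := hE x (subset_closure j0)
  gcongr

end IsSolution

end Modulated

section Core

variable {d : ℕ} {Ω : Set (Vec d)} {N : Vec d → Vec d} {β : Vec d → Vec d → ℝ} {θ : Vec d → ℝ}
  {α : ℝ} {g γ : ℝ → Vec d → Vec d → ℝ}

lemma modulated_apply (θ : Vec d → ℝ) (h : ℝ → Vec d → Vec d → ℝ) (t : ℝ) (x v : Vec d) :
    modulated θ h t x v = h t x v - θ x * heatProfile v := rfl

lemma varianceDensity_eq (N : Vec d → Vec d) (h : ℝ → Vec d → Vec d → ℝ) (p : ℝ × Vec d × Vec d) :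
    varianceDensity N h p = (h p.1 p.2.1 p.2.2 - √(2 * Real.pi) *
      ∫ w, maxwellian w * max ⟪w, N p.2.1⟫ 0 * h p.1 p.2.1 w) ^ 2 := by
  rw [varianceDensity, integral_wallMeasure]

lemma measurable_varianceDensity (hN : Measurable N) {h : ℝ → Vec d → Vec d → ℝ}
    (hh : Measurable fun p : ℝ × Vec d × Vec d => h p.1 p.2.1 p.2.2) :
    Measurable (varianceDensity N h) := by
  have h1 : Measurable fun q : (ℝ × Vec d) × Vec d => h q.1.1 q.1.2 q.2 :=
    hh.comp (f := fun q : (ℝ × Vec d) × Vec d => (q.1.1, q.1.2, q.2)) (by fun_prop)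
  have h2 : Measurable fun q : (ℝ × Vec d) × Vec d =>
      maxwellian q.2 * max ⟪q.2, N q.1.2⟫ 0 * h q.1.1 q.1.2 q.2 := by fun_prop
  have h3 : Measurable fun y : ℝ × Vec d => ∫ w, maxwellian w * max ⟪w, N y.2⟫ 0 * h y.1 y.2 w :=
    (h2.stronglyMeasurable.integral_prod_right (ν := volume)).measurable
  have h4 : Measurable fun p : ℝ × Vec d × Vec d =>
      ∫ w, maxwellian w * max ⟪w, N p.2.1⟫ 0 * h p.1 p.2.1 w :=
    h3.comp (f := fun p : ℝ × Vec d × Vec d => (p.1, p.2.1)) (by fun_prop)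
  rw [funext (varianceDensity_eq N h)]
  exact (hh.sub (h4.const_mul _)).pow_const 2

namespace IsSolution

lemma measurable_modulated_trace (hs : IsSolution Ω N β θ α g γ) (hθ : Continuous θ) :
    Measurable fun p : ℝ × Vec d × Vec d => modulated θ γ p.1 p.2.1 p.2.2 := by
  have := hs.measurable_trace
  simp only [modulated_apply]
  fun_prop

lemma ae_boundary (hs : IsSolution Ω N β θ α g γ) [IsFiniteMeasure (surfaceMeasure Ω)] (t : ℝ) :
    ∀ᵐ s ∂(volume.restrict (Set.Icc 0 t)), ∀ᵐ x ∂(surfaceMeasure Ω), ∀ᵐ v : Vec d,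
      ⟪v, N x⟫ < 0 → γ s x v = θ x * ((‖v‖ ^ 2 - (d + 1)) / 2) +
        √(2 * Real.pi) * ∫ w, maxwellian w * max ⟪w, N x⟫ 0 * γ s x w := by
  have h1 := Measure.ae_ae_of_ae_prod hs.boundary
  have h2 : ∀ᵐ s ∂(volume.restrict (Set.Icc 0 t)), ∀ᵐ q ∂((surfaceMeasure Ω).prod volume),
      ⟪q.2, N q.1⟫ < 0 → γ s q.1 q.2 = θ q.1 * ((‖q.2‖ ^ 2 - (d + 1)) / 2)
        + ∫ w, γ s q.1 w ∂(wallMeasure N q.1) := by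
    rw [← Measure.restrict_congr_set Ioc_ae_eq_Icc]
    exact ae_restrict_of_ae_restrict_of_subset Set.Ioc_subset_Ioi_self h1
  filter_upwards [h2] with s hs2
  filter_upwards [Measure.ae_ae_of_ae_prod hs2] with x hx
  filter_upwards [hx] with v hv h
  rw [← integral_wallMeasure]
  exact hv h

/-- The boundary term of the modulated entropy. -/
lemma variance (hs : IsSolution Ω N β θ α g γ) [IsFiniteMeasure (surfaceMeasure Ω)]
    (hb : Bornology.IsBounded Ω) (hθ : Continuous θ) (hN : Measurable N) (hN1 : ∀ x, ‖N x‖ = 1)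
    (t : ℝ) :
    Integrable (fun p => maxwellian p.2.2 * max ⟪p.2.2, N p.2.1⟫ 0 *
      varianceDensity N (modulated θ γ) p) (boundaryBase 0 t Ω) ∧
    ∫ p, maxwellian p.2.2 * max ⟪p.2.2, N p.2.1⟫ 0 * varianceDensity N (modulated θ γ) p
        ∂(boundaryBase 0 t Ω) =
      (∫ p, maxwellian p.2.2 * ⟪p.2.2, N p.2.1⟫ * γ p.1 p.2.1 p.2.2 ^ 2 ∂(boundaryBase 0 t Ω)) -
      2 * ∫ p, maxwellian p.2.2 * ⟪p.2.2, N p.2.1⟫ * (θ p.2.1 * heatProfile p.2.2) *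
        γ p.1 p.2.1 p.2.2 ∂(boundaryBase 0 t Ω) := by
  have hγ := hs.measurable_trace
  have hmod := hs.measurable_modulated_trace hθ
  have hvm := measurable_varianceDensity hN hmod
  have hsq : ∀ᵐ s ∂(volume.restrict (Set.Icc 0 t)), ∀ᵐ x ∂(surfaceMeasure Ω),
      Integrable fun v => |⟪v, N x⟫| * maxwellian v * γ s x v ^ 2 :=
    ae_ae_integrable_of_prod_prod (F := fun p : ℝ × Vec d × Vec d =>
      |⟪p.2.2, N p.2.1⟫| * maxwellian p.2.2 * γ p.1 p.2.1 p.2.2 ^ 2) (hs.integrable_trace_sq hN t)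
  have hpos : ∀ p : ℝ × Vec d × Vec d, 0 ≤ maxwellian p.2.2 * max ⟪p.2.2, N p.2.1⟫ 0 := fun p =>
    mul_nonneg (maxwellian_nonneg _) (le_max_right _ _)
  have hFm : Measurable fun p : ℝ × Vec d × Vec d => maxwellian p.2.2 *
    max ⟪p.2.2, N p.2.1⟫ 0 * varianceDensity N (modulated θ γ) p := by fun_prop
  have hGm : Measurable fun p : ℝ × Vec d × Vec d => |⟪p.2.2, N p.2.1⟫| * maxwellian p.2.2 *
    (γ p.1 p.2.1 p.2.2 - θ p.2.1 * heatProfile p.2.2) ^ 2 := by fun_prop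
  have hGi : Integrable (fun p : ℝ × Vec d × Vec d => |⟪p.2.2, N p.2.1⟫| * maxwellian p.2.2 *
      (γ p.1 p.2.1 p.2.2 - θ p.2.1 * heatProfile p.2.2) ^ 2) (boundaryBase 0 t Ω) :=
    integrable_mul_sub_sq (μ := boundaryBase 0 t Ω)
      (w := fun p : ℝ × Vec d × Vec d => |⟪p.2.2, N p.2.1⟫| * maxwellian p.2.2)
      (f := fun p => γ p.1 p.2.1 p.2.2) (h := fun p => θ p.2.1 * heatProfile p.2.2)
      (by fun_prop) hγ (by fun_prop) (fun p => mul_nonneg (abs_nonneg _) (maxwellian_nonneg _))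
      (hs.integrable_trace_sq hN t) (integrable_wall_profile_sq hb hθ hN hN1 0 t)
  have hvar : ∀ s x v, varianceDensity N (modulated θ γ) (s, x, v) =
      (γ s x v - θ x * heatProfile v - √(2 * Real.pi) *
        ∫ w, maxwellian w * max ⟪w, N x⟫ 0 * (γ s x w - θ x * heatProfile w)) ^ 2 := fun s x v => by
    rw [varianceDensity_eq]
    rfl
  have hFi : Integrable (fun p => maxwellian p.2.2 * max ⟪p.2.2, N p.2.1⟫ 0 *
      varianceDensity N (modulated θ γ) p) (boundaryBase 0 t Ω) := by
    refine integrable_of_fiber_le hFm (fun p => mul_nonneg (hpos p) (sq_nonneg _)) hGm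
      (fun p => mul_nonneg (mul_nonneg (abs_nonneg _) (maxwellian_nonneg _)) (sq_nonneg _)) hGi ?_
    filter_upwards [hsq] with s h1
    filter_upwards [h1] with x h2
    have hm := hs.measurable_trace_section s x
    have h3 := integrable_modulated_wall (hN1 x) hm h2 (θ x)
    have hm' : Measurable fun v => γ s x v - θ x * heatProfile v := by fun_prop
    have h4 := integral_posPart_variance (hN1 x) hm' h3 rfl
    simp only [hvar]
    refine ⟨h4.1, h4.2.le.trans ?_⟩
    refine (sub_le_self _ (by positivity)).trans ?_
    refine integral_mono (integrable_posPart_mul_sq hm' h3) h3 fun v => ?_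
    have h5 : max ⟪v, N x⟫ 0 ≤ |⟪v, N x⟫| := max_le (le_abs_self _) (abs_nonneg _)
    have h6 := maxwellian_nonneg v
    simp only
    rw [mul_comm (maxwellian v)]
    gcongr
  refine ⟨hFi, ?_⟩
  have i1 := hs.integrable_trace_flux hN t
  have i2 := (hs.integrable_profile_mul_trace hb hθ hN hN1 t).const_mul 2
  rw [← integral_const_mul, ← integral_sub i1 i2]
  refine integral_eq_of_fiber hFi (i1.sub i2) ?_
  filter_upwards [hsq, hs.ae_boundary t] with s h1 h1'
  filter_upwards [h1, h1'] with x h2 h2'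
  have key := integral_boundary_flux (hN1 x) (hs.measurable_trace_section s x) h2 h2' rfl
  simp only [hvar]
  rw [← key]
  congr 1
  ext v
  ring

end IsSolution

end Core

section Conclusion

variable {d : ℕ} {Ω : Set (Vec d)} {N : Vec d → Vec d} {β : Vec d → Vec d → ℝ} {θ : Vec d → ℝ}
  {α : ℝ} {g γ : ℝ → Vec d → Vec d → ℝ}

lemma phaseMeasure_one :
    phaseMeasure Ω (fun _ => 1) =
      (spaceBase Ω).withDensity fun p => ENNReal.ofReal (maxwellian p.2) := by
  simpa using phaseMeasure_eq (Ω := Ω) (w := fun _ => 1) measurable_const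

lemma timeProd_phaseMeasure_one (t₁ t₂ : ℝ) :
    timeProd t₁ t₂ (phaseMeasure Ω fun _ => 1) =
      (timeBase t₁ t₂ Ω).withDensity fun p => ENNReal.ofReal (maxwellian p.2.2) := by
  simpa using timeProd_phaseMeasure (Ω := Ω) (w := fun _ => 1) measurable_const t₁ t₂

lemma timeProd_outgoingMeasure [IsFiniteMeasure (surfaceMeasure Ω)] (hN : Measurable N)
    (t₁ t₂ : ℝ) :
    timeProd t₁ t₂ (outgoingMeasure Ω N) = (boundaryBase t₁ t₂ Ω).withDensity fun p =>
      ENNReal.ofReal (√(2 * Real.pi) * max ⟪p.2.2, N p.2.1⟫ 0 * maxwellian p.2.2) :=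
  timeProd_boundaryMeasure (w := fun p => √(2 * Real.pi) * max ⟪p.2, N p.1⟫ 0) (by fun_prop) _ _

lemma dissipationDensity_modulated (β : Vec d → Vec d → ℝ) (θ : Vec d → ℝ)
    (g : ℝ → Vec d → Vec d → ℝ) (p : ℝ × Vec d × Vec d) :
    dissipationDensity β (modulated θ g) p =
      (g p.1 p.2.1 p.2.2 - θ p.2.1 * heatProfile p.2.2) * linColl β (g p.1 p.2.1) p.2.2 := by
  rw [← linColl_sub_profile β _ (θ p.2.1)]
  rfl

namespace IsSolution

lemma integrable_entropy (hs : IsSolution Ω N β θ α g γ) (ho : IsOpen Ω)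
    (hb : Bornology.IsBounded Ω) (hθ : Continuous θ) {t : ℝ} (ht : 0 ≤ t) :
    Integrable (fun p => maxwellian p.2 * (g t p.1 p.2 - θ p.1 * heatProfile p.2) ^ 2)
      (spaceBase Ω) :=
  integrable_mul_sub_sq (μ := spaceBase Ω) (w := fun p : Vec d × Vec d => maxwellian p.2)
    (f := fun p => g t p.1 p.2) (h := fun p => θ p.1 * heatProfile p.2) (by fun_prop)
    (hs.measurable_at t) (by fun_prop) (fun p => maxwellian_nonneg _) (hs.integrable_sq ht)
    (integrable_profile_sq ho hb hθ)

lemma entropy_eq (hs : IsSolution Ω N β θ α g γ) (ho : IsOpen Ω)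
    (hb : Bornology.IsBounded Ω) (hθ : Continuous θ) {t : ℝ} (ht : 0 ≤ t) :
    ∫ p, maxwellian p.2 * (g t p.1 p.2 - θ p.1 * heatProfile p.2) ^ 2 ∂(spaceBase Ω) =
      (∫ p, maxwellian p.2 * g t p.1 p.2 ^ 2 ∂(spaceBase Ω)) -
      2 * (∫ p, maxwellian p.2 * (θ p.1 * heatProfile p.2) * g t p.1 p.2 ∂(spaceBase Ω)) +
      ∫ p, maxwellian p.2 * (θ p.1 * heatProfile p.2) ^ 2 ∂(spaceBase Ω) := by
  have i1 := hs.integrable_sq ht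
  have i2 := (hs.integrable_profile_mul ho hb hθ ht).const_mul 2
  have i3 := integrable_profile_sq ho hb hθ
  have i12 : Integrable (fun p => maxwellian p.2 * g t p.1 p.2 ^ 2 -
      2 * (maxwellian p.2 * (θ p.1 * heatProfile p.2) * g t p.1 p.2)) (spaceBase Ω) := i1.sub i2
  rw [← integral_const_mul, ← integral_sub i1 i2, ← integral_add i12 i3]
  congr 1
  ext p
  ring

lemma entropy_le (hs : IsSolution Ω N β θ α g γ) (ho : IsOpen Ω)
    (hb : Bornology.IsBounded Ω) (hθ : Continuous θ) {t : ℝ} (ht : 0 ≤ t) :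
    ∫ p, maxwellian p.2 * (g t p.1 p.2 - θ p.1 * heatProfile p.2) ^ 2 ∂(spaceBase Ω) ≤
      2 * (∫ p, maxwellian p.2 * g t p.1 p.2 ^ 2 ∂(spaceBase Ω)) +
      2 * ∫ p, maxwellian p.2 * (θ p.1 * heatProfile p.2) ^ 2 ∂(spaceBase Ω) := by
  have i1 := (hs.integrable_sq ht).const_mul 2
  have i3 := (integrable_profile_sq ho hb hθ).const_mul 2
  rw [← integral_const_mul, ← integral_const_mul, ← integral_add i1 i3]
  refine integral_mono (hs.integrable_entropy ho hb hθ ht) (i1.add i3) fun p => ?_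
  simp only
  have h2 := mul_le_mul_of_nonneg_left (sq_sub_le (g t p.1 p.2) (θ p.1 * heatProfile p.2))
    (maxwellian_nonneg p.2)
  linarith

lemma integrable_dissipation (hs : IsSolution Ω N β θ α g γ) (ho : IsOpen Ω)
    (hb : Bornology.IsBounded Ω) (hθ : Continuous θ) (hβ : IsSymKernel β) (hd : d ≠ 0) (t : ℝ) :
    Integrable (fun p => maxwellian p.2.2 * ((g p.1 p.2.1 p.2.2 - θ p.2.1 * heatProfile p.2.2) *
      linColl β (g p.1 p.2.1) p.2.2)) (timeBase 0 t Ω) := by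
  refine ((hs.integrable_mul_linColl hβ hd t).sub (hs.integrable_profile_mul_linColl ho hb
    hθ hβ hd t)).congr (Eventually.of_forall fun p => ?_)
  simp only [Pi.sub_apply]
  ring

lemma dissipation_eq (hs : IsSolution Ω N β θ α g γ) (ho : IsOpen Ω)
    (hb : Bornology.IsBounded Ω) (hθ : Continuous θ) (hβ : IsSymKernel β) (hd : d ≠ 0) (t : ℝ) :
    ∫ p, maxwellian p.2.2 * ((g p.1 p.2.1 p.2.2 - θ p.2.1 * heatProfile p.2.2) *
      linColl β (g p.1 p.2.1) p.2.2) ∂(timeBase 0 t Ω) =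
    (∫ p, maxwellian p.2.2 * (g p.1 p.2.1 p.2.2 * linColl β (g p.1 p.2.1) p.2.2)
      ∂(timeBase 0 t Ω)) - ∫ p, maxwellian p.2.2 * (θ p.2.1 * heatProfile p.2.2) *
        linColl β (g p.1 p.2.1) p.2.2 ∂(timeBase 0 t Ω) := by
  have i1 := hs.integrable_mul_linColl hβ hd t
  have i2 := hs.integrable_profile_mul_linColl ho hb hθ hβ hd t
  simp only [mul_assoc] at i1 i2 ⊢
  rw [← integral_sub i1 i2]
  congr 1
  ext p
  ring

/-- The modulated entropy inequality. -/
lemma modulated_entropy_le (hs : IsSolution Ω N β θ α g γ) [IsFiniteMeasure (surfaceMeasure Ω)]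
    (ho : IsOpen Ω) (hb : Bornology.IsBounded Ω) (hθ : ContDiff ℝ (⊤ : ℕ∞) θ)
    (hβ : IsSymKernel β) (hd : d ≠ 0) (hN : Measurable N) (hN1 : ∀ x, ‖N x‖ = 1) (hα : 0 < α)
    {K E : ℝ} (hK0 : 0 ≤ K) (hE : ∀ x ∈ closure Ω, ‖gradient θ x‖ ≤ E)
    (hK : ∀ (e : Vec d) (h : Vec d → ℝ), Measurable h →
      Integrable (fun v => collisionFrequency β v * maxwellian v * h v ^ 2) → ∀ r > 0,
      2 * |∫ v, maxwellian v * (⟪v, e⟫ * ((‖v‖ ^ 2 - (d + 2)) / 2) * h v)| ≤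
        r * (∫ v, maxwellian v * (h v * linColl β h v)) + r⁻¹ * (K * ‖e‖ ^ 2))
    {t : ℝ} (ht : 0 ≤ t) :
    (∫ p, maxwellian p.2 * (g t p.1 p.2 - θ p.1 * heatProfile p.2) ^ 2 ∂(spaceBase Ω)) +
      α⁻¹ * α⁻¹ * (∫ p, maxwellian p.2.2 * ((g p.1 p.2.1 p.2.2 - θ p.2.1 * heatProfile p.2.2) *
        linColl β (g p.1 p.2.1) p.2.2) ∂(timeBase 0 t Ω)) +
      α⁻¹ * (∫ p, maxwellian p.2.2 * max ⟪p.2.2, N p.2.1⟫ 0 *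
        varianceDensity N (modulated θ γ) p ∂(boundaryBase 0 t Ω)) ≤
      2 * (∫ p, maxwellian p.2 * g 0 p.1 p.2 ^ 2 ∂(spaceBase Ω)) +
      2 * (∫ p, maxwellian p.2 * (θ p.1 * heatProfile p.2) ^ 2 ∂(spaceBase Ω)) +
      K * E ^ 2 * ∫ p, maxwellian p.2.2 ∂(timeBase 0 t Ω) := by
  have hθc := hθ.continuous
  have e1 := hs.energy hβ hd hN ht
  have e2 := hs.profile_identity ho hb hθ hβ hd hN hN1 ht
  have e3 := hs.neg_flux_le ho hb hθ hβ hd hα hK0 hE hK t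
  have e4 := hs.entropy_eq ho hb hθc ht
  have e5 := hs.entropy_eq ho hb hθc le_rfl
  have e6 := hs.entropy_le ho hb hθc le_rfl
  have e7 := hs.dissipation_eq ho hb hθc hβ hd t
  have e8 := (hs.variance hb hθc hN hN1 t).2
  set S := ∫ p, maxwellian p.2 * (g t p.1 p.2 - θ p.1 * heatProfile p.2) ^ 2 ∂(spaceBase Ω)
  set S₀ := ∫ p, maxwellian p.2 * (g 0 p.1 p.2 - θ p.1 * heatProfile p.2) ^ 2 ∂(spaceBase Ω)
  set D := ∫ p, maxwellian p.2.2 * ((g p.1 p.2.1 p.2.2 - θ p.2.1 * heatProfile p.2.2) *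
    linColl β (g p.1 p.2.1) p.2.2) ∂(timeBase 0 t Ω)
  set V := ∫ p, maxwellian p.2.2 * max ⟪p.2.2, N p.2.1⟫ 0 *
    varianceDensity N (modulated θ γ) p ∂(boundaryBase 0 t Ω)
  set m := ∫ p, maxwellian p.2.2 ∂(timeBase 0 t Ω)
  have key : α * (S + α⁻¹ * α⁻¹ * D + α⁻¹ * V) ≤ α * (S₀ + K * E ^ 2 * m) := by
    have h1 : α * (S + α⁻¹ * α⁻¹ * D + α⁻¹ * V) = α * S + α⁻¹ * D + V := by
      field_simp
    rw [h1, e7, e8]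
    rw [e7] at e3
    rw [e4, e5]
    linarith
  have := le_of_mul_le_mul_left key hα
  linarith

end IsSolution

/-- The bound for a measurable unit normal field and a symmetric kernel. -/
lemma exists_modulated_bound [IsFiniteMeasure (surfaceMeasure Ω)] (ho : IsOpen Ω)
    (hb : Bornology.IsBounded Ω) (hθ : ContDiff ℝ (⊤ : ℕ∞) θ) (hβ : IsSymKernel β) (hd : 2 ≤ d)
    (hN : Measurable N) (hN1 : ∀ x, ‖N x‖ = 1) (C₀ : ℝ) :
    ∃ C : ℝ → ℝ, ∀ α : ℝ, 0 < α → ∀ g γ : ℝ → Vec d → Vec d → ℝ, IsSolution Ω N β θ α g γ →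
      (∫ p, entropyDensity g 0 p ∂(phaseMeasure Ω fun _ => 1)) ≤ C₀ → ∀ t : ℝ, 0 ≤ t →
        Integrable (entropyDensity (modulated θ g) t) (phaseMeasure Ω fun _ => 1) ∧
        Integrable (dissipationDensity β (modulated θ g))
          (timeProd 0 t (phaseMeasure Ω fun _ => 1)) ∧
        Integrable (varianceDensity N (modulated θ γ)) (timeProd 0 t (outgoingMeasure Ω N)) ∧
        (∫ p, entropyDensity (modulated θ g) t p ∂(phaseMeasure Ω fun _ => 1))
          + 1 / α ^ 2 * (∫ p, dissipationDensity β (modulated θ g) p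
              ∂(timeProd 0 t (phaseMeasure Ω fun _ => 1)))
          + 1 / (α * √(2 * Real.pi)) * (∫ p, varianceDensity N (modulated θ γ) p
              ∂(timeProd 0 t (outgoingMeasure Ω N))) ≤ C t := by
  have hd0 : d ≠ 0 := by omega
  obtain ⟨K, hK0, hK⟩ := hβ.exists_heatFlux_le hd
  obtain ⟨E, hE0, hE⟩ := exists_norm_le_closure hb (continuous_gradient hθ)
  refine ⟨fun t => 2 * C₀ +
    2 * (∫ p, maxwellian p.2 * (θ p.1 * heatProfile p.2) ^ 2 ∂(spaceBase Ω)) +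
    K * E ^ 2 * ∫ p, maxwellian p.2.2 ∂(timeBase 0 t Ω), fun α hα g γ hs hC t ht => ?_⟩
  have key := hs.modulated_entropy_le ho hb hθ hβ hd0 hN hN1 hα hK0 hE hK ht
  have hV := (hs.variance hb hθ.continuous hN hN1 t).1
  have hM : ∀ p : Vec d × Vec d, 0 ≤ maxwellian p.2 := fun p => maxwellian_nonneg _
  have hM' : ∀ p : ℝ × Vec d × Vec d, 0 ≤ maxwellian p.2.2 := fun p => maxwellian_nonneg _
  have hW : ∀ p : ℝ × Vec d × Vec d,
      0 ≤ √(2 * Real.pi) * max ⟪p.2.2, N p.2.1⟫ 0 * maxwellian p.2.2 := fun p =>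
    mul_nonneg (mul_nonneg (Real.sqrt_nonneg _) (le_max_right _ _)) (maxwellian_nonneg _)
  have hWm : Measurable fun p : ℝ × Vec d × Vec d =>
      √(2 * Real.pi) * max ⟪p.2.2, N p.2.1⟫ 0 * maxwellian p.2.2 := by fun_prop
  have hWe : ∀ p : ℝ × Vec d × Vec d,
      √(2 * Real.pi) * max ⟪p.2.2, N p.2.1⟫ 0 * maxwellian p.2.2 *
        varianceDensity N (modulated θ γ) p = √(2 * Real.pi) * (maxwellian p.2.2 *
          max ⟪p.2.2, N p.2.1⟫ 0 * varianceDensity N (modulated θ γ) p) := fun p => by ring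
  rw [phaseMeasure_one, integral_withDensity_ofReal (by fun_prop) hM] at hC
  rw [timeProd_phaseMeasure_one, timeProd_outgoingMeasure hN, phaseMeasure_one,
    integrable_withDensity_ofReal (by fun_prop) hM,
    integrable_withDensity_ofReal (by fun_prop) hM', integrable_withDensity_ofReal hWm hW,
    integral_withDensity_ofReal (by fun_prop) hM, integral_withDensity_ofReal (by fun_prop) hM',
    integral_withDensity_ofReal hWm hW]
  simp only [hWe, dissipationDensity_modulated, integral_const_mul]
  refine ⟨hs.integrable_entropy ho hb hθ.continuous ht,
    hs.integrable_dissipation ho hb hθ.continuous hβ hd0 t, hV.const_mul _, ?_⟩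
  have h1 : ∀ V : ℝ, 1 / (α * √(2 * Real.pi)) * (√(2 * Real.pi) * V) = α⁻¹ * V := fun V => by
    have : √(2 * Real.pi) ≠ 0 := by positivity
    field_simp
  have h2 : 1 / α ^ 2 = α⁻¹ * α⁻¹ := by
    rw [one_div, sq, mul_inv]
  rw [h1, h2]
  have h3 : ∫ p, maxwellian p.2 * entropyDensity (modulated θ g) t p ∂(spaceBase Ω) =
      ∫ p, maxwellian p.2 * (g t p.1 p.2 - θ p.1 * heatProfile p.2) ^ 2 ∂(spaceBase Ω) := rfl
  rw [h3]
  refine key.trans ?_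
  have h4 : ∫ p, maxwellian p.2 * g 0 p.1 p.2 ^ 2 ∂(spaceBase Ω) ≤ C₀ := hC
  gcongr

end Conclusion

/-! ### Reduction to a measurable normal field and a symmetric kernel -/

section Reduction

variable {d : ℕ} {Ω : Set (Vec d)} {n N : Vec d → Vec d} {b : Vec d → Vec d → ℝ}
  {θ θ' : Vec d → ℝ} {α : ℝ} {g γ : ℝ → Vec d → Vec d → ℝ}

lemma ae_boundaryMeasure_mem (w : Vec d × Vec d → ℝ) :
    ∀ᵐ p ∂(boundaryMeasure Ω w), p.1 ∈ frontier Ω :=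
  (withDensity_absolutelyContinuous _ _).ae_le
    (Measure.quasiMeasurePreserving_fst.ae (p := fun x => x ∈ frontier Ω)
      (ae_restrict_mem isClosed_frontier.measurableSet))

lemma boundaryMeasure_congr {w w' : Vec d × Vec d → ℝ}
    (h : ∀ p : Vec d × Vec d, p.1 ∈ frontier Ω → w p = w' p) :
    boundaryMeasure Ω w = boundaryMeasure Ω w' := by
  refine withDensity_congr_ae ?_
  have : ∀ᵐ p ∂((surfaceMeasure Ω).prod (volume : Measure (Vec d))), p.1 ∈ frontier Ω :=
    Measure.quasiMeasurePreserving_fst.ae (p := fun x => x ∈ frontier Ω)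
      (ae_restrict_mem isClosed_frontier.measurableSet)
  filter_upwards [this] with p hp
  rw [h p hp]

lemma outgoingMeasure_congr (hN : ∀ x ∈ frontier Ω, N x = n x) :
    outgoingMeasure Ω N = outgoingMeasure Ω n :=
  boundaryMeasure_congr fun p hp => by rw [hN _ hp]

variable [IsFiniteMeasure (surfaceMeasure Ω)]

lemma ae_timeProd_mem (w : Vec d × Vec d → ℝ) (t₁ t₂ : ℝ) :
    ∀ᵐ p ∂(timeProd t₁ t₂ (boundaryMeasure Ω w)), p.2.1 ∈ frontier Ω := by
  have : SFinite (boundaryMeasure Ω w) := by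
    unfold boundaryMeasure
    infer_instance
  exact Measure.quasiMeasurePreserving_snd.ae (ae_boundaryMeasure_mem w)

lemma wallMeasure_congr {x : Vec d} (h : n x = N x) : wallMeasure n x = wallMeasure N x := by
  unfold wallMeasure
  rw [h]

lemma IsSolution.reduce (hs : IsSolution Ω n b θ' α g γ) (hb : IsCrossSection b)
    (hN : ∀ x ∈ frontier Ω, N x = n x) (hθ : ∀ x ∈ frontier Ω, θ x = θ' x) :
    IsSolution Ω N (symKernel b) θ α g γ := by
  have hL : ∀ (p : ℝ × Vec d × Vec d), linColl (symKernel b) (g p.1 p.2.1) p.2.2 =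
      linColl b (g p.1 p.2.1) p.2.2 := fun p => by
    rw [linColl_symKernel hb (hs.measurable_section p.1 p.2.1)]
  have ha := collisionFrequency_symKernel hb
  have hB : (boundaryMeasure Ω fun p => |⟪p.2, N p.1⟫|) =
      boundaryMeasure Ω fun p => |⟪p.2, n p.1⟫| :=
    boundaryMeasure_congr fun p hp => by rw [hN _ hp]
  refine ⟨hs.measurable, hs.measurable_trace, hs.memLp, ?_, ?_, ?_, ?_, ?_⟩
  · rw [ha]
    exact hs.memLp_freq
  · rw [hB]
    exact hs.memLp_trace
  · intro φ hφ t₁ t₂ h₁ h₂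
    have h3 : ∫ p, φ p * γ p.1 p.2.1 p.2.2 * ⟪p.2.2, N p.2.1⟫
          ∂(timeProd t₁ t₂ (boundaryMeasure Ω fun _ => 1)) =
        ∫ p, φ p * γ p.1 p.2.1 p.2.2 * ⟪p.2.2, n p.2.1⟫
          ∂(timeProd t₁ t₂ (boundaryMeasure Ω fun _ => 1)) := by
      refine integral_congr_ae ?_
      filter_upwards [ae_timeProd_mem (fun _ => 1) t₁ t₂] with p hp
      rw [hN _ hp]
    simp only [hL, h3]
    exact hs.green φ hφ t₁ t₂ h₁ h₂
  · have h1 : ∀ᵐ p : ℝ × Vec d × Vec d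
        ∂((volume.restrict (Set.Ioi 0)).prod ((surfaceMeasure Ω).prod volume)),
        p.2.1 ∈ frontier Ω :=
      ae_mem_of_prod (P := fun x => x ∈ frontier Ω) _ _
        (ae_restrict_mem isClosed_frontier.measurableSet)
    filter_upwards [hs.boundary, h1] with p hp hx
    rw [hN _ hx, hθ _ hx, wallMeasure_congr (hN _ hx)]
    exact hp
  · intro T
    simp only [hL, ha, hB]
    exact hs.strong T

lemma varianceDensity_ae_eq (hN : ∀ x ∈ frontier Ω, N x = n x) (h : ℝ → Vec d → Vec d → ℝ)
    (t₁ t₂ : ℝ) : varianceDensity N h =ᵐ[timeProd t₁ t₂ (outgoingMeasure Ω n)]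
      varianceDensity n h := by
  filter_upwards [ae_timeProd_mem (fun p => √(2 * Real.pi) * max ⟪p.2, n p.1⟫ 0) t₁ t₂] with p hp
  rw [varianceDensity, varianceDensity, wallMeasure_congr (hN _ hp)]

end Reduction

end LinBoltz

end

theorem mainTheorem2 (d : ℕ) (hd : 2 ≤ d)
    (Ω : Set (LinBoltz.Vec d)) (hΩ : LinBoltz.IsSmoothBoundedDomain Ω)
    (n : LinBoltz.Vec d → LinBoltz.Vec d)
    (hn : ∀ x ∈ frontier Ω, LinBoltz.IsOutwardUnitNormal Ω x (n x))
    (b : LinBoltz.Vec d → LinBoltz.Vec d → ℝ) (hb : LinBoltz.IsCrossSection b)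
    (θbar θtilde : LinBoltz.Vec d → ℝ) (hθ : ContDiff ℝ (⊤ : ℕ∞) θtilde)
    (hext : ∀ x ∈ frontier Ω, θtilde x = θbar x) (C₀ : ℝ) :
    ∃ C : ℝ → ℝ, ∀ α : ℝ, 0 < α → ∀ g γ : ℝ → LinBoltz.Vec d → LinBoltz.Vec d → ℝ,
      LinBoltz.IsSolution Ω n b θbar α g γ →
      (∫ p, LinBoltz.entropyDensity g 0 p ∂(LinBoltz.phaseMeasure Ω fun _ => 1)) ≤ C₀ →
      ∀ t : ℝ, 0 ≤ t →
        Integrable (LinBoltz.entropyDensity (LinBoltz.modulated θtilde g) t)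
          (LinBoltz.phaseMeasure Ω fun _ => 1) ∧
        Integrable (LinBoltz.dissipationDensity b (LinBoltz.modulated θtilde g))
          (LinBoltz.timeProd 0 t (LinBoltz.phaseMeasure Ω fun _ => 1)) ∧
        Integrable (LinBoltz.varianceDensity n (LinBoltz.modulated θtilde γ))
          (LinBoltz.timeProd 0 t (LinBoltz.outgoingMeasure Ω n)) ∧
        (∫ p, LinBoltz.entropyDensity (LinBoltz.modulated θtilde g) t p
            ∂(LinBoltz.phaseMeasure Ω fun _ => 1))
          + 1 / α ^ 2 * (∫ p, LinBoltz.dissipationDensity b (LinBoltz.modulated θtilde g) p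
              ∂(LinBoltz.timeProd 0 t (LinBoltz.phaseMeasure Ω fun _ => 1)))
          + 1 / (α * Real.sqrt (2 * Real.pi))
            * (∫ p, LinBoltz.varianceDensity n (LinBoltz.modulated θtilde γ) p
              ∂(LinBoltz.timeProd 0 t (LinBoltz.outgoingMeasure Ω n)))
          ≤ C t := by
  have hd0 : d ≠ 0 := by omega
  obtain ⟨N, hNm, hN1, hN⟩ := hΩ.exists_measurable_normal hd0 hn
  have := hΩ.isFiniteMeasure_surfaceMeasure
  obtain ⟨C, hC⟩ := LinBoltz.exists_modulated_bound (N := N) hΩ.isOpen hΩ.isBounded hθ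
    hb.symKernel hd hNm hN1 C₀
  refine ⟨C, fun α hα g γ hs h0 t ht => ?_⟩
  have key := hC α hα g γ (hs.reduce hb hN hext) h0 t ht
  have hdiss : LinBoltz.dissipationDensity (LinBoltz.symKernel b) (LinBoltz.modulated θtilde g) =
      LinBoltz.dissipationDensity b (LinBoltz.modulated θtilde g) := by
    ext p
    have hm : Measurable (LinBoltz.modulated θtilde g p.1 p.2.1) :=
      (hs.measurable_section p.1 p.2.1).sub
        (LinBoltz.continuous_heatProfile.measurable.const_mul (θtilde p.2.1))
    rw [LinBoltz.dissipationDensity, LinBoltz.linColl_symKernel hb hm]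
    rfl
  have hvar := LinBoltz.varianceDensity_ae_eq hN (LinBoltz.modulated θtilde γ) 0 t
  rw [hdiss, LinBoltz.outgoingMeasure_congr hN, integrable_congr hvar,
    integral_congr_ae hvar] at key
  exact key
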